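/- Call a topological space $X$ \emph{semi-locally contractible} if every open subset $U\subset X$ has a cover by open subsets $W_i\subset U$ such that each inclusion $W_i\hookrightarrow U$ is homotopic to a constant map. For an abelian group $A$, let $H^n(X;A)$ denote the singular cohomology of $X$, i.e. the $n$-th cohomology of the complex $\mathrm{Hom}(C_\bullet(X),A)$, where $C_\bullet(X)$ is the complex of singular chains of $X$ with integer coefficients, and let $H^n(X;\underline{A})$ denote the sheaf cohomology of $X$ with coefficients in the constant sheaf $\underline{A}$ with value $A$. \textbf{Theorem.} Let $n\ge 0$. For every semi-locally contractible topological space $X$ (not assumed to be paracompact or Hausdorff) and every abelian group $A$ there is an isomorphism $$\varphi_{X,A}\colon H^n(X;A)\;\xrightarrow{\ \cong\ }\;H^n(X;\underline{A}),$$ and these isomorphisms are natural in $X$ and in $A$: for every continuous map $f\colon X\to Y$ between semi-locally contractible spaces one has $\varphi_{X,A}\circ f^*=f^*\circ\varphi_{Y,A}$, and for every homomorphism $g\colon A\to B$ of abelian groups one has $\varphi_{X,B}\circ g_*=g_*\circ\varphi_{X,A}$. -/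

import Mathlib

open CategoryTheory Opposite TopologicalSpace

universe u

/-- A topological space `X` is semi-locally contractible if every open subset `U` of `X` is
covered by open subsets `W ⊆ U` which are contractible in `U`, i.e. such that the inclusion
`W ↪ U` is homotopic to a constant map. -/
def SemiLocallyContractible (X : Type u) [TopologicalSpace X] : Prop :=
  ∀ U : Opens X, ∃ S : Set (Opens X), sSup S = U ∧
    ∀ W ∈ S, ∃ h : (W : Set X) ⊆ U, (ContinuousMap.inclusion h).Nullhomotopic

/-- Comparison with Mathlib's formulation of the same notion by neighbourhoods. -/
theorem semiLocallyContractible_iff (X : Type u) [TopologicalSpace X] :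
    SemiLocallyContractible X ↔ LocallyContractibleSpace X := by
  constructor
  · intro H x U hU
    obtain ⟨S, hS, hW⟩ := H ⟨interior U, isOpen_interior⟩
    have hx : x ∈ sSup S := by rw [hS]; exact mem_interior_iff_mem_nhds.2 hU
    obtain ⟨W, hWS, hxW⟩ := Opens.mem_sSup.1 hx
    obtain ⟨h, hn⟩ := hW W hWS
    exact ⟨W, h.trans interior_subset, W.isOpen.mem_nhds hxW,
      hn.comp_right (ContinuousMap.inclusion interior_subset)⟩
  · intro H U
    refine ⟨{W | ∃ h : (W : Set X) ⊆ U, (ContinuousMap.inclusion h).Nullhomotopic},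
      le_antisymm (sSup_le fun W hW => hW.1) ?_, fun W hW => hW⟩
    intro x hx
    obtain ⟨V, hVU, hV, hn⟩ := H x U (U.isOpen.mem_nhds hx)
    exact Opens.mem_sSup.2 ⟨⟨interior V, isOpen_interior⟩, ⟨interior_subset.trans hVU,
      hn.comp_left (ContinuousMap.inclusion interior_subset)⟩, mem_interior_iff_mem_nhds.2 hV⟩

noncomputable section

/-! ### Singular cohomology -/

/-- The complex `C_•(X)` of singular chains with integral coefficients. -/
abbrev singularChains : TopCat.{u} ⥤ ChainComplex AddCommGrpCat.{u} ℕ :=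
  (AlgebraicTopology.singularChainComplexFunctor AddCommGrpCat.{u}).obj
    (AddCommGrpCat.of (ULift.{u} ℤ))

/-- The functor `Hom(-, A)` which sends a chain complex `C_•` of abelian groups to the cochain
complex `Hom(C_•, A)`. -/
abbrev dualComplex (A : AddCommGrpCat.{u}) :
    (ChainComplex AddCommGrpCat.{u} ℕ)ᵒᵖ ⥤
      HomologicalComplex AddCommGrpCat.{u} (ComplexShape.down ℕ).symm :=
  HomologicalComplex.opFunctor _ _ ⋙
    (preadditiveYoneda.obj A).mapHomologicalComplex (ComplexShape.down ℕ).symm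

/-- The complex `C^•(X; A) = Hom(C_•(X), A)` of singular cochains. -/
abbrev singularCochains (X : TopCat.{u}) (A : AddCommGrpCat.{u}) :
    HomologicalComplex AddCommGrpCat.{u} (ComplexShape.down ℕ).symm :=
  (dualComplex A).obj (op (singularChains.obj X))

/-- The singular cohomology group `H^n(X; A)`. -/
abbrev singularCohomology (X : TopCat.{u}) (A : AddCommGrpCat.{u}) (n : ℕ) : AddCommGrpCat.{u} :=
  (singularCochains X A).homology n

/-- The homomorphism `f^* : H^n(Y; A) → H^n(X; A)` induced by a continuous map `f : X → Y`. -/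
def singularCohomologyPullback {X Y : TopCat.{u}} (f : X ⟶ Y) (A : AddCommGrpCat.{u}) (n : ℕ) :
    singularCohomology Y A n ⟶ singularCohomology X A n :=
  HomologicalComplex.homologyMap ((dualComplex A).map (singularChains.map f).op) n

/-- The homomorphism `H^n(X; A) → H^n(X; B)` induced by a homomorphism `g : A → B`. -/
def singularCohomologyCoeff (X : TopCat.{u}) {A B : AddCommGrpCat.{u}} (g : A ⟶ B) (n : ℕ) :
    singularCohomology X A n ⟶ singularCohomology X B n :=
  HomologicalComplex.homologyMap
    ((NatTrans.mapHomologicalComplex (preadditiveYoneda.map g) (ComplexShape.down ℕ).symm).app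
      ((HomologicalComplex.opFunctor _ _).obj (op (singularChains.obj X)))) n

/-! ### Sheaf cohomology of constant sheaves -/

/-- The category of sheaves of abelian groups on `X`. -/
abbrev AbSheaf (X : TopCat.{u}) := Sheaf (Opens.grothendieckTopology X) AddCommGrpCat.{u}

/-- The functor which sends an abelian group `A` to the constant sheaf on `X` with value `A`. -/
abbrev constSheaf (X : TopCat.{u}) : AddCommGrpCat.{u} ⥤ AbSheaf X :=
  constantSheaf (Opens.grothendieckTopology X) AddCommGrpCat.{u}

/-- The cohomology group `H^n(X; A)` of the constant sheaf on `X` with value `A`. -/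
abbrev constSheafCohomology (X : TopCat.{u}) (A : AddCommGrpCat.{u}) (n : ℕ) :
    AddCommGrpCat.{u} :=
  (Sheaf.functorH (Opens.grothendieckTopology X) n).obj ((constSheaf X).obj A)

/-- The homomorphism `H^n(X; A) → H^n(X; B)` on cohomology of constant sheaves induced by a
homomorphism `g : A → B`. -/
def constSheafCohomologyCoeff (X : TopCat.{u}) {A B : AddCommGrpCat.{u}} (g : A ⟶ B) (n : ℕ) :
    constSheafCohomology X A n ⟶ constSheafCohomology X B n :=
  (Sheaf.functorH (Opens.grothendieckTopology X) n).map ((constSheaf X).map g)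

/-- The inverse image functor `f^{-1}` on sheaves of abelian groups. -/
abbrev inverseImage {X Y : TopCat.{u}} (f : X ⟶ Y) : AbSheaf Y ⥤ AbSheaf X :=
  TopCat.Sheaf.pullback AddCommGrpCat.{u} f

instance {X Y : TopCat.{u}} (f : X ⟶ Y) : (inverseImage f).IsLeftAdjoint :=
  (TopCat.Sheaf.pullbackPushforwardAdjunction AddCommGrpCat.{u} f).isLeftAdjoint

instance {X Y : TopCat.{u}} (f : X ⟶ Y) : Limits.PreservesFiniteLimits (inverseImage f) := by
  have : Limits.ReflectsLimits (forget AddCommGrpCat.{u}) :=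
    Limits.reflectsLimits_of_reflectsIsomorphisms
  exact Functor.sheafPullbackConstruction.preservesFiniteLimits _ _ _ _

instance {X Y : TopCat.{u}} (f : X ⟶ Y) : (inverseImage f).Additive :=
  Functor.additive_of_preserves_binary_products _

/-- The canonical isomorphism between the inverse image of a constant sheaf and the constant
sheaf with the same value: both functors are left adjoint to global sections on `X`. -/
def inverseImageConstIso {X Y : TopCat.{u}} (f : X ⟶ Y) :
    constSheaf Y ⋙ inverseImage f ≅ constSheaf X :=
  (((constantSheafAdj (Opens.grothendieckTopology Y) AddCommGrpCat.{u}
      (Limits.isTerminalTop : Limits.IsTerminal (⊤ : Opens Y))).comp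
    (TopCat.Sheaf.pullbackPushforwardAdjunction AddCommGrpCat.{u} f)).ofNatIsoRight
      (Iso.refl _)).leftAdjointUniq
    (constantSheafAdj (Opens.grothendieckTopology X) AddCommGrpCat.{u}
      (Limits.isTerminalTop : Limits.IsTerminal (⊤ : Opens X)))

/-- The homomorphism `f^* : H^n(Y; A) → H^n(X; A)` on cohomology of constant sheaves induced by a
continuous map `f : X → Y`. As sheaf cohomology is `Ext^n` from the constant sheaf `ℤ`, it is the
map `Ext^n(ℤ, A) → Ext^n(f^{-1} ℤ, f^{-1} A)` given by the exact functor `f^{-1}`, followed by the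
canonical identifications of `f^{-1} ℤ` and `f^{-1} A` with constant sheaves on `X`. -/
def constSheafCohomologyPullback {X Y : TopCat.{u}} (f : X ⟶ Y) (A : AddCommGrpCat.{u}) (n : ℕ) :
    constSheafCohomology Y A n ⟶ constSheafCohomology X A n :=
  AddCommGrpCat.ofHom <|
    (((Abelian.Ext.mk₀ ((inverseImageConstIso f).hom.app A)).postcomp _ (add_zero n)).comp
      ((Abelian.Ext.mk₀ ((inverseImageConstIso f).inv.app
        (AddCommGrpCat.of (ULift.{u} ℤ)))).precomp _ (zero_add n))).comp
      ((inverseImage f).mapExtAddHom ((constSheaf Y).obj (AddCommGrpCat.of (ULift.{u} ℤ)))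
        ((constSheaf Y).obj A) n)

end

/-!
The comparison is a cocycle construction, and its bijectivity is proved by dimension shifting in the
first variable of `Ext`.

Let `C^n` be the presheaf `U ↦ C^n(U; A)` of singular cochains on `X`, let `Z^n` be the presheaf of
cocycles, and let `L` be sheafification. On a semi-locally contractible space the cone construction
shows that cocycles of positive degree are locally coboundaries
(`isLocallyExact_cochainPresheafComplex`) and that `L Z^0` is the constant sheaf
(`isIso_sheafification_map_constToCocycles`). The short exact sequences `L Z^n ⟶ L C^n ⟶ L Z^{n+1}`
therefore splice to a class in `Ext^n(L Z^n, A)` (`iteratedExtClass`). A singular cocycle on `X` is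
a morphism of presheaves `ℤ ⟶ Z^n`, and pulling back this class along it gives an element of
`Ext^n(ℤ, A)`, which is the cohomology of the constant sheaf; coboundaries are
sent to zero (`cocycleToExt`, `cocycleClass`).

In order to see that the map from cohomology classes of cocycles to `Ext^n` is bijective, `ℤ` is
replaced by more general presheaves `G`. The classical argument, that the sheafification of `C^n` is
acyclic and that global cochains can be compared with its global sections, needs `X` to be
paracompact. Two facts serve as a substitute.

* Iterated barycentric subdivision shows that `Hom(N, C^•)` is acyclic for every presheaf `N` with
  vanishing sheafification (`isLocalComplex_cochainPresheafComplex`). A primitive of a cocycle `a`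
  is given by `∑ₖ a ∘ Sdᵏ ∘ T`, where `T` is the homotopy between the subdivision operator `Sd` and
  the identity. This sum is finite on each chain, because sections of `N` are locally zero and fine
  chains are supported on the members of a given open cover.
* If the coefficient group is injective, then so is the presheaf `C^n`, because a morphism to it is
  a family of homomorphisms from the stalks at all singular simplices (`injective_cochainPresheaf`).

Embed `A` in an injective group `J`, with quotient `K`. The presheaves `G` which are used are the
*good* ones, for which all morphisms from `G` to the cochains with values in `K` lift to cochains
with values in `J` (`IsGood`). Free presheaves are good and so are their subpresheaves, in
particular the constant presheaf `ℤ`. Along monomorphisms of good presheaves which become isomorphisms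
after sheafification, cocycles extend up to coboundaries, and a cocycle is a coboundary if its restriction
is (`LocalInjectiveResolution.exists_extension_succ`,
`LocalInjectiveResolution.exists_primitive`). As classes of positive degree in `Ext` vanish after
pulling back along a suitable epimorphism (`exists_epi_comp_ext_eq_zero`), induction on the degree
gives the bijectivity for all good `G` (`surjectiveInDegree_and_injectiveInDegree`).

Naturality holds because the extension classes are natural with respect to maps of complexes
(`cocycleToExt_comp_kernelMap`) and with respect to the exact inverse image functor
(`comp_cocycleToExt_eq_mapExactFunctor`).
-/

open Limits
open Abelian (Ext)

/-! ### Local complexes and good objects -/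

section LocalComplexes

universe v₁ v₂ u₁ u₂ w

variable {P : Type u₁} [Category.{v₁} P] [Abelian P] {S : Type u₂} [Category.{v₂} S] [Abelian S]

/-- A cochain complex `K` in `P` is local with respect to `L : P ⥤ S` if `Hom(N, K)` is acyclic
for all `N` which are killed by `L`. -/
def IsLocalComplex (L : P ⥤ S) (K : CochainComplex P ℕ) : Prop :=
  ∀ N : P, IsZero (L.obj N) →
    (∀ z : N ⟶ K.X 0, z ≫ K.d 0 1 = 0 → z = 0) ∧
    ∀ n (z : N ⟶ K.X (n + 1)), z ≫ K.d (n + 1) (n + 2) = 0 → ∃ t : N ⟶ K.X n, t ≫ K.d n (n + 1) = z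

/-- Given a map of complexes `v : J ⟶ K`, an object `G` is good if `Hom(G, J) → Hom(G, K)` is
surjective in every degree. If `J` consists of injective objects and `v` is an epimorphism with
kernel `A`, this says that `Ext¹(G, A^n) = 0` for all `n`. -/
def IsGood {J K : CochainComplex P ℕ} (v : J ⟶ K) (G : P) : Prop :=
  ∀ n (k : G ⟶ K.X n), ∃ j : G ⟶ J.X n, j ≫ v.f n = k

/-- Subobjects of good objects are good. -/
lemma IsGood.of_mono {J K : CochainComplex P ℕ} {v : J ⟶ K} (hK : ∀ n, Injective (K.X n))
    {G G' : P} (h : IsGood v G) (m : G' ⟶ G) [Mono m] : IsGood v G' := by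
  intro n k
  have := hK n
  obtain ⟨j, hj⟩ := h n (Injective.factorThru k m)
  exact ⟨m ≫ j, by rw [Category.assoc, hj, Injective.comp_factorThru]⟩

lemma isZero_obj_cokernel {L : P ⥤ S} [L.PreservesZeroMorphisms] [PreservesFiniteColimits L]
    {G G' : P} (m : G' ⟶ G) [Epi (L.map m)] : IsZero (L.obj (cokernel m)) := by
  have : Epi (L.map (cokernel.π m)) := inferInstance
  rw [IsZero.iff_id_eq_zero, ← cancel_epi (L.map (cokernel.π m)), ← cancel_epi (L.map m)]
  simp [← L.map_comp]

section Extension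

variable {L : P ⥤ S} [L.PreservesZeroMorphisms] [PreservesFiniteColimits L]
  {J : CochainComplex P ℕ} {G G' : P} (m : G' ⟶ G) [Mono m] [Epi (L.map m)]

/-- If `m` becomes an isomorphism under `L`, then cocycles on the source of `m` with values in a
local complex of injective objects extend to the target: the coboundary of an arbitrary extension
is a cocycle on the cokernel of `m`, where it has a primitive. -/
lemma IsLocalComplex.exists_extension (hJL : IsLocalComplex L J)
    (hJ : ∀ n, Injective (J.X n)) {n : ℕ} (z : G' ⟶ J.X n) (hz : z ≫ J.d n (n + 1) = 0) :
    ∃ z' : G ⟶ J.X n, z' ≫ J.d n (n + 1) = 0 ∧ m ≫ z' = z := by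
  have := hJ n
  let s := Injective.factorThru z m
  have hs : m ≫ s = z := Injective.comp_factorThru z m
  let t₀ := cokernel.desc m (s ≫ J.d n (n + 1)) (by rw [reassoc_of% hs, hz])
  have ht₀ : cokernel.π m ≫ t₀ = s ≫ J.d n (n + 1) := cokernel.π_desc _ _ _
  obtain ⟨t, ht⟩ := (hJL _ (isZero_obj_cokernel m)).2 n t₀ (by
    rw [← cancel_epi (cokernel.π m), reassoc_of% ht₀]; simp)
  refine ⟨s - cokernel.π m ≫ t, ?_, by simp [hs]⟩
  rw [Preadditive.sub_comp, Category.assoc, ht, ht₀, sub_self]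

/-- In the situation of `IsLocalComplex.exists_extension`, a primitive over the source of `m` of the
restriction of a cocycle extends to a primitive of that cocycle. -/
lemma IsLocalComplex.exists_primitive (hJL : IsLocalComplex L J) (hJ : ∀ n, Injective (J.X n))
    {n : ℕ} (z : G ⟶ J.X (n + 1))
    (hz : z ≫ J.d (n + 1) (n + 2) = 0) (s : G' ⟶ J.X n) (hs : s ≫ J.d n (n + 1) = m ≫ z) :
    ∃ s' : G ⟶ J.X n, s' ≫ J.d n (n + 1) = z ∧ m ≫ s' = s := by
  have := hJ n
  let s₀ := Injective.factorThru s m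
  have hs₀ : m ≫ s₀ = s := Injective.comp_factorThru s m
  let t₀ := cokernel.desc m (z - s₀ ≫ J.d n (n + 1)) (by
    rw [Preadditive.comp_sub, reassoc_of% hs₀, hs, sub_self])
  have ht₀ : cokernel.π m ≫ t₀ = z - s₀ ≫ J.d n (n + 1) := cokernel.π_desc _ _ _
  obtain ⟨t, ht⟩ := (hJL _ (isZero_obj_cokernel m)).2 n t₀ (by
    rw [← cancel_epi (cokernel.π m), reassoc_of% ht₀]; simp [hz])
  refine ⟨s₀ + cokernel.π m ≫ t, ?_, by simp [hs₀]⟩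
  rw [Preadditive.add_comp, Category.assoc, ht, ht₀, add_sub_cancel]

end Extension

/-- A short exact sequence `0 ⟶ A ⟶ J ⟶ K ⟶ 0` of complexes in `P`, where `J` and `K` consist of
injective objects and are local with respect to `L : P ⥤ S`. (Surjectivity of `J ⟶ K` is not
part of the data: it is only used on good objects, for which it is a condition on morphisms.) -/
structure LocalInjectiveResolution (L : P ⥤ S) (A : CochainComplex P ℕ) where
  /-- The complex of injective objects into which `A` is embedded. -/
  J : CochainComplex P ℕ
  /-- The quotient of `J` by `A`. -/
  K : CochainComplex P ℕ
  /-- The embedding of `A`. -/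
  i : A ⟶ J
  /-- The projection to the quotient. -/
  v : J ⟶ K
  mono_i : ∀ n, Mono (i.f n)
  zero : ∀ n, i.f n ≫ v.f n = 0
  exists_lift : ∀ n (G : P) (j : G ⟶ J.X n), j ≫ v.f n = 0 → ∃ a : G ⟶ A.X n, a ≫ i.f n = j
  injective_J : ∀ n, Injective (J.X n)
  injective_K : ∀ n, Injective (K.X n)
  isLocal_J : IsLocalComplex L J
  isLocal_K : IsLocalComplex L K

namespace LocalInjectiveResolution

attribute [instance] mono_i

variable {L : P ⥤ S} {A : CochainComplex P ℕ}

omit [Abelian S] in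
/-- Morphisms to `A^n` extend along monomorphisms with good cokernel. -/
lemma exists_extension_of_good (R : LocalInjectiveResolution L A) {T : ShortComplex P}
    (hT : T.ShortExact) (h : IsGood R.v T.X₃) {n : ℕ} (z : T.X₁ ⟶ A.X n) :
    ∃ z' : T.X₂ ⟶ A.X n, T.f ≫ z' = z := by
  have := R.injective_J n
  have := hT.mono_f
  have := hT.epi_g
  let s := Injective.factorThru (z ≫ R.i.f n) T.f
  have hs : T.f ≫ s = z ≫ R.i.f n := Injective.comp_factorThru _ _
  let g₀ := hT.exact.desc (s ≫ R.v.f n) (by rw [reassoc_of% hs, R.zero, comp_zero])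
  have hg₀ : T.g ≫ g₀ = s ≫ R.v.f n := hT.exact.g_desc _ _
  obtain ⟨g, hg⟩ := h n g₀
  obtain ⟨z', hz'⟩ := R.exists_lift n T.X₂ (s - T.g ≫ g) (by simp [hg, hg₀])
  refine ⟨z', ?_⟩
  rw [← cancel_mono (R.i.f n), Category.assoc, hz']
  simp [hs]

variable [L.PreservesZeroMorphisms] [PreservesFiniteColimits L] {G G' : P} (m : G' ⟶ G) [Mono m]
  [Epi (L.map m)]

/-- Cocycles of degree zero with values in `A` extend along `m`. -/
lemma exists_extension_zero (R : LocalInjectiveResolution L A) (z : G' ⟶ A.X 0)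
    (hz : z ≫ A.d 0 1 = 0) :
    ∃ z' : G ⟶ A.X 0, z' ≫ A.d 0 1 = 0 ∧ m ≫ z' = z := by
  obtain ⟨j, hj, hjz⟩ := R.isLocal_J.exists_extension m R.injective_J (z ≫ R.i.f 0) (by
    rw [Category.assoc, R.i.comm, reassoc_of% hz, zero_comp])
  let k := cokernel.desc m (j ≫ R.v.f 0) (by rw [reassoc_of% hjz, R.zero, comp_zero])
  have hk : cokernel.π m ≫ k = j ≫ R.v.f 0 := cokernel.π_desc _ _ _
  have hk0 : k = 0 := (R.isLocal_K _ (isZero_obj_cokernel m)).1 k (by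
    rw [← cancel_epi (cokernel.π m), reassoc_of% hk, R.v.comm, reassoc_of% hj]; simp)
  obtain ⟨z', hz'⟩ := R.exists_lift 0 G j (by rw [← hk, hk0, comp_zero])
  refine ⟨z', ?_, ?_⟩
  · rw [← cancel_mono (R.i.f 1), Category.assoc, ← R.i.comm, reassoc_of% hz', hj, zero_comp]
  · rw [← cancel_mono (R.i.f 0), Category.assoc, hz', hjz]

/-- Cocycles of positive degree with values in `A` extend along `m` up to coboundaries, if the
target of `m` is good. -/
lemma exists_extension_succ (R : LocalInjectiveResolution L A) (hG : IsGood R.v G) {n : ℕ}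
    (z : G' ⟶ A.X (n + 1))
    (hz : z ≫ A.d (n + 1) (n + 2) = 0) :
    ∃ (z' : G ⟶ A.X (n + 1)) (s : G' ⟶ A.X n), z' ≫ A.d (n + 1) (n + 2) = 0 ∧
      m ≫ z' = z + s ≫ A.d n (n + 1) := by
  obtain ⟨j, hj, hjz⟩ := R.isLocal_J.exists_extension m R.injective_J (z ≫ R.i.f _) (by
    rw [Category.assoc, R.i.comm, reassoc_of% hz, zero_comp])
  let k := cokernel.desc m (j ≫ R.v.f _) (by rw [reassoc_of% hjz, R.zero, comp_zero])
  have hk : cokernel.π m ≫ k = j ≫ R.v.f _ := cokernel.π_desc _ _ _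
  obtain ⟨t, ht⟩ := (R.isLocal_K _ (isZero_obj_cokernel m)).2 n k (by
    rw [← cancel_epi (cokernel.π m), reassoc_of% hk, R.v.comm, reassoc_of% hj]; simp)
  obtain ⟨r, hr⟩ := hG n (cokernel.π m ≫ t)
  obtain ⟨z', hz'⟩ := R.exists_lift _ G (j - r ≫ R.J.d n (n + 1)) (by
    simp only [Preadditive.sub_comp, Category.assoc, ← R.v.comm, reassoc_of% hr, ht, hk, sub_self])
  obtain ⟨s, hs⟩ := R.exists_lift _ G' (m ≫ r) (by
    rw [Category.assoc, hr, cokernel.condition_assoc, zero_comp])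
  refine ⟨z', -s, ?_, ?_⟩
  · rw [← cancel_mono (R.i.f _), Category.assoc, ← R.i.comm, reassoc_of% hz']
    simp [hj]
  · rw [← cancel_mono (R.i.f _), Category.assoc, hz']
    simp only [Preadditive.comp_sub, Preadditive.add_comp, Preadditive.neg_comp, Category.assoc,
      ← R.i.comm, reassoc_of% hs, hjz]
    abel

/-- A cocycle on a good object with values in `A` is a coboundary if its restriction along `m`
is. -/
lemma exists_primitive (R : LocalInjectiveResolution L A) (hG : IsGood R.v G) {n : ℕ}
    (z : G ⟶ A.X (n + 1))
    (hz : z ≫ A.d (n + 1) (n + 2) = 0) (s : G' ⟶ A.X n) (hs : s ≫ A.d n (n + 1) = m ≫ z) :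
    ∃ s' : G ⟶ A.X n, s' ≫ A.d n (n + 1) = z := by
  obtain ⟨j, hj, hjs⟩ := R.isLocal_J.exists_primitive m R.injective_J (z ≫ R.i.f _) (by
    rw [Category.assoc, R.i.comm, reassoc_of% hz, zero_comp]) (s ≫ R.i.f _) (by
    rw [Category.assoc, R.i.comm, reassoc_of% hs])
  let k := cokernel.desc m (j ≫ R.v.f _) (by rw [reassoc_of% hjs, R.zero, comp_zero])
  have hk : cokernel.π m ≫ k = j ≫ R.v.f _ := cokernel.π_desc _ _ _
  have hkd : k ≫ R.K.d n (n + 1) = 0 := by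
    rw [← cancel_epi (cokernel.π m), reassoc_of% hk, R.v.comm, reassoc_of% hj, R.zero]; simp
  suffices ∃ j' : G ⟶ R.J.X n, j' ≫ R.v.f n = 0 ∧ j' ≫ R.J.d n (n + 1) = z ≫ R.i.f _ by
    obtain ⟨j', h₁, h₂⟩ := this
    obtain ⟨s', hs'⟩ := R.exists_lift _ G j' h₁
    refine ⟨s', ?_⟩
    rw [← cancel_mono (R.i.f _), Category.assoc, ← R.i.comm, reassoc_of% hs', h₂]
  cases n with
  | zero =>
    have := (R.isLocal_K _ (isZero_obj_cokernel m)).1 k hkd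
    exact ⟨j, by rw [← hk, this, comp_zero], hj⟩
  | succ n =>
    obtain ⟨t, ht⟩ := (R.isLocal_K _ (isZero_obj_cokernel m)).2 n k hkd
    obtain ⟨r, hr⟩ := hG n (cokernel.π m ≫ t)
    refine ⟨j - r ≫ R.J.d n (n + 1), ?_, by simp [hj]⟩
    simp only [Preadditive.sub_comp, Category.assoc, ← R.v.comm, reassoc_of% hr, ht, hk, sub_self]

end LocalInjectiveResolution

/-! ### The extension class of a cocycle -/

section Effaceability

/-- Extension classes of positive degree are effaceable: they vanish after pulling back along a
suitable epimorphism. -/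
lemma exists_epi_comp_ext_eq_zero [HasExt.{w} S] [EnoughInjectives S] {n : ℕ} {X Y : S}
    (e : Ext X Y (n + 1)) :
    ∃ (Q : S) (q : Q ⟶ X), Epi q ∧ (Ext.mk₀ q).comp e (zero_add _) = 0 := by
  induction n generalizing Y with
  | zero =>
    have hT := ShortComplex.ShortExact.mk' (ShortComplex.exact_cokernel (Injective.ι Y))
      inferInstance inferInstance
    obtain ⟨x, rfl⟩ := Ext.covariant_sequence_exact₁ X hT e (Ext.eq_zero_of_injective _) rfl
    obtain ⟨f, rfl⟩ := (Ext.mk₀_bijective _ _).2 x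
    refine ⟨_, pullback.snd (cokernel.π (Injective.ι Y)) f, inferInstance, ?_⟩
    rw [← Ext.comp_assoc (a₁₂ := 0) _ _ _ (by lia) (by lia) (by lia), Ext.mk₀_comp_mk₀,
      ← pullback.condition, ← Ext.mk₀_comp_mk₀,
      Ext.comp_assoc (a₂₃ := 1) _ _ _ (by lia) (by lia) (by lia)]
    erw [hT.comp_extClass]
    exact Ext.comp_zero _ _ _ _ _
  | succ n ih =>
    have hT := ShortComplex.ShortExact.mk' (ShortComplex.exact_cokernel (Injective.ι Y))
      inferInstance inferInstance
    obtain ⟨x, rfl⟩ := Ext.covariant_sequence_exact₁ X hT e (Ext.eq_zero_of_injective _) rfl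
    obtain ⟨Q, q, hq, h⟩ := ih x
    refine ⟨Q, q, hq, ?_⟩
    rw [← Ext.comp_assoc (a₁₂ := n + 1) _ _ _ (by lia) (by lia) (by lia), h, Ext.zero_comp]

end Effaceability

/-- The differential `A.X n ⟶ A.X (n + 1)`, as a map to the cocycles in degree `n + 1`. -/
noncomputable def toCocycles (A : CochainComplex P ℕ) (n : ℕ) :
    A.X n ⟶ kernel (A.d (n + 1) (n + 2)) :=
  kernel.lift _ (A.d n (n + 1)) (by simp)

@[simp]
lemma toCocycles_ι (A : CochainComplex P ℕ) (n : ℕ) :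
    toCocycles A n ≫ kernel.ι _ = A.d n (n + 1) := kernel.lift_ι _ _ _

@[simp]
lemma ι_toCocycles (A : CochainComplex P ℕ) (n : ℕ) :
    kernel.ι (A.d n (n + 1)) ≫ toCocycles A n = 0 := by
  rw [← cancel_mono (kernel.ι _)]; simp

lemma cocycleSequence_exact (A : CochainComplex P ℕ) (n : ℕ) :
    (ShortComplex.mk _ _ (ι_toCocycles A n)).Exact := by
  rw [ShortComplex.exact_iff_exact_up_to_refinements]
  intro T x hx
  have hx' : x ≫ A.d n (n + 1) = 0 := by
    have hx₁ : x ≫ toCocycles A n = 0 := hx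
    simpa using hx₁ =≫ kernel.ι _
  exact ⟨T, 𝟙 T, inferInstance, kernel.lift _ x hx', (by simp : 𝟙 T ≫ x = _)⟩

section Comparison

variable (L : P ⥤ S) [L.PreservesZeroMorphisms] [PreservesFiniteLimits L]
  [PreservesFiniteColimits L] (A : CochainComplex P ℕ)

/-- The functor `L` makes the complex `A` exact in positive degrees. -/
abbrev IsLocallyExact : Prop := ∀ n, Epi (L.map (toCocycles A n))

/-- The image under `L` of the sequence `Z^n(A) ⟶ A^n ⟶ Z^{n+1}(A)` of cocycles and cochains. -/
noncomputable abbrev cocycleSequence (n : ℕ) : ShortComplex S :=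
  ShortComplex.mk (L.map (kernel.ι (A.d n (n + 1)))) (L.map (toCocycles A n))
    (by rw [← L.map_comp, ι_toCocycles, L.map_zero])

variable {L A}

lemma IsLocallyExact.shortExact (hA : IsLocallyExact L A) (n : ℕ) :
    (cocycleSequence L A n).ShortExact where
  exact := (cocycleSequence_exact A n).map L
  mono_f := inferInstanceAs (Mono (L.map (kernel.ι _)))
  epi_g := hA n

variable [HasExt.{w} S] (hA : IsLocallyExact L A) {B : S} (b : L.obj (kernel (A.d 0 1)) ⟶ B)

/-- The iterated Yoneda product of the classes of the extensions `Z^i ⟶ A^i ⟶ Z^{i+1}` for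
`i < n`, followed by a map `b : Z^0 ⟶ B`. -/
noncomputable def iteratedExtClass (n : ℕ) : Ext (L.obj (kernel (A.d n (n + 1)))) B n :=
  n.rec (Ext.mk₀ b) fun k e ↦ (hA.shortExact k).extClass.comp e (add_comm 1 k)

lemma iteratedExtClass_zero : iteratedExtClass hA b 0 = Ext.mk₀ b := rfl

lemma iteratedExtClass_succ (n : ℕ) : iteratedExtClass hA b (n + 1) =
    (hA.shortExact n).extClass.comp (iteratedExtClass hA b n) (add_comm 1 n) := rfl

/-- The map which sends a cocycle `z : G ⟶ Z^n(A)` to a class in `Ext^n(L G, B)`. -/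
noncomputable def cocycleToExt (n : ℕ) (G : P) (z : G ⟶ kernel (A.d n (n + 1))) :
    Ext (L.obj G) B n :=
  (Ext.mk₀ (L.map z)).comp (iteratedExtClass hA b n) (zero_add n)

lemma cocycleToExt_comp (n : ℕ) {G G' : P} (f : G' ⟶ G) (z : G ⟶ kernel (A.d n (n + 1))) :
    cocycleToExt hA b n G' (f ≫ z) =
      (Ext.mk₀ (L.map f)).comp (cocycleToExt hA b n G z) (zero_add n) := by
  rw [cocycleToExt, cocycleToExt, L.map_comp, Ext.mk₀_comp_mk₀_assoc]

lemma cocycleToExt_add [L.Additive] (n : ℕ) {G : P} (z z' : G ⟶ kernel (A.d n (n + 1))) :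
    cocycleToExt hA b n G (z + z') = cocycleToExt hA b n G z + cocycleToExt hA b n G z' := by
  rw [cocycleToExt, L.map_add, Ext.mk₀_add, Ext.add_comp, cocycleToExt, cocycleToExt]

/-- Coboundaries have trivial class. -/
lemma cocycleToExt_toCocycles (n : ℕ) {G : P} (s : G ⟶ A.X n) :
    cocycleToExt hA b (n + 1) G (s ≫ toCocycles A n) = 0 := by
  rw [cocycleToExt_comp, cocycleToExt, iteratedExtClass_succ]
  rw [(hA.shortExact n).comp_extClass_assoc, Ext.comp_zero]

/-- Compatibility of `cocycleToExt` with connecting homomorphisms in the variable `G`. -/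
lemma extClass_comp_cocycleToExt {G₁ G₂ G₃ : P} {f : G₁ ⟶ G₂} {g : G₂ ⟶ G₃}
    {w : L.map f ≫ L.map g = 0} (hT : (ShortComplex.mk _ _ w).ShortExact) {n : ℕ}
    (κ : G₁ ⟶ kernel (A.d n (n + 1))) (s : G₂ ⟶ A.X n)
    (γ : G₃ ⟶ kernel (A.d (n + 1) (n + 2))) (h₁ : f ≫ s = κ ≫ kernel.ι _)
    (h₂ : g ≫ γ = s ≫ toCocycles A n) :
    hT.extClass.comp (cocycleToExt hA b n _ κ) (add_comm 1 n) =
      cocycleToExt hA b (n + 1) _ γ := by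
  let φ : ShortComplex.mk _ _ w ⟶ cocycleSequence L A n :=
    ShortComplex.homMk (L.map κ) (L.map s) (L.map γ)
      (by rw [← L.map_comp, ← L.map_comp, h₁]) (by rw [← L.map_comp, ← L.map_comp, h₂])
  have := ShortComplex.ShortExact.extClass_naturality hT (hA.shortExact n) φ
  rw [cocycleToExt, cocycleToExt, iteratedExtClass_succ,
    ← Ext.comp_assoc (a₁₂ := 1) _ _ _ (by lia) (by lia) (by lia),
    ← Ext.comp_assoc (a₁₂ := 1) _ _ _ (by lia) (by lia) (by lia)]
  exact congrArg (fun e ↦ Ext.comp e (iteratedExtClass hA b n) (add_comm 1 n)) this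

end Comparison

end LocalComplexes

/-! ### Dimension shifting -/

section Bijectivity

universe v₁ v₂ u₁ u₂ w

variable {P : Type u₁} [Category.{v₁} P] [Abelian P] {S : Type u₂} [Category.{v₂} S] [Abelian S]
  {L : P ⥤ S} [L.Additive] [PreservesFiniteLimits L] [PreservesFiniteColimits L]
  {A : CochainComplex P ℕ}

/-- The object of cocycles in degree zero belongs to the reflective subcategory `S` of `P`. When
`L` is the sheafification functor, this means that the presheaf of these cocycles is a sheaf. -/
lemma LocalInjectiveResolution.isIso_unit {R : S ⥤ P} [R.Full] [R.Faithful] (adj : L ⊣ R)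
    (r : LocalInjectiveResolution L A) : IsIso (adj.unit.app (kernel (A.d 0 1))) := by
  set Z := kernel (A.d 0 1)
  -- a map from an object killed by `L` to `Z` vanishes
  have hZ : ∀ (N : P) (f : N ⟶ Z), IsZero (L.obj N) → f = 0 := fun N f hN ↦ by
    rw [← cancel_mono (kernel.ι (A.d 0 1)), zero_comp, ← cancel_mono (r.i.f 0), zero_comp]
    exact (r.isLocal_J N hN).1 _ (by simp [r.i.comm])
  have hm : Mono (adj.unit.app Z) := by
    refine Preadditive.mono_of_kernel_zero ?_
    refine hZ _ _ ?_
    have hι : L.map (kernel.ι (adj.unit.app Z)) = 0 := by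
      rw [← cancel_mono (L.map (adj.unit.app Z)), ← L.map_comp, kernel.condition]; simp
    rw [IsZero.iff_id_eq_zero, ← cancel_mono (L.map (kernel.ι (adj.unit.app Z))), hι]
    simp
  obtain ⟨z, hz, hz'⟩ := r.exists_extension_zero (adj.unit.app Z) (kernel.ι _)
    (kernel.condition _)
  let ρ := kernel.lift _ z hz
  have hρ : adj.unit.app Z ≫ ρ = 𝟙 Z := by
    rw [← cancel_mono (kernel.ι _), Category.assoc, kernel.lift_ι, hz']
    exact (Category.id_comp _).symm
  refine ⟨ρ, hρ, ?_⟩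
  -- maps from `R (L Z)` to itself are determined by their restriction to `Z`
  have h : adj.unit.app Z ≫ (ρ ≫ adj.unit.app Z) = adj.unit.app Z ≫ 𝟙 _ := by
    rw [reassoc_of% hρ]; exact (Category.comp_id _).symm
  obtain ⟨f, hf⟩ := R.map_surjective (ρ ≫ adj.unit.app Z)
  rw [← hf] at h ⊢
  have : f = 𝟙 _ := (adj.homEquiv _ _).injective (by simpa [Adjunction.homEquiv_unit] using h)
  rw [this]; exact R.map_id _

omit [L.Additive] [PreservesFiniteColimits L] in
/-- Every epimorphism `Q ⟶ L G` can be refined by the image of a morphism `p : T ⟶ G` of `P`. -/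
lemma exists_refinement {R : S ⥤ P} [R.Full] [R.Faithful] (adj : L ⊣ R) {G : P} {Q : S}
    (q : Q ⟶ L.obj G) [Epi q] :
    ∃ (T : P) (p : T ⟶ G) (f : L.obj T ⟶ Q), Epi (L.map p) ∧ f ≫ q = L.map p := by
  let a : pullback (R.map q) (adj.unit.app G) ⟶ _ := pullback.fst _ _
  let p : pullback (R.map q) (adj.unit.app G) ⟶ G := pullback.snd _ _
  have sq : IsPullback a p (R.map q) (adj.unit.app G) := IsPullback.of_hasPullback _ _
  have hLRq : L.map (R.map q) = adj.counit.app _ ≫ q ≫ inv (adj.counit.app (L.obj G)) := by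
    rw [← Category.assoc, IsIso.eq_comp_inv]; exact adj.counit.naturality q
  have : Epi (L.map (R.map q)) := by rw [hLRq]; infer_instance
  refine ⟨_, p, L.map a ≫ adj.counit.app Q, ?_, ?_⟩
  · exact Abelian.epi_snd_of_isLimit _ _ (sq.map L).isLimit
  · have := L.congr_map sq.w
    rw [L.map_comp, L.map_comp, hLRq] at this
    have h2 := this =≫ adj.counit.app (L.obj G)
    simpa using h2

/-- A morphism `p : T ⟶ G` gives an exact sequence `0 ⟶ ker p ⟶ T ⟶ im p ⟶ 0`. -/
lemma shortExact_kernel_image {T G : P} (p : T ⟶ G) :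
    (ShortComplex.mk (kernel.ι p) (factorThruImage p)
      (by rw [← cancel_mono (image.ι p)]; simp)).ShortExact where
  exact := by
    rw [ShortComplex.exact_iff_exact_up_to_refinements]
    intro X x hx
    have hx₁ : x ≫ factorThruImage p = 0 := hx
    exact ⟨X, 𝟙 X, inferInstance, kernel.lift p x (by
      rw [← image.fac p, reassoc_of% hx₁, zero_comp]), (by simp : 𝟙 X ≫ x = _)⟩

section

variable [HasExt.{w} S] (hA : IsLocallyExact L A) {B : S} (b : L.obj (kernel (A.d 0 1)) ⟶ B)

/-- `cocycleToExt` is surjective on good objects in degree `n`. -/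
def SurjectiveInDegree {J K : CochainComplex P ℕ} (v : J ⟶ K) (n : ℕ) : Prop :=
  ∀ G, IsGood v G → Function.Surjective (cocycleToExt hA b n G)

/-- On good objects, only coboundaries are killed by `cocycleToExt` in degree `n`; for `n = 0`, only
the zero cocycle is. -/
def InjectiveInDegree {J K : CochainComplex P ℕ} (v : J ⟶ K) (n : ℕ) : Prop :=
  ∀ G, IsGood v G → ∀ s : G ⟶ kernel (A.d n (n + 1)), cocycleToExt hA b n G s = 0 →
    s = 0 ∨ ∃ m, ∃ (_ : n = m + 1) (t : G ⟶ A.X m), t ≫ A.d m n = s ≫ kernel.ι (A.d n (n + 1))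

variable {hA b}

lemma surjectiveInDegree_zero [IsIso b] {R : S ⥤ P} [R.Full] [R.Faithful] (adj : L ⊣ R)
    (r : LocalInjectiveResolution L A) : SurjectiveInDegree hA b r.v 0 := by
  intro G _ e
  have := r.isIso_unit adj
  obtain ⟨f, rfl⟩ := (Ext.mk₀_bijective _ _).2 e
  let η := adj.unit.app (kernel (A.d 0 1))
  let z := adj.homEquiv _ _ (f ≫ inv b) ≫ inv η
  have hz : z ≫ η = adj.homEquiv _ _ (f ≫ inv b) := by simp [z, η]
  refine ⟨z, ?_⟩
  rw [cocycleToExt, iteratedExtClass_zero, Ext.mk₀_comp_mk₀]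
  congr 1
  rw [← IsIso.eq_comp_inv]
  apply (adj.homEquiv _ _).injective
  rw [← hz, Adjunction.homEquiv_unit]
  exact (adj.unit.naturality z).symm

lemma injectiveInDegree_zero [IsIso b] {R : S ⥤ P} [R.Full] [R.Faithful] (adj : L ⊣ R)
    (r : LocalInjectiveResolution L A) : InjectiveInDegree hA b r.v 0 := by
  intro G _ s hs
  have := r.isIso_unit adj
  have : R.Additive := adj.right_adjoint_additive
  rw [cocycleToExt, iteratedExtClass_zero, Ext.mk₀_comp_mk₀, Ext.mk₀_eq_zero_iff] at hs
  have hs' : L.map s = 0 := by rw [← cancel_mono b, hs, zero_comp]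
  left
  have := adj.unit.naturality s
  rw [Functor.comp_map, hs', R.map_zero, comp_zero] at this
  rw [← cancel_mono (adj.unit.app (kernel (A.d 0 1))), zero_comp]
  exact this

/-- A class `e` on `G` vanishes on some `T` over `G` which is locally surjective, hence comes from a
class in degree `n` on the kernel of `T ⟶ G`. A cocycle representing the latter extends to a cochain
on `T`, whose coboundary is a cocycle on the image of `T ⟶ G`, and this extends to `G`. -/
lemma SurjectiveInDegree.succ [EnoughInjectives S] {R : S ⥤ P} [R.Full] [R.Faithful] (adj : L ⊣ R)
    (r : LocalInjectiveResolution L A)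
    (enough : ∀ Q : P, ∃ (T : P) (p : T ⟶ Q), Epi p ∧ IsGood r.v T) {n : ℕ}
    (hn : SurjectiveInDegree hA b r.v n) : SurjectiveInDegree hA b r.v (n + 1) := by
  intro G hG e
  -- choose `p : T ⟶ G` such that `L p` is an epimorphism which kills `e`
  obtain ⟨Q, q, hq, hqe⟩ := exists_epi_comp_ext_eq_zero e
  obtain ⟨T₀, p₀, f, hp₀, hf⟩ := exists_refinement adj q
  obtain ⟨T, p₁, hp₁, hT⟩ := enough T₀
  let p := p₁ ≫ p₀
  have hLp : Epi (L.map p) := by rw [L.map_comp]; infer_instance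
  have hpe : (Ext.mk₀ (L.map p)).comp e (zero_add _) = 0 := by
    rw [L.map_comp, ← hf, ← Category.assoc, ← Ext.mk₀_comp_mk₀_assoc, hqe, Ext.comp_zero]
  have hfac : L.map (factorThruImage p) ≫ L.map (image.ι p) = L.map p := by
    rw [← L.map_comp, image.fac]
  have hLi : Epi (L.map (image.ι p)) := by
    rw [← hfac] at hLp; exact epi_of_epi (L.map (factorThruImage p)) _
  have hI : IsGood r.v (image p) := hG.of_mono r.injective_K (image.ι p)
  have hK : IsGood r.v (kernel p) := hT.of_mono r.injective_K (kernel.ι p)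
  have hse := shortExact_kernel_image p
  have hseL : (ShortComplex.mk (L.map (kernel.ι p)) (L.map (factorThruImage p)) _).ShortExact :=
    hse.map_of_exact L
  -- the restriction of `e` to the image of `p` comes from the kernel of `p`
  obtain ⟨e₁, he₁⟩ := Ext.contravariant_sequence_exact₃ hseL _
    ((Ext.mk₀ (L.map (image.ι p))).comp e (zero_add _))
    (by rw [Ext.mk₀_comp_mk₀_assoc, hfac, hpe]) (add_comm 1 n)
  obtain ⟨κ, rfl⟩ := hn _ hK e₁
  obtain ⟨t, ht⟩ := r.exists_extension_of_good hse hI (κ ≫ kernel.ι _)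
  have ht : kernel.ι p ≫ t = κ ≫ kernel.ι _ := ht
  let γ : image p ⟶ kernel (A.d (n + 1) (n + 2)) := hse.exact.desc (t ≫ toCocycles A n)
    ((reassoc_of% ht) _ |>.trans (by simp))
  have hγ : factorThruImage p ≫ γ = t ≫ toCocycles A n := hse.exact.g_desc _ _
  rw [extClass_comp_cocycleToExt hA b hseL κ t γ ht hγ] at he₁
  obtain ⟨z, s, hz, hzs⟩ := r.exists_extension_succ (image.ι p) hG (γ ≫ kernel.ι _) (by simp)
  refine ⟨kernel.lift _ z hz, ?_⟩
  have hzγ : image.ι p ≫ kernel.lift _ z hz = γ + s ≫ toCocycles A n := by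
    rw [← cancel_mono (kernel.ι _)]; simp [hzs]
  have : IsIso (L.map (image.ι p)) := isIso_of_mono_of_epi _
  have h := cocycleToExt_comp hA b (n + 1) (image.ι p) (kernel.lift _ z hz)
  rw [hzγ, cocycleToExt_add, cocycleToExt_toCocycles, add_zero, he₁] at h
  have h' := congrArg
    (fun e ↦ (Ext.mk₀ (inv (L.map (image.ι p)))).comp e (zero_add _)) h
  simpa using h'.symm

/-- A cocycle `z` on `G` is the coboundary of a cochain `s₀` after pulling back to some `T` over `G`
which is locally surjective. If `z` has trivial class, then `s₀` can be modified in such a way that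
it vanishes on the kernel of `T ⟶ G`, so that it is defined on the image, and on `G`. -/
lemma InjectiveInDegree.succ (r : LocalInjectiveResolution L A)
    (enough : ∀ Q : P, ∃ (T : P) (p : T ⟶ Q), Epi p ∧ IsGood r.v T) {n : ℕ}
    (hn : SurjectiveInDegree hA b r.v n) (hn' : InjectiveInDegree hA b r.v n) :
    InjectiveInDegree hA b r.v (n + 1) := by
  intro G hG z hz
  refine Or.inr ⟨n, rfl, ?_⟩
  -- choose `p : T ⟶ G` such that `L p` is an epimorphism and `p ≫ z` is a coboundary
  have := hA n
  have sq : IsPullback _ _ (toCocycles A n) z := IsPullback.of_hasPullback _ _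
  have hp₀ : Epi (L.map (pullback.snd (toCocycles A n) z)) :=
    Abelian.epi_snd_of_isLimit _ _ (sq.map L).isLimit
  obtain ⟨T, p₁, hp₁, hT⟩ := enough (pullback (toCocycles A n) z)
  let p := p₁ ≫ pullback.snd _ _
  let s₀ := p₁ ≫ pullback.fst _ _
  have hs₀ : s₀ ≫ toCocycles A n = p ≫ z := by simp [s₀, p, pullback.condition]
  have hLp : Epi (L.map p) := by rw [L.map_comp]; infer_instance
  have hfac : L.map (factorThruImage p) ≫ L.map (image.ι p) = L.map p := by
    rw [← L.map_comp, image.fac]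
  have hLi : Epi (L.map (image.ι p)) := by
    rw [← hfac] at hLp; exact epi_of_epi (L.map (factorThruImage p)) _
  have hI : IsGood r.v (image p) := hG.of_mono r.injective_K (image.ι p)
  have hK : IsGood r.v (kernel p) := hT.of_mono r.injective_K (kernel.ι p)
  have hse := shortExact_kernel_image p
  have hseL : (ShortComplex.mk (L.map (kernel.ι p)) (L.map (factorThruImage p)) _).ShortExact :=
    hse.map_of_exact L
  let κ : kernel p ⟶ kernel (A.d n (n + 1)) := kernel.lift _ (kernel.ι p ≫ s₀) (by
    rw [← toCocycles_ι, Category.assoc, reassoc_of% hs₀]; simp)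
  have hκ : kernel.ι p ≫ s₀ = κ ≫ kernel.ι _ := by simp [κ]
  -- the class of `κ` comes from `T`, so that it can be removed
  have hδ := extClass_comp_cocycleToExt hA b hseL κ s₀ (image.ι p ≫ z) hκ (by simp [hs₀])
  rw [cocycleToExt_comp, hz, Ext.comp_zero] at hδ
  obtain ⟨e, he⟩ := Ext.contravariant_sequence_exact₁ hseL _ _ (add_comm 1 n) hδ
  obtain ⟨ω, rfl⟩ := hn _ hT e
  have hκω : cocycleToExt hA b n _ (κ - kernel.ι p ≫ ω) = 0 := by
    have h := cocycleToExt_add hA b n (κ - kernel.ι p ≫ ω) (kernel.ι p ≫ ω)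
    rw [sub_add_cancel, cocycleToExt_comp, he] at h
    simpa using h
  suffices ∃ s₁ : T ⟶ A.X n, kernel.ι p ≫ s₁ = 0 ∧ s₁ ≫ A.d n (n + 1) = s₀ ≫ A.d n (n + 1) by
    obtain ⟨s₁, hs₁, hs₁'⟩ := this
    refine r.exists_primitive (image.ι p) hG (z ≫ kernel.ι _) (by simp) (hse.exact.desc s₁ hs₁) ?_
    have := hse.epi_g
    have h : factorThruImage p ≫ hse.exact.desc s₁ hs₁ = s₁ := hse.exact.g_desc _ _
    rw [← cancel_epi (factorThruImage p), reassoc_of% h, hs₁', ← toCocycles_ι, reassoc_of% hs₀]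
    simp
  obtain h | ⟨m, rfl, v, hv⟩ := hn' _ hK _ hκω
  · refine ⟨s₀ - ω ≫ kernel.ι _, ?_, by simp⟩
    rw [Preadditive.comp_sub, hκ, ← Category.assoc, ← Preadditive.sub_comp, h, zero_comp]
  · obtain ⟨v', hv'⟩ := r.exists_extension_of_good hse hI v
    have hv' : kernel.ι p ≫ v' = v := hv'
    refine ⟨s₀ - ω ≫ kernel.ι _ - v' ≫ A.d m (m + 1), ?_, by simp⟩
    rw [Preadditive.comp_sub, reassoc_of% hv', hv, Preadditive.comp_sub, hκ,
      Preadditive.sub_comp, Category.assoc, sub_self]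

/-- For good `G`, the map `cocycleToExt` is surjective, and only coboundaries are sent to zero.
The proof is by dimension shifting in the variable `G`. -/
theorem surjectiveInDegree_and_injectiveInDegree [IsIso b] [EnoughInjectives S] {R : S ⥤ P}
    [R.Full] [R.Faithful] (adj : L ⊣ R) (r : LocalInjectiveResolution L A)
    (enough : ∀ Q : P, ∃ (T : P) (p : T ⟶ Q), Epi p ∧ IsGood r.v T) (n : ℕ) :
    SurjectiveInDegree hA b r.v n ∧ InjectiveInDegree hA b r.v n := by
  induction n with
  | zero => exact ⟨surjectiveInDegree_zero adj r, injectiveInDegree_zero adj r⟩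
  | succ n ih => exact ⟨ih.1.succ adj r enough, InjectiveInDegree.succ r enough ih.1 ih.2⟩

end

end Bijectivity

/-! ### Singular chains -/

section SingularChains

/-- The standard topological simplex of dimension `n`. -/
abbrev TopSimplex (n : ℕ) := stdSimplex ℝ (Fin (n + 1))

/-- The inclusion of the `i`-th face of the standard simplex. -/
noncomputable def faceMap (n : ℕ) (i : Fin (n + 2)) : C(TopSimplex n, TopSimplex (n + 1)) :=
  ⟨stdSimplex.map i.succAbove, stdSimplex.continuous_map _⟩

lemma faceMap_apply_self {n : ℕ} (i : Fin (n + 2)) (t : TopSimplex n) : faceMap n i t i = 0 := by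
  change FunOnFinite.linearMap ℝ ℝ _ _ _ = _
  rw [FunOnFinite.linearMap_apply_apply]
  exact Finset.sum_eq_zero fun j hj ↦ by simp [Fin.succAbove_ne] at hj

lemma faceMap_apply_succAbove {n : ℕ} (i : Fin (n + 2)) (t : TopSimplex n) (j : Fin (n + 1)) :
    faceMap n i t (i.succAbove j) = t j := by
  change FunOnFinite.linearMap ℝ ℝ _ _ _ = _
  rw [FunOnFinite.linearMap_apply_apply, Finset.sum_eq_single j]
  · intro k hk hkj
    simp [hkj] at hk
  · simp

lemma faceMap_comp_faceMap {n : ℕ} {i j : Fin (n + 2)} (h : i ≤ j) :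
    (faceMap (n + 1) j.succ).comp (faceMap n i) =
      (faceMap (n + 1) i.castSucc).comp (faceMap n j) := by
  ext1 t
  change stdSimplex.map _ (stdSimplex.map _ t) = stdSimplex.map _ (stdSimplex.map _ t)
  rw [stdSimplex.map_comp_apply, stdSimplex.map_comp_apply]
  congr 1
  ext k
  simp only [Function.comp_apply, Fin.succAbove, Fin.lt_def, Fin.le_def] at h ⊢
  split_ifs <;> simp_all <;> omega

/-- The group of singular `n`-chains of `X`. -/
abbrev SingularChain (n : ℕ) (X : Type*) [TopologicalSpace X] :=
  FreeAbelianGroup C(TopSimplex n, X)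

variable {X Y Z : Type*} [TopologicalSpace X] [TopologicalSpace Y] [TopologicalSpace Z]

namespace SingularChain

/-- The homomorphism `C_n(X) → C_n(Y)` induced by a continuous map. -/
def push (n : ℕ) (f : C(X, Y)) : SingularChain n X →+ SingularChain n Y :=
  FreeAbelianGroup.map f.comp

@[simp]
lemma push_of {n : ℕ} (f : C(X, Y)) (σ : C(TopSimplex n, X)) :
    push n f (.of σ) = .of (f.comp σ) := rfl

lemma push_push {n : ℕ} (g : C(Y, Z)) (f : C(X, Y)) (c : SingularChain n X) :
    push n g (push n f c) = push n (g.comp f) c := by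
  induction c using FreeAbelianGroup.induction_on <;> simp_all [ContinuousMap.comp_assoc]

lemma push_id {n : ℕ} (c : SingularChain n X) : push n (.id X) c = c := by
  induction c using FreeAbelianGroup.induction_on <;> simp_all

/-- The boundary homomorphism `C_{n+1}(X) → C_n(X)`. -/
noncomputable def boundary (n : ℕ) : SingularChain (n + 1) X →+ SingularChain n X :=
  FreeAbelianGroup.lift fun σ ↦ ∑ i : Fin (n + 2), (-1 : ℤ) ^ (i : ℕ) • .of (σ.comp (faceMap n i))

lemma boundary_of {n : ℕ} (σ : C(TopSimplex (n + 1), X)) : boundary n (.of σ) =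
    ∑ i : Fin (n + 2), (-1 : ℤ) ^ (i : ℕ) • .of (σ.comp (faceMap n i)) :=
  FreeAbelianGroup.lift_apply_of _ _

lemma push_boundary {n : ℕ} (f : C(X, Y)) (c : SingularChain (n + 1) X) :
    push n f (boundary n c) = boundary n (push (n + 1) f c) := by
  induction c using FreeAbelianGroup.induction_on <;>
    simp_all [boundary_of, ContinuousMap.comp_assoc]

lemma boundary_boundary {n : ℕ} (c : SingularChain (n + 2) X) :
    boundary n (boundary (n + 1) c) = 0 := by
  induction c using FreeAbelianGroup.induction_on with
  | zero => simp
  | add x y hx hy => rw [map_add, map_add, hx, hy, add_zero]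
  | neg x hx => rw [map_neg, map_neg, hx, neg_zero]
  | of σ =>
    simp only [boundary_of, map_sum, map_zsmul, Finset.smul_sum, smul_smul]
    rw [← Finset.sum_product']
    let S : Finset (Fin (n + 3) × Fin (n + 2)) := {ij | (ij.1 : ℕ) ≤ (ij.2 : ℕ)}
    rw [Finset.univ_product_univ, ← Finset.sum_add_sum_compl S, ← eq_neg_iff_add_eq_zero,
      ← Finset.sum_neg_distrib]
    -- the involution which exchanges the two ways of omitting two vertices
    let φ : ∀ ij : Fin (n + 3) × Fin (n + 2), ij ∈ S → Fin (n + 3) × Fin (n + 2) := fun ij hij ↦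
      (ij.2.succ, Fin.castLT ij.1 (lt_of_le_of_lt (Finset.mem_filter.mp hij).right ij.2.is_lt))
    apply Finset.sum_bij φ
    · intro ij hij
      simp_rw [S, φ, Finset.compl_filter, Finset.mem_filter_univ, Fin.val_succ,
        Fin.val_castLT] at hij ⊢
      lia
    · rintro ⟨i, j⟩ hij ⟨i', j'⟩ hij' h
      simp only [φ, Prod.mk_inj, Fin.ext_iff, Fin.val_castLT] at h ⊢
      exact ⟨h.2, by simpa using h.1⟩
    · rintro ⟨i', j'⟩ hij'
      simp_rw [S, Finset.compl_filter, Finset.mem_filter_univ, not_le] at hij'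
      refine ⟨(j'.castSucc, i'.pred ?_), ?_, ?_⟩
      · rintro rfl
        simp only [Fin.val_zero, not_lt_zero] at hij'
      · simpa [S] using Nat.le_sub_one_of_lt hij'
      · simp [φ]
    · rintro ⟨i, j⟩ hij
      have hij' : (i : ℕ) ≤ j := by simpa [S] using hij
      rw [← neg_smul]
      congr 1
      · simp only [φ, Fin.val_succ, Fin.val_castLT, pow_add, pow_one]; ring
      · congr 1
        have h := faceMap_comp_faceMap (n := n) (i := i.castLT (by lia)) (j := j)
          (by simpa [Fin.le_def] using hij')
        rw [ContinuousMap.comp_assoc, ContinuousMap.comp_assoc, h]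
        simp

/-- The augmentation `C_n(X) → ℤ`, which sends every simplex to `1`. -/
def augmentation (n : ℕ) : SingularChain n X →+ ℤ := FreeAbelianGroup.lift fun _ ↦ 1

@[simp]
lemma augmentation_of {n : ℕ} (σ : C(TopSimplex n, X)) : augmentation n (.of σ) = 1 :=
  FreeAbelianGroup.lift_apply_of _ _

lemma augmentation_boundary (c : SingularChain 1 X) : augmentation 0 (boundary 0 c) = 0 := by
  induction c using FreeAbelianGroup.induction_on <;> simp_all [boundary_of, Fin.sum_univ_two]

lemma augmentation_push {n : ℕ} (f : C(X, Y)) (c : SingularChain n X) :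
    augmentation n (push n f c) = augmentation n c := by
  induction c using FreeAbelianGroup.induction_on <;> simp_all

end SingularChain

/-! ### Cones -/

/-- The map `Δⁿ × I → Δⁿ⁺¹` which exhibits `Δⁿ⁺¹` as the cone on its zeroth face. The
end `1` of the interval is collapsed to the zeroth vertex. -/
noncomputable def coneProj (n : ℕ) : C(TopSimplex n × unitInterval, TopSimplex (n + 1)) where
  toFun x := ⟨Fin.cons (x.2 : ℝ) fun i ↦ (1 - (x.2 : ℝ)) * x.1 i, by
    constructor
    · intro i
      cases i using Fin.cases with
      | zero => exact x.2.2.1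
      | succ i => exact mul_nonneg (by linarith [x.2.2.2]) (x.1.2.1 i)
    · rw [Fin.sum_univ_succ]
      simp [← Finset.mul_sum]⟩
  continuous_toFun := by
    refine Continuous.subtype_mk (continuous_pi fun i ↦ ?_) _
    cases i using Fin.cases with
    | zero => simpa using by fun_prop
    | succ i =>
      have : Continuous fun x : TopSimplex n × unitInterval ↦ x.1 i :=
        (continuous_apply i).comp (continuous_subtype_val.comp continuous_fst)
      simp only [Fin.cons_succ]
      fun_prop

@[simp]
lemma coneProj_apply_zero {n : ℕ} (x : TopSimplex n × unitInterval) :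
    coneProj n x 0 = (x.2 : ℝ) := rfl

@[simp]
lemma coneProj_apply_succ {n : ℕ} (x : TopSimplex n × unitInterval) (i : Fin (n + 1)) :
    coneProj n x i.succ = (1 - (x.2 : ℝ)) * x.1 i := rfl

lemma coneProj_surjective (n : ℕ) : Function.Surjective (coneProj n) := by
  intro t
  have h0 : 0 ≤ t 0 := t.2.1 0
  have hsum : ∑ i : Fin (n + 1), t i.succ = 1 - t 0 := by
    have := stdSimplex.sum_eq_one t
    rw [Fin.sum_univ_succ] at this
    linarith
  have h1 : t 0 ≤ 1 := stdSimplex.le_one t 0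
  rcases h1.lt_or_eq with h | h
  · have hpos : 0 < 1 - t 0 := by linarith
    refine ⟨(⟨fun i ↦ t i.succ / (1 - t 0), fun i ↦ div_nonneg (t.2.1 _) hpos.le, ?_⟩,
      ⟨t 0, h0, h1⟩), ?_⟩
    · rw [← Finset.sum_div, hsum, div_self hpos.ne']
    · ext i
      cases i using Fin.cases with
      | zero => rfl
      | succ i => exact mul_div_cancel₀ _ hpos.ne'
  · refine ⟨(Classical.arbitrary _, 1), ?_⟩
    ext i
    cases i using Fin.cases with
    | zero => simp [h]
    | succ i =>
      have := (Finset.sum_eq_zero_iff_of_nonneg (fun i _ ↦ t.2.1 (Fin.succ i))).1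
        (hsum.trans (by linarith)) i (Finset.mem_univ i)
      rw [coneProj_apply_succ, show t i.succ = 0 from this]
      simp

lemma isQuotientMap_coneProj (n : ℕ) : Topology.IsQuotientMap (coneProj n) :=
  (coneProj n).continuous.isClosedMap.isQuotientMap (coneProj n).continuous (coneProj_surjective n)

lemma coneProj_eq_iff {n : ℕ} {s s' : TopSimplex n} {r r' : unitInterval} :
    coneProj n (s, r) = coneProj n (s', r') → r = r' ∧ (r = 1 ∨ s = s') := by
  intro h
  have hr : r = r' := Subtype.ext congr($h 0)
  subst hr
  refine ⟨rfl, or_iff_not_imp_left.2 fun h1 ↦ ?_⟩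
  ext i
  have := congr($h i.succ)
  simp only [coneProj_apply_succ] at this
  refine mul_left_cancel₀ (fun h2 ↦ h1 (Subtype.ext ?_)) this
  change (r : ℝ) = 1
  linarith

lemma faceMap_zero_eq {n : ℕ} (t : TopSimplex n) : faceMap n 0 t = coneProj n (t, 0) := by
  ext i
  cases i using Fin.cases with
  | zero => simpa using faceMap_apply_self 0 t
  | succ i => simpa using faceMap_apply_succAbove 0 t i

lemma faceMap_succ_coneProj {n : ℕ} (i : Fin (n + 2)) (s : TopSimplex n) (r : unitInterval) :
    faceMap (n + 1) i.succ (coneProj n (s, r)) = coneProj (n + 1) (faceMap n i s, r) := by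
  ext k
  cases k using Fin.cases with
  | zero => simpa using faceMap_apply_succAbove i.succ (coneProj n (s, r)) 0
  | succ k =>
    rcases Fin.eq_self_or_eq_succAbove i k with rfl | ⟨j, rfl⟩
    · simp [faceMap_apply_self]
    · rw [← Fin.succ_succAbove_succ, faceMap_apply_succAbove, Fin.succ_succAbove_succ]
      simp [faceMap_apply_succAbove]

lemma faceMap_one_eq (t : TopSimplex 0) : faceMap 0 1 t = coneProj 0 (t, 1) := by
  ext i
  cases i using Fin.cases with
  | zero => simpa using faceMap_apply_succAbove 1 t 0
  | succ i =>
    obtain rfl : i = 0 := Subsingleton.elim _ _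
    rw [coneProj_apply_succ]
    simpa using faceMap_apply_self 1 t

/-- A null-homotopy of a map `j : X → Y`: a homotopy from `j` to the constant map with value
`pt`. -/
structure Contraction (j : C(X, Y)) where
  /-- The value of the constant map. -/
  pt : Y
  /-- The homotopy. -/
  map : C(X × unitInterval, Y)
  map_zero : ∀ x, map (x, 0) = j x
  map_one : ∀ x, map (x, 1) = pt

namespace Contraction

variable {j : C(X, Y)} (H : Contraction j)

lemma factorsThrough_coneProj {n : ℕ} (σ : C(TopSimplex n, X)) :
    Function.FactorsThrough (H.map.comp (σ.prodMap (.id unitInterval))) (coneProj n) := by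
  rintro ⟨s, r⟩ ⟨s', r'⟩ h
  obtain ⟨rfl, rfl | rfl⟩ := coneProj_eq_iff h
  · simp [H.map_one]
  · rfl

/-- The cone on a singular simplex `σ` of `X`, as a singular simplex of `Y`. -/
noncomputable def coneSimplex {n : ℕ} (σ : C(TopSimplex n, X)) : C(TopSimplex (n + 1), Y) :=
  (isQuotientMap_coneProj n).lift _ (H.factorsThrough_coneProj σ)

@[simp]
lemma coneSimplex_coneProj {n : ℕ} (σ : C(TopSimplex n, X)) (s : TopSimplex n)
    (r : unitInterval) : H.coneSimplex σ (coneProj n (s, r)) = H.map (σ s, r) :=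
  DFunLike.congr_fun ((isQuotientMap_coneProj n).lift_comp _ (H.factorsThrough_coneProj σ)) (s, r)

lemma coneSimplex_comp_faceMap_zero {n : ℕ} (σ : C(TopSimplex n, X)) :
    (H.coneSimplex σ).comp (faceMap n 0) = j.comp σ := by
  ext t
  simp [faceMap_zero_eq, H.map_zero]

lemma coneSimplex_comp_faceMap_succ {n : ℕ} (σ : C(TopSimplex (n + 1), X)) (i : Fin (n + 2)) :
    (H.coneSimplex σ).comp (faceMap (n + 1) i.succ) = H.coneSimplex (σ.comp (faceMap n i)) := by
  ext t
  obtain ⟨⟨s, r⟩, rfl⟩ := coneProj_surjective n t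
  simp [faceMap_succ_coneProj]

lemma coneSimplex_comp_faceMap_one (σ : C(TopSimplex 0, X)) :
    (H.coneSimplex σ).comp (faceMap 0 1) = .const _ H.pt := by
  ext t
  simp [faceMap_one_eq, H.map_one]

/-- The cone operator on singular chains. Up to an augmentation term in degree zero, it is a chain
homotopy between zero and the map induced by `j`. -/
noncomputable def cone (n : ℕ) : SingularChain n X →+ SingularChain (n + 1) Y :=
  FreeAbelianGroup.map H.coneSimplex

@[simp]
lemma cone_of {n : ℕ} (σ : C(TopSimplex n, X)) :
    H.cone n (.of σ) = .of (H.coneSimplex σ) := rfl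

lemma boundary_cone_succ {n : ℕ} (c : SingularChain (n + 1) X) :
    SingularChain.boundary (n + 1) (H.cone (n + 1) c) =
      SingularChain.push (n + 1) j c - H.cone n (SingularChain.boundary n c) := by
  induction c using FreeAbelianGroup.induction_on with
  | zero => simp
  | add x y hx hy => simp only [map_add, hx, hy]; abel
  | neg x hx => simp only [map_neg, hx]; abel
  | of σ =>
    rw [cone_of, SingularChain.boundary_of, Fin.sum_univ_succ, SingularChain.boundary_of]
    simp [coneSimplex_comp_faceMap_zero, coneSimplex_comp_faceMap_succ, pow_succ, sub_eq_add_neg]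

lemma boundary_cone_zero (c : SingularChain 0 X) :
    SingularChain.boundary 0 (H.cone 0 c) = SingularChain.push 0 j c -
      SingularChain.augmentation 0 c • .of (.const _ H.pt) := by
  induction c using FreeAbelianGroup.induction_on with
  | zero => simp
  | add x y hx hy => simp only [map_add, hx, hy, add_smul]; abel
  | neg x hx => simp only [map_neg, hx, neg_smul]; abel
  | of σ =>
    rw [cone_of, SingularChain.boundary_of, Fin.sum_univ_two]
    simp [coneSimplex_comp_faceMap_zero, coneSimplex_comp_faceMap_one, sub_eq_add_neg]

end Contraction

end SingularChains

/-! ### Barycentric subdivision -/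

section Subdivision

variable {X Y : Type*} [TopologicalSpace X] [TopologicalSpace Y]

namespace SingularChain

/-- A chain `e` of the standard simplex `Δⁿ` defines a natural transformation
`C_n(X) → C_m(X)`, which sends a simplex `σ` to `σ_*(e)`. -/
noncomputable def act {m n : ℕ} (e : SingularChain m (TopSimplex n)) :
    SingularChain n X →+ SingularChain m X :=
  FreeAbelianGroup.lift fun σ ↦ push m σ e

@[simp]
lemma act_of {m n : ℕ} (e : SingularChain m (TopSimplex n)) (σ : C(TopSimplex n, X)) :
    act e (.of σ) = push m σ e :=
  FreeAbelianGroup.lift_apply_of _ _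

lemma push_act {m n : ℕ} (e : SingularChain m (TopSimplex n)) (f : C(X, Y))
    (c : SingularChain n X) : push m f (act e c) = act e (push n f c) := by
  induction c using FreeAbelianGroup.induction_on <;> simp_all [push_push]

lemma boundary_act {m n : ℕ} {e : SingularChain (m + 1) (TopSimplex (n + 1))}
    {e' : SingularChain m (TopSimplex n)}
    (h : boundary m e = act e' (boundary n (.of (.id _)))) (c : SingularChain (n + 1) X) :
    boundary m (act e c) = act e' (boundary n c) := by
  induction c using FreeAbelianGroup.induction_on with
  | zero => simp
  | add x y hx hy => simp only [map_add, hx, hy]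
  | neg x hx => simp only [map_neg, hx]
  | of σ => rw [act_of, ← push_boundary, h, push_act, push_boundary, push_of]; rfl

lemma act_of_id {n : ℕ} (c : SingularChain n X) : act (.of (.id (TopSimplex n))) c = c := by
  induction c using FreeAbelianGroup.induction_on <;> simp_all

end SingularChain

/-- The contraction of the standard simplex to its barycenter along straight lines. -/
noncomputable def barycentricContraction (n : ℕ) : Contraction (.id (TopSimplex n)) where
  pt := stdSimplex.barycenter
  map :=
    { toFun := fun x ↦ ⟨(x.2 : ℝ) • stdSimplex.barycenter.1 + (1 - (x.2 : ℝ)) • x.1.1,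
        convex_stdSimplex ℝ _ stdSimplex.barycenter.2 x.1.2 x.2.2.1 (by linarith [x.2.2.2])
          (by ring)⟩
      continuous_toFun := by fun_prop }
  map_zero x := by ext; simp
  map_one x := by ext; simp

lemma barycentricContraction_map_apply {n : ℕ} (x : TopSimplex n) (r : unitInterval)
    (k : Fin (n + 1)) : (barycentricContraction n).map (x, r) k =
      (r : ℝ) * (stdSimplex.barycenter : TopSimplex n) k + (1 - (r : ℝ)) * x k := rfl

open SingularChain

/-- The barycentric subdivision of the standard simplex: the cone, with the barycenter as vertex,
on the barycentric subdivision of the boundary. -/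
noncomputable def subdivisionChain : ∀ n : ℕ, SingularChain n (TopSimplex n)
  | 0 => .of (.id _)
  | n + 1 => (barycentricContraction (n + 1)).cone n
      (act (subdivisionChain n) (boundary n (.of (.id _))))

/-- The barycentric subdivision operator on singular chains. -/
noncomputable def subdivide (n : ℕ) : SingularChain n X →+ SingularChain n X :=
  act (subdivisionChain n)

lemma subdivide_zero (c : SingularChain 0 X) : subdivide 0 c = c := act_of_id c

lemma subdivisionChain_succ (n : ℕ) : subdivisionChain (n + 1) =
    (barycentricContraction (n + 1)).cone n (act (subdivisionChain n)
      (boundary n (.of (.id _)))) := rfl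

lemma boundary_subdivisionChain (n : ℕ) : boundary n (subdivisionChain (n + 1)) =
    act (subdivisionChain n) (boundary n (.of (.id _))) := by
  induction n with
  | zero =>
    rw [subdivisionChain_succ, Contraction.boundary_cone_zero, push_id]
    simp [subdivisionChain, act_of_id, augmentation_boundary]
  | succ n ih =>
    rw [subdivisionChain_succ, Contraction.boundary_cone_succ, push_id, boundary_act ih,
      boundary_boundary]
    simp

lemma boundary_subdivide {n : ℕ} (c : SingularChain (n + 1) X) :
    boundary n (subdivide (n + 1) c) = subdivide n (boundary n c) :=
  boundary_act (boundary_subdivisionChain n) c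

lemma push_subdivide {n : ℕ} (f : C(X, Y)) (c : SingularChain n X) :
    push n f (subdivide n c) = subdivide n (push n f c) := push_act _ _ _

/-- The chain of the standard simplex which defines the chain homotopy between the identity and
the barycentric subdivision. -/
noncomputable def subdivisionHomotopyChain : ∀ n : ℕ, SingularChain (n + 1) (TopSimplex n)
  | 0 => 0
  | n + 1 => (barycentricContraction (n + 1)).cone (n + 1)
      (.of (.id _) - subdivisionChain (n + 1) -
        act (subdivisionHomotopyChain n) (boundary n (.of (.id _))))

/-- The chain homotopy between the identity and the barycentric subdivision. -/
noncomputable def subdivisionHomotopy (n : ℕ) : SingularChain n X →+ SingularChain (n + 1) X :=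
  act (subdivisionHomotopyChain n)

lemma push_subdivisionHomotopy {n : ℕ} (f : C(X, Y)) (c : SingularChain n X) :
    push (n + 1) f (subdivisionHomotopy n c) = subdivisionHomotopy n (push n f c) := push_act _ _ _

/-- By naturality, the homotopy relation for the identity of `Δⁿ⁺¹` implies it for all chains. -/
lemma boundary_subdivisionHomotopy_of_eq {n : ℕ}
    (h : boundary (n + 1) (subdivisionHomotopyChain (n + 1)) = .of (.id _) -
      subdivisionChain (n + 1) - act (subdivisionHomotopyChain n) (boundary n (.of (.id _))))
    (c : SingularChain (n + 1) X) : boundary (n + 1) (subdivisionHomotopy (n + 1) c) =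
      c - subdivide (n + 1) c - subdivisionHomotopy n (boundary n c) := by
  induction c using FreeAbelianGroup.induction_on with
  | zero => simp
  | add x y hx hy => simp only [map_add, hx, hy]; abel
  | neg x hx => simp only [map_neg, hx]; abel
  | of σ =>
    rw [subdivisionHomotopy, subdivide, subdivisionHomotopy, act_of, ← push_boundary, h, map_sub,
      map_sub, push_act, push_boundary, push_of, act_of]
    rfl

/-- The homotopy relation on the identity of `Δⁿ⁺¹`. The chain of which `subdivisionHomotopyChain`
is the cone is a cycle, by the homotopy relation in lower dimension. -/
lemma boundary_subdivisionHomotopyChain (n : ℕ) :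
    boundary (n + 1) (subdivisionHomotopyChain (n + 1)) = .of (.id _) -
      subdivisionChain (n + 1) - act (subdivisionHomotopyChain n) (boundary n (.of (.id _))) := by
  have key : boundary n (.of (.id _) - subdivisionChain (n + 1) -
      act (subdivisionHomotopyChain n) (boundary n (.of (.id _)))) = 0 := by
    rw [map_sub, map_sub, boundary_subdivisionChain]
    induction n with
    | zero =>
      have : act (X := TopSimplex 1) (subdivisionHomotopyChain 0) = 0 := by
        ext; simp [subdivisionHomotopyChain]
      simp [this, subdivisionChain, act_of_id]
    | succ n ih =>
      have h : boundary (n + 1) (subdivisionHomotopyChain (n + 1)) = .of (.id _) -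
          subdivisionChain (n + 1) -
            act (subdivisionHomotopyChain n) (boundary n (.of (.id _))) := by
        rw [← boundary_subdivisionChain, ← map_sub, ← map_sub] at ih
        rw [subdivisionHomotopyChain, Contraction.boundary_cone_succ, push_id, ih]
        simp
      have := boundary_subdivisionHomotopy_of_eq h
        (boundary (n + 1) (.of (.id (TopSimplex (n + 2)))))
      rw [subdivisionHomotopy] at this
      rw [this, boundary_boundary]
      simp [subdivide]
  rw [subdivisionHomotopyChain, Contraction.boundary_cone_succ, push_id, key]
  simp

lemma boundary_subdivisionHomotopy {n : ℕ} (c : SingularChain (n + 1) X) :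
    boundary (n + 1) (subdivisionHomotopy (n + 1) c) =
      c - subdivide (n + 1) c - subdivisionHomotopy n (boundary n c) :=
  boundary_subdivisionHomotopy_of_eq (boundary_subdivisionHomotopyChain n) c

/-! ### Iterated subdivisions become small -/

/-- The distance on the standard simplex given by the `ℓ¹`-norm. -/
def l1Dist {n : ℕ} (s t : TopSimplex n) : ℝ := ∑ k, |s k - t k|

lemma l1Dist_le_two {n : ℕ} (s t : TopSimplex n) : l1Dist s t ≤ 2 := by
  calc l1Dist s t ≤ ∑ k, (s k + t k) := Finset.sum_le_sum fun k _ ↦ by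
        have h₁ : 0 ≤ s k := s.2.1 k
        have h₂ : 0 ≤ t k := t.2.1 k
        rw [abs_le]; constructor <;> linarith
    _ = 2 := by
      rw [Finset.sum_add_distrib, stdSimplex.sum_eq_one s, stdSimplex.sum_eq_one t]; norm_num

lemma dist_le_l1Dist {n : ℕ} (s t : TopSimplex n) : dist s t ≤ l1Dist s t := by
  rw [Subtype.dist_eq, l1Dist, dist_pi_le_iff (Finset.sum_nonneg fun _ _ ↦ abs_nonneg _)]
  intro k
  exact Finset.single_le_sum (f := fun k ↦ |s k - t k|) (fun _ _ ↦ abs_nonneg _)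
    (Finset.mem_univ k)

/-- An affine map `Δᵐ → Δⁿ` such that any two of the images of the vertices have `ℓ¹`-distance at
most `2 μ`. (The factor `2` is the diameter of `Δⁿ`.) -/
def HasMesh {m n : ℕ} (μ : ℝ) (τ : C(TopSimplex m, TopSimplex n)) : Prop :=
  ∃ v : Fin (m + 1) → TopSimplex n, (∀ t k, τ t k = ∑ i, t i * v i k) ∧
    ∀ i j, l1Dist (v i) (v j) ≤ 2 * μ

/-- An affine map of mesh `μ` is `μ`-Lipschitz for the `ℓ¹`-distance. -/
lemma HasMesh.l1Dist_le {m n : ℕ} {μ : ℝ} {τ : C(TopSimplex m, TopSimplex n)} (h : HasMesh μ τ)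
    (s t : TopSimplex m) : l1Dist (τ s) (τ t) ≤ μ * l1Dist s t := by
  obtain ⟨v, hv, hμ⟩ := h
  -- the positive and negative parts of `s - t` have the same mass `M`
  set a : Fin (m + 1) → ℝ := fun i ↦ max (s i - t i) 0
  set b : Fin (m + 1) → ℝ := fun i ↦ max (t i - s i) 0
  have ha : ∀ i, 0 ≤ a i := fun i ↦ le_max_right _ _
  have hb : ∀ i, 0 ≤ b i := fun i ↦ le_max_right _ _
  have hsub : ∀ i, a i - b i = s i - t i := fun i ↦ by
    simp only [a, b]
    rcases le_total (s i) (t i) with h | h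
    · rw [max_eq_right (by linarith), max_eq_left (by linarith)]; ring
    · rw [max_eq_left (by linarith), max_eq_right (by linarith)]; ring
  have habs : ∀ i, a i + b i = |s i - t i| := fun i ↦ by
    simp only [a, b]
    rcases le_total (s i) (t i) with h | h
    · rw [max_eq_right (by linarith), max_eq_left (by linarith), abs_of_nonpos (by linarith)]; ring
    · rw [max_eq_left (by linarith), max_eq_right (by linarith), abs_of_nonneg (by linarith)]; ring
  set M := ∑ i, a i
  have hM : ∑ i, b i = M := by
    have : ∑ i, (a i - b i) = 0 := by
      simp only [hsub, Finset.sum_sub_distrib, stdSimplex.sum_eq_one s, stdSimplex.sum_eq_one t,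
        sub_self]
    rw [Finset.sum_sub_distrib] at this
    linarith
  have hl : l1Dist s t = 2 * M := by
    rw [l1Dist, ← Finset.sum_congr rfl fun i _ ↦ habs i, Finset.sum_add_distrib, hM]; ring
  have hM0 : 0 ≤ M := Finset.sum_nonneg fun i _ ↦ ha i
  have hτ : ∀ k, M * (τ s k - τ t k) = ∑ i, ∑ j, a i * b j * (v i k - v j k) := fun k ↦ by
    have h₁ : τ s k - τ t k = ∑ i, a i * v i k - ∑ i, b i * v i k := by
      rw [hv, hv, ← Finset.sum_sub_distrib, ← Finset.sum_sub_distrib]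
      exact Finset.sum_congr rfl fun i _ ↦ by rw [← sub_mul, ← sub_mul, hsub]
    have h₂ : ∑ i, ∑ j, a i * b j * (v i k - v j k) =
        (∑ i, a i * v i k) * ∑ j, b j - (∑ i, a i) * ∑ j, b j * v j k := by
      rw [Finset.sum_mul_sum, Finset.sum_mul_sum, ← Finset.sum_sub_distrib]
      refine Finset.sum_congr rfl fun i _ ↦ ?_
      rw [← Finset.sum_sub_distrib]
      exact Finset.sum_congr rfl fun j _ ↦ by ring
    rw [h₂, hM, h₁]; ring
  have key : M * l1Dist (τ s) (τ t) ≤ M * (2 * M * μ) := by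
    calc M * l1Dist (τ s) (τ t) = ∑ k, |M * (τ s k - τ t k)| := by
          rw [l1Dist, Finset.mul_sum]
          exact Finset.sum_congr rfl fun k _ ↦ by rw [abs_mul, abs_of_nonneg hM0]
      _ ≤ ∑ k, ∑ i, ∑ j, a i * b j * |v i k - v j k| := Finset.sum_le_sum fun k _ ↦ by
          rw [hτ]
          refine (Finset.abs_sum_le_sum_abs _ _).trans (Finset.sum_le_sum fun i _ ↦ ?_)
          refine (Finset.abs_sum_le_sum_abs _ _).trans (Finset.sum_le_sum fun j _ ↦ ?_)
          rw [abs_mul, abs_of_nonneg (mul_nonneg (ha i) (hb j))]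
      _ = ∑ i, ∑ j, a i * b j * l1Dist (v i) (v j) := by
          rw [Finset.sum_comm]
          refine Finset.sum_congr rfl fun i _ ↦ ?_
          rw [Finset.sum_comm]
          exact Finset.sum_congr rfl fun j _ ↦ by rw [l1Dist, Finset.mul_sum]
      _ ≤ ∑ i, ∑ j, a i * b j * (2 * μ) := Finset.sum_le_sum fun i _ ↦ Finset.sum_le_sum fun j _ ↦
          mul_le_mul_of_nonneg_left (hμ i j) (mul_nonneg (ha i) (hb j))
      _ = M * (2 * M * μ) := by
          simp_rw [← Finset.sum_mul, ← Finset.mul_sum, hM, ← Finset.sum_mul]; ring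
  rcases hM0.eq_or_lt with h0 | h0
  · have hst : s = t := by
      ext i
      have h₁ := (Finset.sum_eq_zero_iff_of_nonneg fun i _ ↦ ha i).1 h0.symm i (Finset.mem_univ i)
      have h₂ := (Finset.sum_eq_zero_iff_of_nonneg fun i _ ↦ hb i).1 (hM.trans h0.symm) i
        (Finset.mem_univ i)
      have := hsub i
      rw [h₁, h₂] at this
      linarith
    simp [hst, l1Dist]
  · rw [hl]
    linarith [le_of_mul_le_mul_left key h0]

lemma HasMesh.faceMap_comp {m n : ℕ} {μ : ℝ} {τ : C(TopSimplex m, TopSimplex n)}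
    (h : HasMesh μ τ) (i : Fin (n + 2)) : HasMesh μ ((faceMap n i).comp τ) := by
  obtain ⟨v, hv, hμ⟩ := h
  refine ⟨fun l ↦ faceMap n i (v l), fun t k ↦ ?_, fun l l' ↦ ?_⟩
  · rcases Fin.eq_self_or_eq_succAbove i k with rfl | ⟨k, rfl⟩
    · simp [faceMap_apply_self]
    · simp [faceMap_apply_succAbove, hv]
  · refine le_trans (le_of_eq ?_) (hμ l l')
    simp [l1Dist, Fin.sum_univ_succAbove _ i, faceMap_apply_self, faceMap_apply_succAbove]

/-- All points have `ℓ¹`-distance at most `2 n / (n + 1)` from the barycenter of `Δⁿ`: this holds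
for the vertices, hence for their convex combinations. -/
lemma l1Dist_barycenter_le {n : ℕ} (w : TopSimplex n) :
    l1Dist stdSimplex.barycenter w ≤ 2 * (n / (n + 1)) := by
  have hn : (0 : ℝ) < n + 1 := by positivity
  have hb : ∀ k, (stdSimplex.barycenter : TopSimplex n) k = ((n : ℝ) + 1)⁻¹ := fun k ↦
    (stdSimplex.barycenter_apply k).trans (by simp)
  have hvert : ∀ j : Fin (n + 1), ∑ k, |((n : ℝ) + 1)⁻¹ - if k = j then 1 else 0| =
      2 * (n / (n + 1)) := fun j ↦ by
    rw [Fin.sum_univ_succAbove _ j]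
    have h1 : ((n : ℝ) + 1)⁻¹ ≤ 1 :=
      inv_le_one_of_one_le₀ (by linarith [(n.cast_nonneg : (0 : ℝ) ≤ n)])
    simp only [if_true, Fin.succAbove_ne, if_false, sub_zero, Finset.sum_const, Finset.card_univ,
      Fintype.card_fin, nsmul_eq_mul]
    rw [abs_of_nonpos (by linarith), abs_of_nonneg (by positivity)]
    field_simp
    ring
  calc l1Dist stdSimplex.barycenter w
      = ∑ k, |∑ j, w j * (((n : ℝ) + 1)⁻¹ - if k = j then 1 else 0)| := by
        refine Finset.sum_congr rfl fun k _ ↦ ?_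
        simp only [hb, mul_sub, Finset.sum_sub_distrib, ← Finset.sum_mul, stdSimplex.sum_eq_one w]
        simp
    _ ≤ ∑ k, ∑ j, w j * |((n : ℝ) + 1)⁻¹ - if k = j then 1 else 0| :=
        Finset.sum_le_sum fun k _ ↦ (Finset.abs_sum_le_sum_abs _ _).trans
          (Finset.sum_le_sum fun j _ ↦ by rw [abs_mul, abs_of_nonneg (show 0 ≤ w j from w.2.1 j)])
    _ = 2 * (n / (n + 1)) := by
        rw [Finset.sum_comm]
        simp only [← Finset.mul_sum, hvert, ← Finset.sum_mul, stdSimplex.sum_eq_one w, one_mul]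

lemma l1Dist_comm {n : ℕ} (s t : TopSimplex n) : l1Dist s t = l1Dist t s :=
  Finset.sum_congr rfl fun _ _ ↦ abs_sub_comm _ _

/-- The cone with vertex the barycenter of `Δⁿ` on an affine simplex of small mesh has mesh at most
`n / (n + 1)`, as edges which end at the barycenter are short. -/
lemma HasMesh.coneSimplex {m n : ℕ} {μ : ℝ} {τ : C(TopSimplex m, TopSimplex n)}
    (h : HasMesh μ τ) (hμ : μ ≤ n / (n + 1)) :
    HasMesh (n / (n + 1)) ((barycentricContraction n).coneSimplex τ) := by
  obtain ⟨v, hv, hvμ⟩ := h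
  refine ⟨Fin.cons stdSimplex.barycenter v, fun t k ↦ ?_, fun i j ↦ ?_⟩
  · obtain ⟨⟨s, r⟩, rfl⟩ := coneProj_surjective m t
    rw [Contraction.coneSimplex_coneProj, barycentricContraction_map_apply, Fin.sum_univ_succ]
    simp [hv, Finset.mul_sum, mul_assoc]
  · cases i using Fin.cases with
    | zero =>
      cases j using Fin.cases with
      | zero => simp only [Fin.cons_zero]; exact l1Dist_barycenter_le _
      | succ j => simp only [Fin.cons_zero, Fin.cons_succ]; exact l1Dist_barycenter_le _
    | succ i =>
      cases j using Fin.cases with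
      | zero =>
        simp only [Fin.cons_zero, Fin.cons_succ]; rw [l1Dist_comm]; exact l1Dist_barycenter_le _
      | succ j =>
        simp only [Fin.cons_succ]
        exact (hvμ i j).trans (by linarith)

/-- The chains all of whose simplices belong to `S`. -/
def supportedChains {n : ℕ} (S : Set C(TopSimplex n, X)) : AddSubgroup (SingularChain n X) :=
  AddSubgroup.closure (FreeAbelianGroup.of '' S)

lemma of_mem_supportedChains {n : ℕ} {S : Set C(TopSimplex n, X)} {σ : C(TopSimplex n, X)}
    (h : σ ∈ S) : .of σ ∈ supportedChains S :=
  AddSubgroup.subset_closure ⟨σ, h, rfl⟩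

lemma supportedChains_mono {n : ℕ} {S T : Set C(TopSimplex n, X)} (h : S ⊆ T) :
    supportedChains S ≤ supportedChains T :=
  AddSubgroup.closure_mono (Set.image_mono h)

/-- A homomorphism which sends the simplices in `S` to `K` sends all chains supported on `S` to
`K`. -/
lemma mem_of_mem_supportedChains {M : Type*} [AddCommGroup M] {n : ℕ} {S : Set C(TopSimplex n, X)}
    {c : SingularChain n X} (hc : c ∈ supportedChains S) (f : SingularChain n X →+ M)
    (K : AddSubgroup M) (h : ∀ σ ∈ S, f (.of σ) ∈ K) : f c ∈ K := by
  have : supportedChains S ≤ K.comap f := by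
    rw [supportedChains, AddSubgroup.closure_le]
    rintro _ ⟨σ, hσ, rfl⟩
    exact h σ hσ
  exact this hc

/-- The simplices of the barycentric subdivision of `Δⁿ` have mesh at most `n / (n + 1)`. -/
lemma subdivisionChain_mem (n : ℕ) : subdivisionChain n ∈
    supportedChains {τ : C(TopSimplex n, TopSimplex n) | HasMesh (n / (n + 1)) τ} := by
  induction n with
  | zero =>
    refine of_mem_supportedChains ⟨fun i ↦ stdSimplex.vertex i, fun t k ↦ ?_, fun i j ↦ ?_⟩
    · simp
    · obtain rfl : i = j := Fin.ext (by lia)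
      simp [l1Dist]
  | succ n ih =>
    have h₁ : act (subdivisionChain n) (boundary n (.of (.id (TopSimplex (n + 1))))) ∈
        supportedChains {τ : C(TopSimplex n, TopSimplex (n + 1)) | HasMesh (n / (n + 1)) τ} := by
      rw [boundary_of, map_sum]
      refine AddSubgroup.sum_mem _ fun i _ ↦ ?_
      rw [map_zsmul]
      refine AddSubgroup.zsmul_mem _ ?_ _
      rw [ContinuousMap.id_comp, act_of]
      exact mem_of_mem_supportedChains ih _ _ fun τ hτ ↦
        of_mem_supportedChains (hτ.faceMap_comp i)
    refine mem_of_mem_supportedChains h₁ _ _ fun τ hτ ↦ of_mem_supportedChains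
      (HasMesh.coneSimplex hτ ?_)
    push_cast
    rw [div_le_div_iff₀ (by positivity) (by positivity)]
    linarith

lemma iterate_subdivide_mem {n : ℕ} (σ : C(TopSimplex n, X)) (k : ℕ) :
    (subdivide n)^[k] (.of σ) ∈ supportedChains {ρ | ∃ τ : C(TopSimplex n, TopSimplex n),
      ρ = σ.comp τ ∧ ∀ s t, l1Dist (τ s) (τ t) ≤ (n / (n + 1) : ℝ) ^ k * l1Dist s t} := by
  induction k with
  | zero => exact of_mem_supportedChains ⟨.id _, by simp, by simp⟩
  | succ k ih =>
    rw [Function.iterate_succ_apply']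
    refine mem_of_mem_supportedChains ih _ _ ?_
    rintro _ ⟨τ, rfl, hτ⟩
    rw [subdivide, act_of]
    refine mem_of_mem_supportedChains (subdivisionChain_mem n) _ _ fun τ' hτ' ↦
      of_mem_supportedChains ⟨τ.comp τ', by rw [ContinuousMap.comp_assoc], fun s t ↦ ?_⟩
    calc l1Dist (τ (τ' s)) (τ (τ' t)) ≤ (n / (n + 1) : ℝ) ^ k * l1Dist (τ' s) (τ' t) := hτ _ _
      _ ≤ (n / (n + 1) : ℝ) ^ k * (n / (n + 1) * l1Dist s t) := by
        gcongr
        exact HasMesh.l1Dist_le hτ' s t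
      _ = _ := by ring

/-- All sufficiently fine subdivisions of a chain consist of simplices each of which is contained
in a member of a given open cover. -/
lemma exists_iterate_subdivide_mem {ι : Type*} {W : ι → Set X} (hW : ∀ i, IsOpen (W i))
    (hcover : ⋃ i, W i = Set.univ) {n : ℕ} (c : SingularChain n X) :
    ∃ K, ∀ k ≥ K, (subdivide n)^[k] c ∈ supportedChains {σ | ∃ i, Set.range σ ⊆ W i} := by
  induction c using FreeAbelianGroup.induction_on with
  | zero => exact ⟨0, fun k _ ↦ by rw [iterate_map_zero]; exact zero_mem _⟩
  | add x y hx hy =>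
    obtain ⟨K, hK⟩ := hx
    obtain ⟨K', hK'⟩ := hy
    refine ⟨max K K', fun k hk ↦ ?_⟩
    rw [iterate_map_add]
    exact add_mem (hK k ((le_max_left _ _).trans hk)) (hK' k ((le_max_right _ _).trans hk))
  | neg x hx =>
    obtain ⟨K, hK⟩ := hx
    exact ⟨K, fun k hk ↦ by rw [iterate_map_neg]; exact neg_mem (hK k hk)⟩
  | of σ =>
    obtain ⟨δ, hδ, h⟩ := lebesgue_number_lemma_of_metric (s := Set.univ)
      (c := fun i ↦ σ ⁻¹' W i) isCompact_univ (fun i ↦ (hW i).preimage σ.continuous)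
      (by rw [← Set.preimage_iUnion, hcover, Set.preimage_univ])
    have hlt : (n / (n + 1) : ℝ) < 1 := by
      rw [div_lt_one (by positivity)]; linarith
    obtain ⟨K, hK⟩ := exists_pow_lt_of_lt_one (half_pos hδ) hlt
    refine ⟨K, fun k hk ↦ supportedChains_mono ?_ (iterate_subdivide_mem σ k)⟩
    rintro _ ⟨τ, rfl, hτ⟩
    obtain ⟨i, hi⟩ := h (τ (Classical.arbitrary _)) trivial
    refine ⟨i, ?_⟩
    rintro _ ⟨s, rfl⟩
    refine hi (Metric.mem_ball.2 ?_)
    calc dist (τ s) (τ (Classical.arbitrary _))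
        ≤ (n / (n + 1) : ℝ) ^ k * l1Dist s (Classical.arbitrary _) :=
          (dist_le_l1Dist _ _).trans (hτ _ _)
      _ ≤ (n / (n + 1) : ℝ) ^ K * 2 := by
          exact mul_le_mul (pow_le_pow_of_le_one (by positivity) hlt.le hk) (l1Dist_le_two _ _)
            (Finset.sum_nonneg fun _ _ ↦ abs_nonneg _) (by positivity)
      _ < δ := by linarith

end Subdivision

/-! ### Locality of singular cochains -/

section Primitive

variable {Y : Type*} [TopologicalSpace Y] {N A : Type*} [AddCommGroup N] [AddCommGroup A]

open SingularChain

lemma boundary_iterate_subdivide {n : ℕ} (k : ℕ) (c : SingularChain (n + 1) Y) :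
    boundary n ((subdivide (n + 1))^[k] c) = (subdivide n)^[k] (boundary n c) :=
  Function.Semiconj.iterate_right (f := boundary n) boundary_subdivide k c

lemma push_iterate_subdivide {Z : Type*} [TopologicalSpace Z] {n : ℕ} (f : C(Y, Z)) (k : ℕ)
    (c : SingularChain n Y) : push n f ((subdivide n)^[k] c) = (subdivide n)^[k] (push n f c) :=
  Function.Semiconj.iterate_right (f := push n f) (push_subdivide f) k c

/-- Each cochain of the family `a x` vanishes on all sufficiently fine subdivisions of any given
chain. -/
def VanishesOnFineChains {n : ℕ} (a : N →+ SingularChain n Y →+ A) : Prop :=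
  ∀ x c, ∃ K, ∀ k ≥ K, a x ((subdivide n)^[k] c) = 0

lemma VanishesOnFineChains.finite {n : ℕ} {a : N →+ SingularChain n Y →+ A}
    (h : VanishesOnFineChains a) (x : N) (c : SingularChain n Y) :
    (Function.support fun k ↦ a x ((subdivide n)^[k] c)).Finite := by
  obtain ⟨K, hK⟩ := h x c
  refine (Set.finite_lt_nat K).subset fun k hk ↦ ?_
  by_contra hkK
  exact hk (hK k (not_lt.1 hkK))

/-- If `a x` vanishes on fine chains and is a cocycle, then `∑ₖ a x ∘ Sdᵏ ∘ T` is a cochain with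
coboundary `a x`; here `Sd` is the barycentric subdivision and `T` the homotopy between `Sd` and
the identity. -/
noncomputable def subdivisionPrimitive {n : ℕ} (a : N →+ SingularChain (n + 1) Y →+ A)
    (h : VanishesOnFineChains a) : N →+ SingularChain n Y →+ A :=
  AddMonoidHom.mk' (fun x ↦ AddMonoidHom.mk'
      (fun c ↦ ∑ᶠ k, a x ((subdivide (n + 1))^[k] (subdivisionHomotopy n c))) fun c c' ↦ by
        rw [← finsum_add_distrib (h.finite _ _) (h.finite _ _)]
        simp only [map_add, iterate_map_add]) fun x x' ↦ by
    refine AddMonoidHom.ext fun c ↦ ?_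
    simp only [AddMonoidHom.mk'_apply, AddMonoidHom.add_apply]
    rw [← finsum_add_distrib (h.finite _ _) (h.finite _ _)]
    simp only [map_add, AddMonoidHom.add_apply]

lemma subdivisionPrimitive_apply {n : ℕ} (a : N →+ SingularChain (n + 1) Y →+ A)
    (h : VanishesOnFineChains a) (x : N) (c : SingularChain n Y) :
    subdivisionPrimitive a h x c =
      ∑ᶠ k, a x ((subdivide (n + 1))^[k] (subdivisionHomotopy n c)) := rfl

lemma subdivisionPrimitive_boundary {n : ℕ} (a : N →+ SingularChain (n + 1) Y →+ A)
    (h : VanishesOnFineChains a) (x : N)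
    (hx : ∀ c : SingularChain (n + 2) Y, a x (boundary (n + 1) c) = 0)
    (c : SingularChain (n + 1) Y) : subdivisionPrimitive a h x (boundary n c) = a x c := by
  obtain ⟨K, hK⟩ := h x c
  have hterm : ∀ k, a x ((subdivide (n + 1))^[k] (subdivisionHomotopy n (boundary n c))) =
      a x ((subdivide (n + 1))^[k] c) - a x ((subdivide (n + 1))^[k + 1] c) := fun k ↦ by
    have : subdivisionHomotopy n (boundary n c) = c - subdivide (n + 1) c -
        boundary (n + 1) (subdivisionHomotopy (n + 1) c) := by
      rw [boundary_subdivisionHomotopy]; abel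
    rw [this, iterate_map_sub, iterate_map_sub, map_sub, map_sub, ← boundary_iterate_subdivide, hx,
      sub_zero, Function.iterate_succ_apply]
  rw [subdivisionPrimitive_apply]
  simp only [hterm]
  rw [finsum_eq_sum_of_support_subset (s := Finset.range K), Finset.sum_range_sub', hK K le_rfl]
  · simp
  · intro k hk
    by_contra hkK
    have : K ≤ k := by simpa using hkK
    exact hk (by simp only [hK k this, hK (k + 1) (this.trans (Nat.le_succ k)), sub_zero])

end Primitive

/-! ### The presheaves of singular cochains -/

section Presheaves

variable {X : TopCat.{u}}

/-- The category of presheaves of abelian groups on `X`. -/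
abbrev AbPresheaf (X : TopCat.{u}) := (Opens X)ᵒᵖ ⥤ AddCommGrpCat.{u}

/-- The sheafification functor for presheaves of abelian groups on `X`. -/
noncomputable abbrev sheafification (X : TopCat.{u}) : AbPresheaf X ⥤ AbSheaf X :=
  presheafToSheaf (Opens.grothendieckTopology X) AddCommGrpCat.{u}

/-- The inclusion between open subsets, as a continuous map. -/
def openInclusion {U V : Opens X} (h : U ≤ V) : C(U, V) := ContinuousMap.inclusion h

/-- The homomorphism `Hom(N, A) → Hom(M, A)` given by precomposition with `f : M → N`. -/
def precompHom {M N : Type*} [AddCommGroup M] [AddCommGroup N] (A : Type*) [AddCommGroup A]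
    (f : M →+ N) : (N →+ A) →+ (M →+ A) :=
  AddMonoidHom.mk' (fun a ↦ a.comp f) fun _ _ ↦ rfl

/-- The presheaf `U ↦ C^n(U; A)` of singular cochains on `X`. -/
abbrev cochainPresheaf (X : TopCat.{u}) (A : AddCommGrpCat.{u}) (n : ℕ) : AbPresheaf X where
  obj U := AddCommGrpCat.of (SingularChain n U.unop →+ A)
  map i := AddCommGrpCat.ofHom (precompHom A (SingularChain.push n (openInclusion i.unop.le)))
  map_id U := AddCommGrpCat.hom_ext <| AddMonoidHom.ext fun a ↦ AddMonoidHom.ext fun c ↦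
    congrArg (a : SingularChain n U.unop →+ A) (SingularChain.push_id c)
  map_comp {U _ _} i i' := AddCommGrpCat.hom_ext <| AddMonoidHom.ext fun a ↦
    AddMonoidHom.ext fun c ↦ congrArg (a : SingularChain n U.unop →+ A)
      (SingularChain.push_push (openInclusion i.unop.le) (openInclusion i'.unop.le) c).symm

/-- The coboundary operator on singular cochains. -/
noncomputable def coboundary (X : TopCat.{u}) (A : AddCommGrpCat.{u}) (n : ℕ) :
    cochainPresheaf X A n ⟶ cochainPresheaf X A (n + 1) where
  app _ := AddCommGrpCat.ofHom (precompHom A (SingularChain.boundary n))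
  naturality U _ i := AddCommGrpCat.hom_ext <| AddMonoidHom.ext fun a ↦ AddMonoidHom.ext fun c ↦
    congrArg (a : SingularChain n U.unop →+ A)
      (SingularChain.push_boundary (openInclusion i.unop.le) c)

/-- The complex of presheaves of singular cochains on `X`. -/
noncomputable abbrev cochainPresheafComplex (X : TopCat.{u}) (A : AddCommGrpCat.{u}) :
    CochainComplex (AbPresheaf X) ℕ :=
  CochainComplex.of (cochainPresheaf X A) (coboundary X A) fun n ↦
    NatTrans.ext <| funext fun U ↦ AddCommGrpCat.hom_ext <| AddMonoidHom.ext fun a ↦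
      AddMonoidHom.ext fun c ↦
        (congrArg (a : SingularChain n U.unop →+ A) (SingularChain.boundary_boundary c)).trans
          (map_zero (a : SingularChain n U.unop →+ A))

lemma cochainPresheafComplex_d (A : AddCommGrpCat.{u}) (n : ℕ) :
    (cochainPresheafComplex X A).d n (n + 1) = coboundary X A n :=
  CochainComplex.of_d _ _ _

/-- The components of a morphism from a presheaf to a presheaf of singular cochains. -/
def evalCochain {N : AbPresheaf X} {A : AddCommGrpCat.{u}} {n : ℕ} (z : N ⟶ cochainPresheaf X A n)
    (U : Opens X) : N.obj (op U) →+ SingularChain n U →+ A :=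
  (z.app (op U)).hom

lemma evalCochain_map {N : AbPresheaf X} {A : AddCommGrpCat.{u}} {n : ℕ}
    (z : N ⟶ cochainPresheaf X A n) {U V : Opens X} (h : U ≤ V) (x : N.obj (op V))
    (c : SingularChain n U) :
    evalCochain z U (N.map (homOfLE h).op x) c =
      evalCochain z V x (SingularChain.push n (openInclusion h) c) :=
  DFunLike.congr_fun (ConcreteCategory.congr_hom (z.naturality (homOfLE h).op) x) c

/-- A morphism from a presheaf to a presheaf of singular cochains, given by its components. -/
def homToCochain {N : AbPresheaf X} {A : AddCommGrpCat.{u}} {n : ℕ}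
    (z : ∀ U : Opens X, N.obj (op U) →+ SingularChain n U →+ A)
    (hz : ∀ (U V : Opens X) (h : U ≤ V) (x : N.obj (op V)) (σ : C(TopSimplex n, U)),
      z U (N.map (homOfLE h).op x) (.of σ) = z V x (.of ((openInclusion h).comp σ))) :
    N ⟶ cochainPresheaf X A n where
  app U := AddCommGrpCat.ofHom (z U.unop)
  naturality _ _ i := AddCommGrpCat.hom_ext <| AddMonoidHom.ext fun x ↦
    FreeAbelianGroup.lift_ext _ _ fun σ ↦ hz _ _ i.unop.le x σ

@[simp]
lemma evalCochain_homToCochain {N : AbPresheaf X} {A : AddCommGrpCat.{u}} {n : ℕ}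
    (z : ∀ U : Opens X, N.obj (op U) →+ SingularChain n U →+ A) (hz) (U : Opens X) :
    evalCochain (homToCochain z hz) U = z U := rfl

lemma cochainHom_ext {N : AbPresheaf X} {A : AddCommGrpCat.{u}} {n : ℕ}
    {z z' : N ⟶ cochainPresheaf X A n}
    (h : ∀ U x σ, evalCochain z U x (.of σ) = evalCochain z' U x (.of σ)) : z = z' := by
  refine NatTrans.ext <| funext fun U ↦ AddCommGrpCat.hom_ext <| AddMonoidHom.ext fun x ↦ ?_
  exact FreeAbelianGroup.lift_ext _ _ fun σ ↦ h U.unop x σ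

lemma evalCochain_comp_coboundary {N : AbPresheaf X} {A : AddCommGrpCat.{u}} {n : ℕ}
    (z : N ⟶ cochainPresheaf X A n) (U : Opens X) (x : N.obj (op U))
    (c : SingularChain (n + 1) U) : evalCochain (z ≫ coboundary X A n) U x c =
      evalCochain z U x (SingularChain.boundary n c) := rfl

/-- The sections of a presheaf whose sheafification is zero are locally zero. -/
lemma exists_map_eq_zero {N : AbPresheaf X} (hN : IsZero ((sheafification X).obj N)) {U : Opens X}
    (x : N.obj (op U)) {p : X} (hp : p ∈ U) :
    ∃ (V : Opens X) (h : V ≤ U), p ∈ V ∧ N.map (homOfLE h).op x = 0 := by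
  have hz : toSheafify (Opens.grothendieckTopology X) N = 0 :=
    ((sheafToPresheaf _ _).map_isZero hN).eq_of_tgt _ _
  have := Presheaf.equalizerSieve_mem (Opens.grothendieckTopology X)
    (toSheafify (Opens.grothendieckTopology X) N) x 0 (by rw [hz]; simp)
  obtain ⟨V, f, hf, hpV⟩ := this p hp
  exact ⟨V, f.le, hpV, hf.trans (map_zero _)⟩

/-- If the presheaf `N` has vanishing sheafification, then each section is zero on the members of an
open cover, and sufficiently fine subdivisions of a chain are supported on such a cover. -/
lemma vanishesOnFineChains {N : AbPresheaf X} (hN : IsZero ((sheafification X).obj N))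
    {A : AddCommGrpCat.{u}} {n : ℕ} (z : N ⟶ cochainPresheaf X A n) (U : Opens X) :
    VanishesOnFineChains (evalCochain z U) := by
  intro x c
  -- the open cover of `U` by the open subsets on which `x` vanishes
  let ι := {V : Opens X // ∃ h : V ≤ U, N.map (homOfLE h).op x = 0}
  let W : ι → Set U := fun V ↦ Subtype.val ⁻¹' (V.1 : Set X)
  obtain ⟨K, hK⟩ := exists_iterate_subdivide_mem (W := W)
    (fun V ↦ V.1.isOpen.preimage continuous_subtype_val) (by
      refine Set.eq_univ_of_forall fun p ↦ Set.mem_iUnion.2 ?_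
      obtain ⟨V, h, hpV, hV⟩ := exists_map_eq_zero hN x p.2
      exact ⟨⟨V, h, hV⟩, hpV⟩) c
  refine ⟨K, fun k hk ↦ ?_⟩
  refine mem_of_mem_supportedChains (hK k hk) (evalCochain z U x) ⊥ ?_
  rintro σ ⟨⟨V, h, hV⟩, hσ⟩
  let σ' : C(TopSimplex n, V) :=
    ⟨fun t ↦ ⟨σ t, hσ ⟨t, rfl⟩⟩, by fun_prop⟩
  have h₁ := evalCochain_map z h x (.of σ')
  rw [hV, map_zero, AddMonoidHom.zero_apply] at h₁
  exact h₁.symm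

/-- The complex of singular cochains is local: for every presheaf `N` with vanishing
sheafification, the complex `Hom(N, C^•(-; A))` is contractible, by subdivision of chains. -/
lemma isLocalComplex_cochainPresheafComplex (A : AddCommGrpCat.{u}) :
    IsLocalComplex (sheafification X) (cochainPresheafComplex X A) := by
  intro N hN
  refine ⟨fun z _ ↦ ?_, fun n z hz ↦ ?_⟩
  · refine cochainHom_ext (A := A) (n := 0) (z := z) (z' := 0) fun U x σ ↦ ?_
    obtain ⟨K, hK⟩ := vanishesOnFineChains hN (A := A) (n := 0) z U x (.of σ)
    have h : ∀ k, (subdivide 0)^[k] (.of σ : SingularChain 0 U) = .of σ := fun k ↦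
      Function.iterate_fixed (subdivide_zero _) k
    have := hK K le_rfl
    rw [h] at this
    exact this
  · rw [cochainPresheafComplex_d] at hz
    have hz' : ∀ (U : Opens X) x (c : SingularChain (n + 2) U),
        evalCochain (A := A) (n := n + 1) z U x (SingularChain.boundary (n + 1) c) = 0 :=
      fun U x c ↦ DFunLike.congr_fun (congr(evalCochain $hz U x)) c
    refine ⟨homToCochain (A := A) (n := n)
      (fun U ↦ subdivisionPrimitive (evalCochain (n := n + 1) z U) (vanishesOnFineChains hN _ U))
      fun U V h x σ ↦ ?_, ?_⟩
    · rw [subdivisionPrimitive_apply, subdivisionPrimitive_apply]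
      refine finsum_congr fun k ↦ ?_
      rw [evalCochain_map, push_iterate_subdivide, push_subdivisionHomotopy]
      rfl
    · rw [cochainPresheafComplex_d]
      refine cochainHom_ext (A := A) (n := n + 1) fun U x σ ↦ ?_
      rw [evalCochain_comp_coboundary, evalCochain_homToCochain]
      exact subdivisionPrimitive_boundary _ _ _ (hz' U x) _

end Presheaves

/-! ### Cochains with values in injective groups -/

section Injective

variable {X : TopCat.{u}}

/-- The open subsets of `X` which contain the image of a singular simplex. -/
abbrev SimplexNhd {n : ℕ} (ρ : C(TopSimplex n, X)) :=
  ObjectProperty.FullSubcategory fun U : Opens X ↦ Set.range ρ ⊆ U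

/-- A singular simplex of `X`, regarded as a singular simplex of an open neighbourhood. -/
def simplexRestrict {n : ℕ} (ρ : C(TopSimplex n, X)) (U : Opens X) (h : Set.range ρ ⊆ U) :
    C(TopSimplex n, U) :=
  ⟨fun t ↦ ⟨ρ t, h ⟨t, rfl⟩⟩, by fun_prop⟩

/-- A singular simplex of an open subset of `X`, regarded as a singular simplex of `X`. -/
def simplexExtend {n : ℕ} {U : Opens X} (σ : C(TopSimplex n, U)) : C(TopSimplex n, X) :=
  ⟨fun t ↦ (σ t : X), by fun_prop⟩

lemma range_simplexExtend {n : ℕ} {U : Opens X} (σ : C(TopSimplex n, U)) :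
    Set.range (simplexExtend σ) ⊆ U := by
  rintro _ ⟨t, rfl⟩
  exact (σ t).2

instance {n : ℕ} (ρ : C(TopSimplex n, X)) : IsFiltered (SimplexNhd ρ)ᵒᵖ := by
  have : IsCofiltered (SimplexNhd ρ) := by
    have : IsCofilteredOrEmpty (SimplexNhd ρ) :=
      { cone_objs := fun U V ↦ ⟨⟨U.1 ⊓ V.1, Set.subset_inter U.2 V.2⟩,
          ObjectProperty.homMk (homOfLE inf_le_left),
          ObjectProperty.homMk (homOfLE inf_le_right), trivial⟩
        cone_maps := fun U V f g ↦ ⟨U, 𝟙 U, by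
          congr 1
          exact ObjectProperty.hom_ext _ (Subsingleton.elim _ _)⟩ }
    exact { nonempty := ⟨⟨⊤, fun _ _ ↦ trivial⟩⟩ }
  infer_instance

/-- The stalk of a presheaf at (the image of) a singular simplex. -/
noncomputable abbrev simplexStalk {n : ℕ} (ρ : C(TopSimplex n, X)) :
    AbPresheaf X ⥤ AddCommGrpCat.{u} :=
  (Functor.whiskeringLeft _ _ _).obj (ObjectProperty.ι _ : SimplexNhd ρ ⥤ Opens X).op ⋙ colim

/-- The germ at a singular simplex of sections over a neighbourhood of its image. -/
noncomputable def simplexGerm {n : ℕ} (ρ : C(TopSimplex n, X)) (F : AbPresheaf X) (U : Opens X)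
    (h : Set.range ρ ⊆ U) : F.obj (op U) ⟶ (simplexStalk ρ).obj F :=
  colimit.ι ((ObjectProperty.ι _ : SimplexNhd ρ ⥤ Opens X).op ⋙ F) (op ⟨U, h⟩)

lemma map_simplexGerm {n : ℕ} (ρ : C(TopSimplex n, X)) (F : AbPresheaf X) {U V : Opens X}
    (h : Set.range ρ ⊆ U) (hUV : U ≤ V) :
    F.map (homOfLE hUV).op ≫ simplexGerm ρ F U h = simplexGerm ρ F V (h.trans hUV) :=
  colimit.w ((ObjectProperty.ι _ : SimplexNhd ρ ⥤ Opens X).op ⋙ F)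
    (ObjectProperty.homMk (homOfLE hUV : U ⟶ V) :
      (⟨U, h⟩ : SimplexNhd ρ) ⟶ ⟨V, h.trans hUV⟩).op

lemma simplexGerm_map {n : ℕ} (ρ : C(TopSimplex n, X)) {F G : AbPresheaf X} (f : F ⟶ G)
    (U : Opens X) (h : Set.range ρ ⊆ U) :
    simplexGerm ρ F U h ≫ (simplexStalk ρ).map f = f.app _ ≫ simplexGerm ρ G U h :=
  ι_colimMap _ _

instance {n : ℕ} (ρ : C(TopSimplex n, X)) {F G : AbPresheaf X} (f : F ⟶ G) [Mono f] :
    Mono ((simplexStalk ρ).map f) := by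
  have : Mono (((Functor.whiskeringLeft _ _ AddCommGrpCat.{u}).obj
      (ObjectProperty.ι _ : SimplexNhd ρ ⥤ Opens X).op).map f) := by
    rw [NatTrans.mono_iff_mono_app]
    intro U
    exact (NatTrans.mono_iff_mono_app f).1 inferInstance _
  rw [Functor.comp_map]
  infer_instance

/-- For an injective group `J`, the presheaf of singular cochains with values in `J` is injective:
a morphism from `F` to this presheaf is a family of maps from the stalks of `F` at all singular
simplices to `J`, and taking stalks is exact. -/
instance injective_cochainPresheaf (J : AddCommGrpCat.{u}) [Injective J] (n : ℕ) :
    Injective (cochainPresheaf X J n) where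
  factors {F G} z m hm := by
    let c (ρ : C(TopSimplex n, X)) :
        Cocone ((ObjectProperty.ι _ : SimplexNhd ρ ⥤ Opens X).op ⋙ F) :=
      { pt := J
        ι :=
          { app := fun U ↦ AddCommGrpCat.ofHom ((evalCochain z U.unop.1).flip
              (.of (simplexRestrict ρ U.unop.1 U.unop.2)))
            naturality := fun V U i ↦ AddCommGrpCat.hom_ext <| AddMonoidHom.ext fun x ↦
              evalCochain_map z i.unop.hom.le x _ } }
    let g (ρ : C(TopSimplex n, X)) : (simplexStalk ρ).obj F ⟶ J := colimit.desc _ (c ρ)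
    let e (ρ : C(TopSimplex n, X)) : (simplexStalk ρ).obj G ⟶ J :=
      Injective.factorThru (g ρ) ((simplexStalk ρ).map m)
    let w (U : Opens X) : G.obj (op U) →+ SingularChain n U →+ J :=
      (FreeAbelianGroup.lift fun σ : C(TopSimplex n, U) ↦
        (simplexGerm (simplexExtend σ) G U (range_simplexExtend σ) ≫ e (simplexExtend σ)).hom).flip
    have hw : ∀ U x σ, w U x (.of σ) =
        (simplexGerm (simplexExtend σ) G U (range_simplexExtend σ) ≫ e (simplexExtend σ)) x :=
      fun U x σ ↦ DFunLike.congr_fun (FreeAbelianGroup.lift_apply_of (fun σ : C(TopSimplex n, U) ↦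
        (simplexGerm (simplexExtend σ) G U (range_simplexExtend σ) ≫ e (simplexExtend σ)).hom) σ) x
    refine ⟨homToCochain w fun U V h x σ ↦ ?_, cochainHom_ext fun U x σ ↦ ?_⟩
    · rw [hw, hw]
      have := map_simplexGerm (simplexExtend σ) G (range_simplexExtend σ) h
      exact ConcreteCategory.congr_hom (this =≫ e (simplexExtend σ)) x
    · refine (hw U (m.app _ x) σ).trans ?_
      have h₂ : m.app (op U) ≫ simplexGerm (simplexExtend σ) G U (range_simplexExtend σ) ≫
          e (simplexExtend σ) = (c (simplexExtend σ)).ι.app (op ⟨U, range_simplexExtend σ⟩) := by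
        rw [← Category.assoc, ← simplexGerm_map, Category.assoc, Injective.comp_factorThru]
        exact colimit.ι_desc _ _
      exact ConcreteCategory.congr_hom h₂ x

end Injective

/-! ### Change of coefficients -/

section Coefficients

variable {X : TopCat.{u}}

/-- The morphism of presheaves of cochains induced by a homomorphism of coefficient groups. -/
def cochainCoeff (X : TopCat.{u}) {A B : AddCommGrpCat.{u}} (g : A ⟶ B) (n : ℕ) :
    cochainPresheaf X A n ⟶ cochainPresheaf X B n where
  app _ := AddCommGrpCat.ofHom (AddMonoidHom.compHom g.hom)
  naturality _ _ _ := rfl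

lemma evalCochain_comp_cochainCoeff {N : AbPresheaf X} {A B : AddCommGrpCat.{u}} (g : A ⟶ B)
    {n : ℕ} (z : N ⟶ cochainPresheaf X A n) (U : Opens X) (x : N.obj (op U))
    (c : SingularChain n U) :
    evalCochain (z ≫ cochainCoeff X g n) U x c = g (evalCochain z U x c) := rfl

/-- The morphism of complexes of presheaves induced by a homomorphism of coefficient groups. -/
noncomputable def cochainComplexCoeff (X : TopCat.{u}) {A B : AddCommGrpCat.{u}} (g : A ⟶ B) :
    cochainPresheafComplex X A ⟶ cochainPresheafComplex X B :=
  CochainComplex.ofHom (cochainCoeff X g) fun n ↦ by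
    rw [cochainPresheafComplex_d, cochainPresheafComplex_d]
    rfl

lemma cochainComplexCoeff_f {A B : AddCommGrpCat.{u}} (g : A ⟶ B) (n : ℕ) :
    (cochainComplexCoeff X g).f n = cochainCoeff X g n := rfl

/-- Quotients of injective groups are injective, because they are divisible. -/
lemma injective_of_epi {J K : AddCommGrpCat.{u}} [Injective J] (v : J ⟶ K) [Epi v] :
    Injective K := by
  have hsurj : ∀ m : ℤ, m ≠ 0 → ∀ a : K, ∃ b, m • b = a := fun m hm a ↦ by
    obtain ⟨j, rfl⟩ := (AddCommGrpCat.epi_iff_surjective v).1 inferInstance a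
    let i : AddCommGrpCat.of (ULift.{u} ℤ) ⟶ AddCommGrpCat.of (ULift.{u} ℤ) :=
      AddCommGrpCat.ofHom (zsmulAddGroupHom m)
    have : Mono i := by
      rw [AddCommGrpCat.mono_iff_injective]
      rintro ⟨x⟩ ⟨y⟩ h
      have h' : m * x = m * y := congrArg ULift.down h
      exact congrArg ULift.up (mul_left_cancel₀ hm h')
    let f : AddCommGrpCat.of (ULift.{u} ℤ) ⟶ J :=
      AddCommGrpCat.ofHom ((zmultiplesHom J j).comp AddEquiv.ulift.toAddMonoidHom)
    let f' := Injective.factorThru f i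
    have hf' : f' (i ⟨1⟩) = f ⟨1⟩ := ConcreteCategory.congr_hom (Injective.comp_factorThru f i) _
    have h₁ : i ⟨1⟩ = m • (⟨1⟩ : ULift.{u} ℤ) := rfl
    have h₂ : f ⟨1⟩ = (1 : ℤ) • j := rfl
    refine ⟨v (f' ⟨1⟩), ?_⟩
    rw [← map_zsmul, ← map_zsmul, ← h₁, hf', h₂, one_smul]
  let : DivisibleBy K ℤ := divisibleByOfSMulRightSurj K ℤ fun {m} hm a ↦ hsurj m hm a
  exact AddCommGrpCat.injective_of_divisible K

/-- Free presheaves are good: a morphism from such a presheaf to `C^n(-; K)` is a family of elements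
of `K`, which can be lifted to `J`. -/
lemma isGood_free {J K : AddCommGrpCat.{u}} (v : J ⟶ K) [Epi v] (Q : (Opens X)ᵒᵖ ⥤ Type u) :
    IsGood (cochainComplexCoeff X v) (Q ⋙ AddCommGrpCat.free) := by
  intro n (k : Q ⋙ AddCommGrpCat.free ⟶ cochainPresheaf X K n)
  obtain ⟨r, hr⟩ := ((AddCommGrpCat.epi_iff_surjective v).1 inferInstance).hasRightInverse
  let j (U : Opens X) : FreeAbelianGroup (Q.obj (op U)) →+ SingularChain n U →+ J :=
    FreeAbelianGroup.lift fun q ↦ FreeAbelianGroup.lift fun σ ↦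
      r (evalCochain k U (FreeAbelianGroup.of q) (.of σ))
  have hj : ∀ U q σ, j U (.of q) (.of σ) =
      r (evalCochain k U (FreeAbelianGroup.of q) (.of σ)) := fun U q σ ↦ by
    simp only [j, FreeAbelianGroup.lift_apply_of]
  refine ⟨homToCochain j fun U V h x σ ↦ ?_, ?_⟩
  · have h₁ : (j U).comp ((Q ⋙ AddCommGrpCat.free).map (homOfLE h).op).hom =
        (precompHom J (SingularChain.push n (openInclusion h))).comp (j V) := by
      refine FreeAbelianGroup.lift_ext _ _ fun q ↦ FreeAbelianGroup.lift_ext _ _ fun σ ↦ ?_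
      have h₂ := evalCochain_map k h (FreeAbelianGroup.of q) (.of σ)
      refine (hj U (Q.map (homOfLE h).op q) σ).trans (Eq.trans ?_ (hj V q _).symm)
      exact congrArg r h₂
    exact DFunLike.congr_fun (DFunLike.congr_fun h₁ x) _
  · rw [cochainComplexCoeff_f]
    refine NatTrans.ext <| funext fun U ↦ AddCommGrpCat.hom_ext <|
      FreeAbelianGroup.lift_ext _ _ fun q ↦ FreeAbelianGroup.lift_ext _ _ fun σ ↦ ?_
    have h₁ := hr (evalCochain k U.unop (FreeAbelianGroup.of q) (.of σ))
    exact (congrArg v (hj U.unop q σ)).trans h₁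

/-- The constant presheaf `ℤ` is good: the constant presheaf `ℤ[pt]` of free groups is. -/
lemma isGood_const {J K : AddCommGrpCat.{u}} [Injective J] (v : J ⟶ K) [Epi v] :
    IsGood (cochainComplexCoeff X v)
      ((Functor.const (Opens X)ᵒᵖ).obj (AddCommGrpCat.of (ULift.{u} ℤ))) := by
  have := injective_of_epi v
  let m : AddCommGrpCat.of (ULift.{u} ℤ) ⟶ AddCommGrpCat.free.obj PUnit :=
    AddCommGrpCat.ofHom ((FreeAbelianGroup.uniqueEquiv PUnit).symm.toAddMonoidHom.comp
      AddEquiv.ulift.toAddMonoidHom)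
  have : Mono m := by
    rw [AddCommGrpCat.mono_iff_injective]
    exact (FreeAbelianGroup.uniqueEquiv PUnit).symm.injective.comp ULift.down_injective
  let m' : (Functor.const (Opens X)ᵒᵖ).obj (AddCommGrpCat.of (ULift.{u} ℤ)) ⟶
      (Functor.const _).obj PUnit ⋙ AddCommGrpCat.free :=
    { app := fun _ ↦ m
      naturality := fun _ _ _ ↦ (Category.id_comp m).trans ((Category.comp_id m).symm.trans
        (congrArg (m ≫ ·) (AddCommGrpCat.free.map_id PUnit).symm)) }
  have : Mono m' := by
    have : ∀ U, Mono (m'.app U) := fun _ ↦ ‹Mono m›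
    exact NatTrans.mono_of_mono_app m'
  exact (isGood_free v ((Functor.const _).obj PUnit)).of_mono
    (fun n ↦ injective_cochainPresheaf K n) m'

/-- Every presheaf is a quotient of a good one, namely of the free presheaf on its sections. -/
lemma exists_epi_isGood {J K : AddCommGrpCat.{u}} (v : J ⟶ K) [Epi v] (Q : AbPresheaf X) :
    ∃ (T : AbPresheaf X) (p : T ⟶ Q), Epi p ∧ IsGood (cochainComplexCoeff X v) T := by
  let p : (Q ⋙ forget _) ⋙ AddCommGrpCat.free ⟶ Q :=
    Functor.whiskerLeft Q AddCommGrpCat.adj.counit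
  refine ⟨_, p, ?_, isGood_free v _⟩
  have : ∀ U, Epi (p.app U) := fun U ↦
    inferInstanceAs (Epi (AddCommGrpCat.adj.counit.app (Q.obj U)))
  exact NatTrans.epi_of_epi_app p

/-- A short exact sequence `0 ⟶ A ⟶ J ⟶ K ⟶ 0` of groups with `J` injective gives a short exact
sequence of complexes of presheaves of cochains. -/
noncomputable def cochainResolution {A J : AddCommGrpCat.{u}} [Injective J] (i : A ⟶ J) [Mono i] :
    LocalInjectiveResolution (sheafification X) (cochainPresheafComplex X A) where
  J := cochainPresheafComplex X J
  K := cochainPresheafComplex X (cokernel i)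
  i := cochainComplexCoeff X i
  v := cochainComplexCoeff X (cokernel.π i)
  mono_i n := by
    have : ∀ U, Mono ((cochainCoeff X i n).app U) := fun U ↦ by
      rw [AddCommGrpCat.mono_iff_injective]
      intro a b hab
      exact AddMonoidHom.ext fun c ↦
        (AddCommGrpCat.mono_iff_injective i).1 inferInstance (DFunLike.congr_fun hab c)
    exact NatTrans.mono_of_mono_app (cochainCoeff X i n)
  zero n := NatTrans.ext <| funext fun U ↦ AddCommGrpCat.hom_ext <| AddMonoidHom.ext fun a ↦
    AddMonoidHom.ext fun c ↦ ConcreteCategory.congr_hom (cokernel.condition i) (a c)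
  exists_lift n G j hj := by
    have hi : Function.Injective i := (AddCommGrpCat.mono_iff_injective i).1 inferInstance
    have hex := (ShortComplex.ab_exact_iff _).1 (ShortComplex.exact_cokernel i)
    have h (U : Opens X) (x : G.obj (op U)) (c : SingularChain n U) :
        ∃ a, i a = evalCochain (A := J) j U x c :=
      hex _ (DFunLike.congr_fun (congr(evalCochain (A := cokernel i) (n := n) $hj U x)) c)
    choose a ha using h
    refine ⟨homToCochain (A := A) (n := n) (fun U ↦ AddMonoidHom.mk' (fun x ↦
      AddMonoidHom.mk' (a U x) fun c c' ↦ hi ?_) fun x x' ↦ AddMonoidHom.ext fun c ↦ hi ?_)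
      fun U V h x σ ↦ hi ?_, ?_⟩
    · simp only [map_add, ha]
    · refine (ha _ _ _).trans (.trans ?_ (map_add i.hom _ _).symm)
      refine .trans ?_ (congr($(ha U x c) + $(ha U x' c))).symm
      simp only [map_add, AddMonoidHom.add_apply]
    · refine (ha _ _ _).trans (.trans ?_ (ha _ _ _).symm)
      exact evalCochain_map (A := J) j h x _
    · exact cochainHom_ext (A := J) (n := n) fun U x σ ↦ ha U x _
  injective_J _ := injective_cochainPresheaf _ _
  injective_K n := by
    have := injective_of_epi (cokernel.π i)
    exact injective_cochainPresheaf _ _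
  isLocal_J := isLocalComplex_cochainPresheafComplex J
  isLocal_K := isLocalComplex_cochainPresheafComplex _

end Coefficients

/-! ### Local exactness of the complex of singular cochains -/

section LocalExactness

lemma ContinuousMap.Nullhomotopic.nonempty_contraction {Y Z : Type*} [TopologicalSpace Y]
    [TopologicalSpace Z] {j : C(Y, Z)} (h : j.Nullhomotopic) : Nonempty (Contraction j) := by
  obtain ⟨pt, ⟨H⟩⟩ := h
  exact ⟨{ pt := pt
           map := H.toContinuousMap.comp .prodSwap
           map_zero := fun x ↦ H.apply_zero x
           map_one := fun x ↦ H.apply_one x }⟩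

variable {X : TopCat.{u}} {A : AddCommGrpCat.{u}}

lemma SemiLocallyContractible.exists_contraction (hX : SemiLocallyContractible X) {U : Opens X}
    {p : X} (hp : p ∈ U) :
    ∃ (W : Opens X) (h : W ≤ U), p ∈ W ∧ Nonempty (Contraction (openInclusion h)) := by
  obtain ⟨S, rfl, hS⟩ := hX U
  obtain ⟨W, hW, hpW⟩ := Opens.mem_sSup.1 hp
  obtain ⟨h, hn⟩ := hS W hW
  exact ⟨W, h, hpW, hn.nonempty_contraction⟩

/-- The cochain underlying a section of the presheaf of cocycles. -/
noncomputable def cocycleVal {n : ℕ} {U : Opens X}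
    (s : (kernel ((cochainPresheafComplex X A).d n (n + 1))).obj (op U)) :
    SingularChain n U →+ A :=
  (kernel.ι ((cochainPresheafComplex X A).d n (n + 1))).app (op U) s

lemma cocycleVal_injective {n : ℕ} {U : Opens X} :
    Function.Injective (cocycleVal (X := X) (A := A) (n := n) (U := U)) :=
  (AddCommGrpCat.mono_iff_injective _).1 ((NatTrans.mono_iff_mono_app
    (kernel.ι ((cochainPresheafComplex X A).d n (n + 1)))).1 inferInstance (op U))

lemma cocycleVal_boundary {n : ℕ} {U : Opens X}
    (s : (kernel ((cochainPresheafComplex X A).d n (n + 1))).obj (op U))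
    (c : SingularChain (n + 1) U) : cocycleVal s (SingularChain.boundary n c) = 0 := by
  have h : kernel.ι ((cochainPresheafComplex X A).d n (n + 1)) ≫ coboundary X A n = 0 :=
    (congrArg _ (cochainPresheafComplex_d A n).symm).trans (kernel.condition _)
  exact DFunLike.congr_fun (ConcreteCategory.congr_hom (congr_app h (op U)) s) c

lemma cocycleVal_map {n : ℕ} {U V : Opens X} (h : V ≤ U)
    (s : (kernel ((cochainPresheafComplex X A).d n (n + 1))).obj (op U))
    (c : SingularChain n V) :
    cocycleVal ((kernel ((cochainPresheafComplex X A).d n (n + 1))).map (homOfLE h).op s) c =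
      cocycleVal s (SingularChain.push n (openInclusion h) c) :=
  DFunLike.congr_fun (ConcreteCategory.congr_hom
    ((kernel.ι ((cochainPresheafComplex X A).d n (n + 1))).naturality (homOfLE h).op) s) c

lemma cocycleVal_toCocycles {n : ℕ} {U : Opens X} (a : SingularChain n U →+ A)
    (c : SingularChain (n + 1) U) :
    cocycleVal ((toCocycles (cochainPresheafComplex X A) n).app (op U) a) c =
      a (SingularChain.boundary n c) := by
  have h := (toCocycles_ι (cochainPresheafComplex X A) n).trans (cochainPresheafComplex_d A n)
  exact DFunLike.congr_fun (ConcreteCategory.congr_hom (congr_app h (op U)) a) c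

/-- On a semi-locally contractible space, cocycles of positive degree are locally coboundaries, by
the cone construction. -/
lemma isLocallyExact_cochainPresheafComplex (hX : SemiLocallyContractible X)
    (A : AddCommGrpCat.{u}) :
    IsLocallyExact (sheafification X) (cochainPresheafComplex X A) := by
  intro n
  have : Presheaf.IsLocallySurjective (Opens.grothendieckTopology X)
      (toCocycles (cochainPresheafComplex X A) n) := by
    refine ⟨fun {U} s p hp ↦ ?_⟩
    obtain ⟨W, h, hpW, ⟨H⟩⟩ := hX.exists_contraction hp
    refine ⟨W, homOfLE h, ⟨(cocycleVal s).comp (H.cone n), ?_⟩, hpW⟩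
    refine cocycleVal_injective <| AddMonoidHom.ext fun c ↦ ?_
    rw [cocycleVal_toCocycles, cocycleVal_map, AddMonoidHom.comp_apply, ← sub_eq_zero, ← map_sub,
      ← neg_eq_zero, ← map_neg, neg_sub, ← H.boundary_cone_succ, cocycleVal_boundary]
  have := (Presheaf.isLocallySurjective_presheafToSheaf_map_iff _ _).2 this
  exact Sheaf.epi_of_isLocallySurjective _

/-- The inclusion of constant functions in the presheaf of cochains of degree zero. -/
def constToCochains (X : TopCat.{u}) (A : AddCommGrpCat.{u}) :
    (Functor.const (Opens X)ᵒᵖ).obj A ⟶ cochainPresheaf X A 0 :=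
  homToCochain (N := (Functor.const (Opens X)ᵒᵖ).obj A)
    (fun _ ↦ ((smulAddHom ℤ A).comp (SingularChain.augmentation 0)).flip) fun _ _ _ x σ ↦ by
      simp

/-- The inclusion of constant functions in the presheaf of cocycles of degree zero. -/
noncomputable def constToCocycles (X : TopCat.{u}) (A : AddCommGrpCat.{u}) :
    (Functor.const (Opens X)ᵒᵖ).obj A ⟶ kernel ((cochainPresheafComplex X A).d 0 1) :=
  kernel.lift _ (constToCochains X A) (by
    rw [cochainPresheafComplex_d]
    refine cochainHom_ext (A := A) (n := 1) fun U x σ ↦ ?_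
    rw [evalCochain_comp_coboundary]
    refine (congrArg (· • x) (SingularChain.augmentation_boundary _)).trans (zero_smul ℤ x))

lemma constToCocycles_ι :
    constToCocycles X A ≫ kernel.ι _ = constToCochains X A := kernel.lift_ι _ _ _

lemma cocycleVal_constToCocycles {U : Opens X} (a : A) (c : SingularChain 0 U) :
    cocycleVal ((constToCocycles X A).app (op U) a) c = SingularChain.augmentation 0 c • a :=
  DFunLike.congr_fun (ConcreteCategory.congr_hom
    (congr_app (constToCocycles_ι (X := X) (A := A)) (op U)) a) c

/-- On a semi-locally contractible space, the cocycles in degree zero are the locally constant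
functions. -/
lemma isIso_sheafification_map_constToCocycles (hX : SemiLocallyContractible X)
    (A : AddCommGrpCat.{u}) : IsIso ((sheafification X).map (constToCocycles X A)) := by
  have h₁ : Presheaf.IsLocallySurjective (Opens.grothendieckTopology X)
      (constToCocycles X A) := by
    refine ⟨fun {U} s p hp ↦ ?_⟩
    obtain ⟨W, h, hpW, ⟨H⟩⟩ := hX.exists_contraction hp
    refine ⟨W, homOfLE h, ⟨cocycleVal s (.of (.const _ H.pt)), ?_⟩, hpW⟩
    refine cocycleVal_injective <| AddMonoidHom.ext fun c ↦ ?_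
    rw [cocycleVal_constToCocycles, cocycleVal_map, ← map_zsmul, ← sub_eq_zero, ← map_sub,
      ← neg_eq_zero, ← map_neg, neg_sub, ← H.boundary_cone_zero, cocycleVal_boundary]
  have h₂ : Presheaf.IsLocallyInjective (Opens.grothendieckTopology X)
      (constToCocycles X A) := by
    refine ⟨fun {U} a b hab p hp ↦ ⟨U.unop, 𝟙 _, ?_, hp⟩⟩
    have h := congr(cocycleVal $hab (.of (.const _ ⟨p, hp⟩)))
    rw [cocycleVal_constToCocycles, cocycleVal_constToCocycles, SingularChain.augmentation_of,
      one_smul, one_smul] at h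
    exact h
  rw [← GrothendieckTopology.W_iff, GrothendieckTopology.W_iff_isLocallyBijective]
  exact ⟨h₂, h₁⟩

end LocalExactness

/-! ### Singular cochains as homomorphisms on the free group of singular simplices -/

section ConcreteCochains

variable {X Y : TopCat.{u}} {A B : AddCommGrpCat.{u}}

/-- The inclusion of the summand of `C_n(X)` corresponding to a singular simplex. -/
noncomputable def simplexInclusion {n : ℕ} (σ : C(TopSimplex n, X)) :
    AddCommGrpCat.of (ULift.{u} ℤ) ⟶ (singularChains.obj X).X n :=
  (TopCat.toSSet.obj X).ιChainComplex ((X.toSSetObjEquiv (op (.mk n))).symm σ)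

lemma singularChains_hom_ext {n : ℕ} {x y : (singularChains.obj X).X n ⟶ A}
    (h : ∀ σ : C(TopSimplex n, X), simplexInclusion σ ≫ x = simplexInclusion σ ≫ y) : x = y :=
  SSet.chainComplex_hom_ext fun s ↦ by
    obtain ⟨σ, rfl⟩ := (X.toSSetObjEquiv (op (.mk n))).symm.surjective s
    exact h σ

lemma simplexInclusion_d {n : ℕ} (σ : C(TopSimplex (n + 1), X)) :
    simplexInclusion σ ≫ (singularChains.obj X).d (n + 1) n =
      ∑ i : Fin (n + 2), (-1 : ℤ) ^ i.val • simplexInclusion (σ.comp (faceMap n i)) :=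
  (TopCat.toSSet.obj X).ιChainComplex_d _ _

lemma simplexInclusion_map (f : X ⟶ Y) {n : ℕ} (σ : C(TopSimplex n, X)) :
    simplexInclusion σ ≫ (singularChains.map f).f n = simplexInclusion (f.hom.comp σ) :=
  SSet.ι_chainComplexMap_f _ _ _ _ _

lemma hom_uliftInt_ext {x y : AddCommGrpCat.of (ULift.{u} ℤ) ⟶ A} (h : x ⟨1⟩ = y ⟨1⟩) : x = y := by
  refine AddCommGrpCat.hom_ext <| AddMonoidHom.ext fun m ↦ ?_
  have hm : m = m.down • (⟨1⟩ : ULift.{u} ℤ) := ULift.ext _ _ (by simp)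
  rw [hm, map_zsmul, map_zsmul]
  exact congrArg _ h

/-- A cochain in `Hom(C_n(X), A)`, as a homomorphism on the free group on the singular simplices. -/
noncomputable def toConcrete {n : ℕ} :
    ((singularChains.obj X).X n ⟶ A) →+ (SingularChain n X →+ A) :=
  AddMonoidHom.mk' (fun x ↦ FreeAbelianGroup.lift fun σ ↦ (simplexInclusion σ ≫ x) ⟨1⟩)
    fun x y ↦ FreeAbelianGroup.lift_ext _ _ fun σ ↦ by
      simp [FreeAbelianGroup.lift_apply_of]

lemma toConcrete_of {n : ℕ} (x : (singularChains.obj X).X n ⟶ A) (σ : C(TopSimplex n, X)) :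
    toConcrete x (.of σ) = (simplexInclusion σ ≫ x) ⟨1⟩ :=
  FreeAbelianGroup.lift_apply_of _ _

lemma toConcrete_bijective {n : ℕ} :
    Function.Bijective (toConcrete (X := X) (A := A) (n := n)) := by
  constructor
  · refine fun x y h ↦ singularChains_hom_ext fun σ ↦ hom_uliftInt_ext ?_
    rw [← toConcrete_of, ← toConcrete_of, h]
  · intro a
    let x : (singularChains.obj X).X n ⟶ A :=
      Sigma.desc fun s ↦ AddCommGrpCat.ofHom ((zmultiplesHom A
        (a (.of (X.toSSetObjEquiv (op (.mk n)) s)))).comp AddEquiv.ulift.toAddMonoidHom)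
    refine ⟨x, FreeAbelianGroup.lift_ext _ _ fun σ ↦ (toConcrete_of x σ).trans ?_⟩
    refine (ConcreteCategory.congr_hom (Sigma.ι_desc _ _) _).trans ?_
    exact one_smul ℤ _

lemma toConcrete_d {n : ℕ} (x : (singularChains.obj X).X n ⟶ A) (c : SingularChain (n + 1) X) :
    toConcrete ((singularChains.obj X).d (n + 1) n ≫ x) c =
      toConcrete x (SingularChain.boundary n c) := by
  have : toConcrete ((singularChains.obj X).d (n + 1) n ≫ x) =
      (toConcrete x).comp (SingularChain.boundary n) := by
    refine FreeAbelianGroup.lift_ext _ _ fun σ ↦ ?_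
    rw [toConcrete_of, ← Category.assoc, simplexInclusion_d, AddMonoidHom.comp_apply,
      SingularChain.boundary_of, Preadditive.sum_comp, map_sum]
    let e : (AddCommGrpCat.of (ULift.{u} ℤ) ⟶ A) →+ A :=
      AddMonoidHom.mk' (fun y ↦ y ⟨1⟩) fun _ _ ↦ rfl
    refine (map_sum e _ _).trans (Finset.sum_congr rfl fun i _ ↦ ?_)
    rw [Preadditive.zsmul_comp, map_zsmul, map_zsmul, toConcrete_of]
    rfl
  exact DFunLike.congr_fun this c

lemma toConcrete_map (f : X ⟶ Y) {n : ℕ} (x : (singularChains.obj Y).X n ⟶ A)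
    (c : SingularChain n X) : toConcrete ((singularChains.map f).f n ≫ x) c =
      toConcrete x (SingularChain.push n f.hom c) := by
  have : toConcrete ((singularChains.map f).f n ≫ x) =
      (toConcrete x).comp (SingularChain.push n f.hom) :=
    FreeAbelianGroup.lift_ext _ _ fun σ ↦ by
      rw [toConcrete_of, ← Category.assoc, simplexInclusion_map, AddMonoidHom.comp_apply,
        SingularChain.push_of, toConcrete_of]
  exact DFunLike.congr_fun this c

/-- The passage to homomorphisms on the free group is compatible with change of coefficients. -/
lemma toConcrete_comp (g : A ⟶ B) {n : ℕ} (x : (singularChains.obj X).X n ⟶ A)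
    (c : SingularChain n X) : toConcrete (x ≫ g) c = g (toConcrete x c) := by
  have : toConcrete (x ≫ g) = g.hom.comp (toConcrete x) :=
    FreeAbelianGroup.lift_ext _ _ fun σ ↦ by
      rw [toConcrete_of, AddMonoidHom.comp_apply, toConcrete_of]
      rfl
  exact DFunLike.congr_fun this c

end ConcreteCochains

/-! ### Cochains on `X` as sections -/

section GlobalCochains

variable {X Y : TopCat.{u}} {A B : AddCommGrpCat.{u}}

/-- The constant presheaf with value `ℤ`. -/
abbrev constInt (X : TopCat.{u}) : AbPresheaf X :=
  (Functor.const (Opens X)ᵒᵖ).obj (AddCommGrpCat.of (ULift.{u} ℤ))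

/-- The inclusion of an open subset of `X` in `X`. -/
def openVal (U : Opens X) : C(U, X) := ⟨Subtype.val, continuous_subtype_val⟩

/-- A cochain on `X` is a morphism from the constant presheaf `ℤ` to the presheaf of cochains. -/
def globalToHom {n : ℕ} (a : SingularChain n X →+ A) : constInt X ⟶ cochainPresheaf X A n :=
  homToCochain (N := constInt X) (fun U ↦ (precompHom A (SingularChain.push n (openVal U))).comp
    ((zmultiplesHom _ a).comp AddEquiv.ulift.toAddMonoidHom)) fun _ _ _ _ _ ↦ rfl

lemma evalCochain_globalToHom {n : ℕ} (a : SingularChain n X →+ A) (U : Opens X)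
    (m : ULift.{u} ℤ) (c : SingularChain n U) : evalCochain (globalToHom a) U m c =
      m.down • a (SingularChain.push n (openVal U) c) := rfl

/-- The canonical map from `X` to its largest open subset. -/
def toTop (X : TopCat.{u}) : C(X, (⊤ : Opens X)) := ⟨fun x ↦ ⟨x, trivial⟩, by fun_prop⟩

lemma globalToHom_bijective {n : ℕ} :
    Function.Bijective (globalToHom (X := X) (A := A) (n := n)) := by
  constructor
  · intro a b h
    refine FreeAbelianGroup.lift_ext _ _ fun σ ↦ ?_
    have := congr(evalCochain (N := constInt X) $h ⊤ (⟨1⟩ : ULift.{u} ℤ) (.of ((toTop X).comp σ)))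
    rw [evalCochain_globalToHom, evalCochain_globalToHom, one_smul, one_smul] at this
    exact this
  · intro z
    refine ⟨(evalCochain z ⊤ (⟨1⟩ : ULift.{u} ℤ)).comp (SingularChain.push n (toTop X)),
      cochainHom_ext fun U (m : ULift.{u} ℤ) σ ↦ ?_⟩
    rw [evalCochain_globalToHom]
    have hm : m = m.down • (⟨1⟩ : ULift.{u} ℤ) := ULift.ext _ _ (by simp)
    have h₁ := evalCochain_map z (le_top : U ≤ ⊤) (⟨1⟩ : ULift.{u} ℤ) (.of σ)
    have h₂ : evalCochain z U m (.of σ) =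
        m.down • evalCochain z U (⟨1⟩ : ULift.{u} ℤ) (.of σ) := by
      conv_lhs => rw [hm]
      exact DFunLike.congr_fun (map_zsmul (evalCochain z U) m.down (⟨1⟩ : ULift.{u} ℤ)) (.of σ)
    rw [h₂]
    exact congrArg (m.down • ·) h₁.symm

lemma globalToHom_add {n : ℕ} (a b : SingularChain n X →+ A) :
    globalToHom (a + b) = globalToHom a + globalToHom b :=
  cochainHom_ext fun _ (m : ULift.{u} ℤ) _ ↦ zsmul_add _ _ m.down

lemma globalToHom_comp_coboundary {n : ℕ} (a : SingularChain n X →+ A) :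
    globalToHom a ≫ coboundary X A n = globalToHom (a.comp (SingularChain.boundary n)) :=
  cochainHom_ext fun U (m : ULift.{u} ℤ) σ ↦ by
    rw [evalCochain_comp_coboundary, evalCochain_globalToHom, evalCochain_globalToHom,
      SingularChain.push_boundary]
    rfl

lemma globalToHom_comp_cochainCoeff (g : A ⟶ B) {n : ℕ} (a : SingularChain n X →+ A) :
    globalToHom a ≫ cochainCoeff X g n = globalToHom (g.hom.comp a) :=
  cochainHom_ext fun U (m : ULift.{u} ℤ) σ ↦ by
    rw [evalCochain_comp_cochainCoeff, evalCochain_globalToHom, evalCochain_globalToHom, map_zsmul]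
    rfl

/-- A cocycle on `X`, as a morphism from the constant presheaf `ℤ` to the presheaf of cocycles. -/
noncomputable def globalToCocycles {n : ℕ} (a : SingularChain n X →+ A)
    (ha : a.comp (SingularChain.boundary n) = 0) :
    constInt X ⟶ kernel ((cochainPresheafComplex X A).d n (n + 1)) :=
  kernel.lift _ (globalToHom a) (by
    rw [cochainPresheafComplex_d]
    refine (globalToHom_comp_coboundary a).trans ?_
    rw [ha]
    exact cochainHom_ext fun U (m : ULift.{u} ℤ) σ ↦ zsmul_zero m.down)

lemma globalToCocycles_ι {n : ℕ} (a : SingularChain n X →+ A)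
    (ha : a.comp (SingularChain.boundary n) = 0) :
    globalToCocycles a ha ≫ kernel.ι _ = globalToHom a := kernel.lift_ι _ _ _

end GlobalCochains

/-! ### The comparison isomorphism -/

section Comparison

variable {X : TopCat.{u}} (hX : SemiLocallyContractible X) {A : AddCommGrpCat.{u}}

/-- The isomorphism from the sheaf of locally constant cocycles to the constant sheaf. -/
noncomputable def cocyclesToConstSheaf (A : AddCommGrpCat.{u}) :
    (sheafification X).obj (kernel ((cochainPresheafComplex X A).d 0 1)) ⟶ (constSheaf X).obj A :=
  have := isIso_sheafification_map_constToCocycles hX A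
  (inv ((sheafification X).map (constToCocycles X A)) :
    _ ⟶ (sheafification X).obj ((Functor.const _).obj A))

instance : IsIso (cocyclesToConstSheaf hX A) := by
  have := isIso_sheafification_map_constToCocycles hX A
  exact inferInstanceAs (IsIso (inv ((sheafification X).map (constToCocycles X A))))

lemma map_constToCocycles_comp (A : AddCommGrpCat.{u}) :
    (sheafification X).map (constToCocycles X A) ≫ cocyclesToConstSheaf hX A = 𝟙 _ :=
  have := isIso_sheafification_map_constToCocycles hX A
  IsIso.hom_inv_id ((sheafification X).map (constToCocycles X A))

/-- The class in sheaf cohomology of a singular cocycle. -/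
noncomputable def cocycleClass {n : ℕ} (a : SingularChain n X →+ A)
    (ha : a.comp (SingularChain.boundary n) = 0) : constSheafCohomology X A n :=
  cocycleToExt (isLocallyExact_cochainPresheafComplex hX A) (cocyclesToConstSheaf hX A) n
    (constInt X) (globalToCocycles a ha)

lemma cocycleClass_add {n : ℕ} (a b : SingularChain n X →+ A)
    (ha : a.comp (SingularChain.boundary n) = 0) (hb : b.comp (SingularChain.boundary n) = 0)
    (hab) :
    cocycleClass hX (a + b) hab = cocycleClass hX a ha + cocycleClass hX b hb := by
  have : globalToCocycles (a + b) hab = globalToCocycles a ha + globalToCocycles b hb := by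
    rw [← cancel_mono (kernel.ι _), Preadditive.add_comp]
    exact (globalToCocycles_ι _ hab).trans ((globalToHom_add a b).trans
      congr($(globalToCocycles_ι a ha) + $(globalToCocycles_ι b hb)).symm)
  rw [cocycleClass, this]
  exact cocycleToExt_add _ _ _ _ _

lemma cocycleClass_comp_boundary {n : ℕ} (a : SingularChain n X →+ A) (ha) :
    cocycleClass hX (a.comp (SingularChain.boundary n)) ha = 0 := by
  have : globalToCocycles (a.comp (SingularChain.boundary n)) ha =
      globalToHom a ≫ toCocycles (cochainPresheafComplex X A) n := by
    rw [← cancel_mono (kernel.ι _), globalToCocycles_ι, Category.assoc, toCocycles_ι,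
      cochainPresheafComplex_d]
    exact (globalToHom_comp_coboundary a).symm
  rw [cocycleClass, this]
  exact cocycleToExt_toCocycles _ _ _ _

/-- The dimension shifting argument applies to the presheaves of cochains, by means of an embedding
of the group `A` in an injective group. -/
lemma surjectiveInDegree_and_injectiveInDegree_cochains (A : AddCommGrpCat.{u}) (n : ℕ) :
    SurjectiveInDegree (isLocallyExact_cochainPresheafComplex hX A) (cocyclesToConstSheaf hX A)
        (cochainComplexCoeff X (cokernel.π (Injective.ι A))) n ∧
      InjectiveInDegree (isLocallyExact_cochainPresheafComplex hX A) (cocyclesToConstSheaf hX A)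
        (cochainComplexCoeff X (cokernel.π (Injective.ι A))) n :=
  surjectiveInDegree_and_injectiveInDegree (sheafificationAdjunction _ _)
    (cochainResolution (X := X) (Injective.ι A)) (exists_epi_isGood _) n

/-- Every class in the cohomology of the constant sheaf is the class of a singular cocycle. -/
lemma cocycleClass_surjective {n : ℕ} (e : constSheafCohomology X A n) :
    ∃ (a : SingularChain n X →+ A) (ha : _), cocycleClass hX a ha = e := by
  obtain ⟨z, rfl⟩ := (surjectiveInDegree_and_injectiveInDegree_cochains hX A n).1 _
    (isGood_const _) e
  obtain ⟨a, ha⟩ := globalToHom_bijective.2 (z ≫ kernel.ι _)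
  have hz : (z ≫ kernel.ι _) ≫ coboundary X A n = 0 := by
    rw [← cochainPresheafComplex_d, Category.assoc, kernel.condition, comp_zero]
  have h₀ : a.comp (SingularChain.boundary n) = 0 := by
    apply globalToHom_bijective.1
    rw [← globalToHom_comp_coboundary]
    refine (congrArg (· ≫ _) ha).trans (hz.trans ?_)
    exact cochainHom_ext fun U (m : ULift.{u} ℤ) σ ↦ (zsmul_zero m.down).symm
  refine ⟨a, h₀, ?_⟩
  have : globalToCocycles a h₀ = z := by
    rw [← cancel_mono (kernel.ι _), globalToCocycles_ι]
    exact ha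
  rw [cocycleClass, this]

/-- Only coboundaries have trivial class in the cohomology of the constant sheaf. -/
lemma cocycleClass_eq_zero {n : ℕ} {a : SingularChain n X →+ A}
    {ha : a.comp (SingularChain.boundary n) = 0} (h : cocycleClass hX a ha = 0) :
    a = 0 ∨ ∃ m, ∃ hm : n = m + 1, ∃ b : SingularChain m X →+ A,
      ∀ c : SingularChain (m + 1) X, b (SingularChain.boundary m c) = a (hm ▸ c) := by
  obtain h | ⟨m, rfl, t, ht⟩ := (surjectiveInDegree_and_injectiveInDegree_cochains hX A n).2 _
    (isGood_const _) _ h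
  · left
    apply globalToHom_bijective.1
    refine (globalToCocycles_ι a ha).symm.trans ((congrArg (· ≫ _) h).trans zero_comp |>.trans ?_)
    exact cochainHom_ext fun U (m : ULift.{u} ℤ) σ ↦ (zsmul_zero m.down).symm
  · refine Or.inr ⟨m, rfl, ?_⟩
    obtain ⟨b, rfl⟩ := globalToHom_bijective.2 t
    refine ⟨b, fun c ↦ ?_⟩
    rw [globalToCocycles_ι, cochainPresheafComplex_d] at ht
    exact DFunLike.congr_fun
      (globalToHom_bijective.1 ((globalToHom_comp_coboundary b).symm.trans ht)) c

/-- The cochain underlying a cocycle of the complex `C^•(X; A)`. -/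
noncomputable def cyclesVal {n : ℕ} (c : (singularCochains X A).cycles n) :
    SingularChain n X →+ A :=
  toConcrete ((singularCochains X A).iCycles n c)

lemma cyclesVal_add {n : ℕ} (c c' : (singularCochains X A).cycles n) :
    cyclesVal (c + c') = cyclesVal c + cyclesVal c' :=
  (congrArg toConcrete (map_add ((singularCochains X A).iCycles n).hom c c')).trans
    (map_add toConcrete _ _)

lemma cyclesVal_comp_boundary {n : ℕ} (c : (singularCochains X A).cycles n) :
    (cyclesVal c).comp (SingularChain.boundary n) = 0 := by
  refine AddMonoidHom.ext fun x ↦ (toConcrete_d _ x).symm.trans ?_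
  have : (singularChains.obj X).d (n + 1) n ≫ (singularCochains X A).iCycles n c = 0 :=
    ConcreteCategory.congr_hom ((singularCochains X A).iCycles_d n (n + 1)) c
  rw [this, map_zero]

/-- The map from singular cocycles to sheaf cohomology. -/
noncomputable def cyclesToSheafCohomology (A : AddCommGrpCat.{u}) (n : ℕ) :
    (singularCochains X A).cycles n ⟶ constSheafCohomology X A n :=
  AddCommGrpCat.ofHom <| AddMonoidHom.mk'
    (fun c ↦ cocycleClass hX (cyclesVal c) (cyclesVal_comp_boundary c)) fun c c' ↦ by
      refine Eq.trans ?_ (cocycleClass_add hX _ _ _ _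
        (cyclesVal_add c c' ▸ cyclesVal_comp_boundary _))
      congr 1
      exact cyclesVal_add c c'

lemma cyclesToSheafCohomology_apply {n : ℕ} (c : (singularCochains X A).cycles n) :
    cyclesToSheafCohomology hX A n c = cocycleClass hX (cyclesVal c) (cyclesVal_comp_boundary c) :=
  rfl

lemma toCycles_cyclesToSheafCohomology (A : AddCommGrpCat.{u}) (m n : ℕ) :
    (singularCochains X A).toCycles m n ≫ cyclesToSheafCohomology hX A n = 0 := by
  by_cases hmn : m + 1 = n
  · subst hmn
    refine AddCommGrpCat.hom_ext <| AddMonoidHom.ext fun x ↦ ?_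
    have h : cyclesVal ((singularCochains X A).toCycles m (m + 1) x) =
        (toConcrete x).comp (SingularChain.boundary m) := by
      refine AddMonoidHom.ext fun c ↦ .trans ?_ (toConcrete_d x c)
      refine congrArg (fun y ↦ toConcrete y c) ?_
      exact ConcreteCategory.congr_hom ((singularCochains X A).toCycles_i m (m + 1)) x
    refine Eq.trans ?_ (cocycleClass_comp_boundary hX (toConcrete x)
      (h ▸ cyclesVal_comp_boundary _))
    refine (cyclesToSheafCohomology_apply hX _).trans ?_
    congr 1
  · rw [(singularCochains X A).toCycles_eq_zero, zero_comp]
    exact hmn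

/-- The comparison homomorphism from singular cohomology to the cohomology of the constant sheaf. -/
noncomputable def comparison (A : AddCommGrpCat.{u}) (n : ℕ) :
    singularCohomology X A n ⟶ constSheafCohomology X A n :=
  ((singularCochains X A).homologyIsCokernel _ n rfl).desc
    (CokernelCofork.ofπ _ (toCycles_cyclesToSheafCohomology hX A _ n))

lemma homologyπ_comparison (A : AddCommGrpCat.{u}) (n : ℕ) :
    (singularCochains X A).homologyπ n ≫ comparison hX A n = cyclesToSheafCohomology hX A n :=
  ((singularCochains X A).homologyIsCokernel _ n rfl).fac _ WalkingParallelPair.one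

lemma homologyπ_surjective (A : AddCommGrpCat.{u}) (n : ℕ) :
    Function.Surjective ((singularCochains X A).homologyπ n) :=
  (AddCommGrpCat.epi_iff_surjective _).1 inferInstance

/-- The comparison homomorphism is an isomorphism, because the class of a cocycle in sheaf
cohomology determines it up to coboundaries and every class arises in this way. -/
instance isIso_comparison (A : AddCommGrpCat.{u}) (n : ℕ) : IsIso (comparison hX A n) := by
  have hπ := fun c ↦ ConcreteCategory.congr_hom (homologyπ_comparison hX A n) c
  rw [ConcreteCategory.isIso_iff_bijective]
  constructor
  · refine (injective_iff_map_eq_zero (comparison hX A n).hom).2 fun x hx ↦ ?_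
    obtain ⟨c, rfl⟩ := homologyπ_surjective A n x
    have hi : Function.Injective ((singularCochains X A).iCycles n) :=
      (AddCommGrpCat.mono_iff_injective _).1 inferInstance
    obtain h | ⟨m, rfl, b, hb⟩ := cocycleClass_eq_zero hX ((hπ c).symm.trans hx)
    · have : c = 0 := hi (toConcrete_bijective.1 (h.trans ((congrArg toConcrete
          (map_zero ((singularCochains X A).iCycles n).hom)).trans (map_zero toConcrete)).symm))
      rw [this, map_zero]
    · obtain ⟨y, rfl⟩ := toConcrete_bijective.2 b
      have : (singularCochains X A).toCycles m (m + 1) y = c := by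
        refine hi (toConcrete_bijective.1 (AddMonoidHom.ext fun s ↦ ?_))
        refine Eq.trans ?_ (hb s)
        refine Eq.trans ?_ (toConcrete_d y s)
        refine congrArg (fun y ↦ toConcrete y s) ?_
        exact ConcreteCategory.congr_hom ((singularCochains X A).toCycles_i m (m + 1)) y
      rw [← this]
      exact ConcreteCategory.congr_hom ((singularCochains X A).toCycles_comp_homologyπ m (m + 1)) y
  · intro e
    obtain ⟨a, ha, rfl⟩ := cocycleClass_surjective hX e
    obtain ⟨x, rfl⟩ := toConcrete_bijective.2 a
    have hx : (singularCochains X A).d n (n + 1) x = 0 := by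
      refine toConcrete_bijective.1 (AddMonoidHom.ext fun s ↦ ?_)
      exact (toConcrete_d x s).trans ((DFunLike.congr_fun ha s).trans
        (DFunLike.congr_fun (map_zero toConcrete).symm s))
    let x' : AddCommGrpCat.of (ULift.{u} ℤ) ⟶ (singularCochains X A).X n :=
      AddCommGrpCat.ofHom ((zmultiplesHom _ x).comp AddEquiv.ulift.toAddMonoidHom)
    let c : (singularCochains X A).cycles n :=
      (singularCochains X A).liftCycles x' (n + 1) (ComplexShape.next_eq' _ rfl)
        (hom_uliftInt_ext ((congrArg _ (one_zsmul x)).trans hx)) (⟨1⟩ : ULift.{u} ℤ)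
    have hc : (singularCochains X A).iCycles n c = x :=
      (ConcreteCategory.congr_hom ((singularCochains X A).liftCycles_i _ _ _ _) _).trans
        (one_zsmul x)
    refine ⟨(singularCochains X A).homologyπ n c, (hπ c).trans ?_⟩
    refine (cyclesToSheafCohomology_apply hX _).trans ?_
    congr 1
    exact congrArg toConcrete hc

end Comparison

/-! ### Naturality in the coefficients -/

section CoefficientNaturality

universe v₁ v₂ u₁ u₂ w

section

variable {P : Type u₁} [Category.{v₁} P] [Abelian P] {S : Type u₂} [Category.{v₂} S] [Abelian S]
  {L : P ⥤ S} [L.PreservesZeroMorphisms] [PreservesFiniteLimits L]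
  [PreservesFiniteColimits L] {A A' : CochainComplex P ℕ}

/-- The map on cocycles induced by a map of complexes. -/
noncomputable def kernelMap (g : A ⟶ A') (n : ℕ) :
    kernel (A.d n (n + 1)) ⟶ kernel (A'.d n (n + 1)) :=
  kernel.map _ _ (g.f n) (g.f (n + 1)) (g.comm _ _).symm

@[simp]
lemma kernelMap_ι (g : A ⟶ A') (n : ℕ) :
    kernelMap g n ≫ kernel.ι _ = kernel.ι _ ≫ g.f n := kernel.lift_ι _ _ _

lemma toCocycles_kernelMap (g : A ⟶ A') (n : ℕ) :
    toCocycles A n ≫ kernelMap g (n + 1) = g.f n ≫ toCocycles A' n := by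
  rw [← cancel_mono (kernel.ι _), Category.assoc, Category.assoc, toCocycles_ι]
  refine (congrArg (_ ≫ ·) (kernelMap_ι g (n + 1))).trans ?_
  rw [← Category.assoc]
  exact (congrArg (· ≫ _) (toCocycles_ι A n)).trans (g.comm _ _).symm

lemma map_kernelMap_comp_iteratedExtClass [HasExt.{w} S] (hA : IsLocallyExact L A)
    (hA' : IsLocallyExact L A') {B B' : S} {b : L.obj (kernel (A.d 0 1)) ⟶ B}
    {b' : L.obj (kernel (A'.d 0 1)) ⟶ B'} (g : A ⟶ A') (γ : B ⟶ B')
    (h : L.map (kernelMap g 0) ≫ b' = b ≫ γ) (n : ℕ) :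
    (Ext.mk₀ (L.map (kernelMap g n))).comp (iteratedExtClass hA' b' n) (zero_add n) =
      (iteratedExtClass hA b n).comp (Ext.mk₀ γ) (add_zero n) := by
  induction n with
  | zero =>
    simp only [iteratedExtClass_zero, Ext.mk₀_comp_mk₀, h]
  | succ n ih =>
    let φ : cocycleSequence L A n ⟶ cocycleSequence L A' n :=
      ShortComplex.homMk (L.map (kernelMap g n)) (L.map (g.f n)) (L.map (kernelMap g (n + 1)))
        (by rw [← L.map_comp, ← L.map_comp, kernelMap_ι])
        (by rw [← L.map_comp, ← L.map_comp, toCocycles_kernelMap])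
    have hφ := ShortComplex.ShortExact.extClass_naturality (hA.shortExact n) (hA'.shortExact n) φ
    have hφ' := congrArg (fun e ↦ Ext.comp e (iteratedExtClass hA' b' n) (add_comm 1 n)) hφ
    rw [iteratedExtClass_succ, iteratedExtClass_succ]
    rw [Ext.comp_assoc (a₂₃ := n) _ _ _ (by lia) (by lia) (by lia), ← ih,
      ← Ext.comp_assoc (a₁₂ := 1) _ _ _ (by lia) (by lia) (by lia),
      ← Ext.comp_assoc (a₁₂ := 1) _ _ _ (by lia) (by lia) (by lia)]
    exact hφ'.symm

/-- The class of a cocycle is natural in the complex. -/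
lemma cocycleToExt_comp_kernelMap [HasExt.{w} S] (hA : IsLocallyExact L A)
    (hA' : IsLocallyExact L A') {B B' : S} {b : L.obj (kernel (A.d 0 1)) ⟶ B}
    {b' : L.obj (kernel (A'.d 0 1)) ⟶ B'} (g : A ⟶ A') (γ : B ⟶ B')
    (h : L.map (kernelMap g 0) ≫ b' = b ≫ γ) (n : ℕ) {G : P} (z : G ⟶ kernel (A.d n (n + 1))) :
    cocycleToExt hA' b' n G (z ≫ kernelMap g n) =
      (cocycleToExt hA b n G z).comp (Ext.mk₀ γ) (add_zero n) := by
  rw [cocycleToExt_comp, cocycleToExt, map_kernelMap_comp_iteratedExtClass hA hA' g γ h,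
    cocycleToExt, Ext.comp_assoc (a₂₃ := n) _ _ _ (by lia) (by lia) (by lia)]

end

variable {X : TopCat.{u}} (hX : SemiLocallyContractible X) {A B : AddCommGrpCat.{u}}

lemma constToCocycles_kernelMap (g : A ⟶ B) :
    constToCocycles X A ≫ kernelMap (cochainComplexCoeff X g) 0 =
      (Functor.const _).map g ≫ constToCocycles X B := by
  rw [← cancel_mono (kernel.ι _), Category.assoc, Category.assoc, kernelMap_ι,
    constToCocycles_ι, ← Category.assoc]
  refine (congrArg (· ≫ _) constToCocycles_ι).trans ?_
  exact cochainHom_ext (A := B) (n := 0) fun U (a : A) σ ↦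
    map_zsmul g.hom (SingularChain.augmentation 0 (.of σ)) a

lemma cocyclesToConstSheaf_naturality (g : A ⟶ B) :
    (sheafification X).map (kernelMap (cochainComplexCoeff X g) 0) ≫ cocyclesToConstSheaf hX B =
      cocyclesToConstSheaf hX A ≫ (constSheaf X).map g := by
  have := isIso_sheafification_map_constToCocycles hX A
  rw [← cancel_epi ((sheafification X).map (constToCocycles X A)), ← Functor.map_comp_assoc,
    constToCocycles_kernelMap, Functor.map_comp, Category.assoc]
  refine (congrArg (_ ≫ ·) (map_constToCocycles_comp hX B)).trans ?_
  refine (Category.comp_id _).trans ?_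
  rw [← Category.assoc]
  exact ((congrArg (· ≫ _) (map_constToCocycles_comp hX A)).trans (Category.id_comp _)).symm

lemma globalToCocycles_kernelMap (g : A ⟶ B) {n : ℕ} (a : SingularChain n X →+ A)
    (ha : a.comp (SingularChain.boundary n) = 0)
    (hb : (g.hom.comp a).comp (SingularChain.boundary n) = 0) :
    globalToCocycles a ha ≫ kernelMap (cochainComplexCoeff X g) n =
      globalToCocycles (g.hom.comp a) hb := by
  rw [← cancel_mono (kernel.ι _), Category.assoc, kernelMap_ι, globalToCocycles_ι, ← Category.assoc]
  exact (congrArg (· ≫ _) (globalToCocycles_ι a ha)).trans (globalToHom_comp_cochainCoeff g a)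

lemma cocycleClass_coeff (g : A ⟶ B) {n : ℕ} (a : SingularChain n X →+ A)
    (ha : a.comp (SingularChain.boundary n) = 0)
    (hb : (g.hom.comp a).comp (SingularChain.boundary n) = 0) :
    cocycleClass hX (g.hom.comp a) hb = constSheafCohomologyCoeff X g n (cocycleClass hX a ha) := by
  rw [cocycleClass, ← globalToCocycles_kernelMap g a ha]
  exact cocycleToExt_comp_kernelMap (isLocallyExact_cochainPresheafComplex hX A)
    (isLocallyExact_cochainPresheafComplex hX B) (cochainComplexCoeff X g) ((constSheaf X).map g)
    (cocyclesToConstSheaf_naturality hX g) n _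

/-- The comparison isomorphism is natural in the coefficient group. -/
theorem singularCohomologyCoeff_comp_comparison (g : A ⟶ B) (n : ℕ) :
    singularCohomologyCoeff X g n ≫ comparison hX B n =
      comparison hX A n ≫ constSheafCohomologyCoeff X g n := by
  rw [← cancel_epi ((singularCochains X A).homologyπ n), singularCohomologyCoeff,
    HomologicalComplex.homologyπ_naturality_assoc]
  refine (congrArg (_ ≫ ·) (homologyπ_comparison hX B n)).trans ?_
  rw [← Category.assoc, homologyπ_comparison]
  refine AddCommGrpCat.hom_ext <| AddMonoidHom.ext fun c ↦ ?_
  have hc : cyclesVal (HomologicalComplex.cyclesMap ((NatTrans.mapHomologicalComplex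
      (preadditiveYoneda.map g) (ComplexShape.down ℕ).symm).app
      ((HomologicalComplex.opFunctor _ _).obj (op (singularChains.obj X)))) n c) =
      g.hom.comp (cyclesVal c) := by
    refine AddMonoidHom.ext fun s ↦ .trans ?_ (toConcrete_comp g _ s)
    refine congrArg (fun y ↦ toConcrete y s) ?_
    exact ConcreteCategory.congr_hom (HomologicalComplex.cyclesMap_i _ n) c
  refine Eq.trans ?_ (cocycleClass_coeff hX g (cyclesVal c) (cyclesVal_comp_boundary c)
    (hc ▸ cyclesVal_comp_boundary _))
  refine (cyclesToSheafCohomology_apply hX _).trans ?_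
  congr 1

end CoefficientNaturality

/-! ### Naturality in the space -/

section SpaceNaturality

section

universe v₁ v₂ v₃ v₄ u₁ u₂ u₃ u₄ w w'

variable {P : Type u₁} [Category.{v₁} P] [Abelian P] {S : Type u₂} [Category.{v₂} S] [Abelian S]
  {P' : Type u₃} [Category.{v₃} P'] [Abelian P'] {S' : Type u₄} [Category.{v₄} S'] [Abelian S']
  {L : P ⥤ S} [L.PreservesZeroMorphisms] [PreservesFiniteLimits L] [PreservesFiniteColimits L]
  {L' : P' ⥤ S'} [L'.PreservesZeroMorphisms] [PreservesFiniteLimits L']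
  [PreservesFiniteColimits L'] {A : CochainComplex P ℕ} {A' : CochainComplex P' ℕ}
  [HasExt.{w} S] [HasExt.{w'} S'] (hA : IsLocallyExact L A) (hA' : IsLocallyExact L' A')
  {B : S} {B' : S'} {b : L.obj (kernel (A.d 0 1)) ⟶ B} {b' : L'.obj (kernel (A'.d 0 1)) ⟶ B'}
  (F : S ⥤ S') [F.Additive] [PreservesFiniteLimits F] [PreservesFiniteColimits F]
  (α : ∀ n, F.obj (L.obj (kernel (A.d n (n + 1)))) ⟶ L'.obj (kernel (A'.d n (n + 1))))
  (β : ∀ n, F.obj (L.obj (A.X n)) ⟶ L'.obj (A'.X n))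
  (hι : ∀ n, F.map (L.map (kernel.ι (A.d n (n + 1)))) ≫ β n =
    α n ≫ L'.map (kernel.ι (A'.d n (n + 1))))
  (hτ : ∀ n, F.map (L.map (toCocycles A n)) ≫ α (n + 1) = β n ≫ L'.map (toCocycles A' n))
  (γ : F.obj B ⟶ B') (hb : α 0 ≫ b' = F.map b ≫ γ)

include hι hτ hb

/-- Compatibility of the iterated extension classes with an exact functor `F`. -/
lemma comp_iteratedExtClass_eq_mapExactFunctor (n : ℕ) :
    (Ext.mk₀ (α n)).comp (iteratedExtClass hA' b' n) (zero_add n) =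
      ((iteratedExtClass hA b n).mapExactFunctor F).comp (Ext.mk₀ γ) (add_zero n) := by
  induction n with
  | zero =>
    simp only [iteratedExtClass_zero, Ext.mk₀_comp_mk₀, hb, Ext.mapExactFunctor_mk₀]
  | succ n ih =>
    let T : ShortComplex S' := ShortComplex.mk (F.map (L.map (kernel.ι (A.d n (n + 1)))))
      (F.map (L.map (toCocycles A n)))
      (by rw [← F.map_comp, ← L.map_comp, ι_toCocycles, L.map_zero, F.map_zero])
    have hT : T.ShortExact := (hA.shortExact n).map_of_exact F
    have hT' : (hA.shortExact n).extClass.mapExactFunctor F = hT.extClass :=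
      Ext.mapExactFunctor_extClass F _
    let φ : T ⟶ cocycleSequence L' A' n :=
      ShortComplex.homMk (α n) (β n) (α (n + 1)) (hι n).symm (hτ n).symm
    have hφ := ShortComplex.ShortExact.extClass_naturality hT (hA'.shortExact n) φ
    have hφ' := congrArg (fun e ↦ Ext.comp e (iteratedExtClass hA' b' n) (add_comm 1 n)) hφ
    have h₁ : ((iteratedExtClass hA b (n + 1)).mapExactFunctor F).comp (Ext.mk₀ γ) (add_zero _) =
        hT.extClass.comp ((Ext.mk₀ (α n)).comp (iteratedExtClass hA' b' n) (zero_add n))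
          (add_comm 1 n) := by
      rw [iteratedExtClass_succ, Ext.mapExactFunctor_comp, hT', ih]
      exact Ext.comp_assoc (a₂₃ := n) _ _ _ (by lia) (by lia) (by lia)
    have h₂ : (hT.extClass.comp (Ext.mk₀ (α n)) (add_zero 1)).comp (iteratedExtClass hA' b' n)
        (add_comm 1 n) = hT.extClass.comp ((Ext.mk₀ (α n)).comp (iteratedExtClass hA' b' n)
          (zero_add n)) (add_comm 1 n) :=
      Ext.comp_assoc (a₁₂ := 1) (a₂₃ := n) _ _ _ (by lia) (by lia) (by lia)
    rw [h₁, ← h₂, iteratedExtClass_succ]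
    refine Eq.trans ?_ hφ'.symm
    exact (Ext.comp_assoc (a₁₂ := 1) _ _ _ (by lia) (by lia) (by lia)).symm

/-- Compatibility of the class of a cocycle with an exact functor `F`. -/
lemma comp_cocycleToExt_eq_mapExactFunctor (n : ℕ) {G : P} {G' : P'}
    (ζ : F.obj (L.obj G) ⟶ L'.obj G') (z : G ⟶ kernel (A.d n (n + 1)))
    (z' : G' ⟶ kernel (A'.d n (n + 1))) (hz : F.map (L.map z) ≫ α n = ζ ≫ L'.map z') :
    (Ext.mk₀ ζ).comp (cocycleToExt hA' b' n G' z') (zero_add n) =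
      ((cocycleToExt hA b n G z).mapExactFunctor F).comp (Ext.mk₀ γ) (add_zero n) := by
  rw [cocycleToExt, cocycleToExt, Ext.mk₀_comp_mk₀_assoc, ← hz, ← Ext.mk₀_comp_mk₀_assoc,
    comp_iteratedExtClass_eq_mapExactFunctor hA hA' F α β hι hτ γ hb n,
    Ext.mapExactFunctor_comp, Ext.mapExactFunctor_mk₀,
    Ext.comp_assoc (a₂₃ := n) _ _ _ (by lia) (by lia) (by lia)]

end

/-- Solving a compatibility of extension classes for one of them. -/
lemma ext_eq_of_mk₀_hom_comp {S : Type*} [Category* S] [Abelian S] [HasExt S] {B C M N : S}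
    (i : B ≅ C) {n : ℕ} (e : Ext C N n) (e' : Ext B M n) (g : M ⟶ N)
    (h : (Ext.mk₀ i.hom).comp e (zero_add n) = e'.comp (Ext.mk₀ g) (add_zero n)) :
    e = ((Ext.mk₀ i.inv).comp e' (zero_add n)).comp (Ext.mk₀ g) (add_zero n) := by
  rw [Ext.comp_assoc (a₂₃ := n) _ _ _ (by lia) (by lia) (by lia), ← h, Ext.mk₀_comp_mk₀_assoc,
    Iso.inv_hom_id, Ext.mk₀_id_comp]

variable {X Y : TopCat.{u}} (f : X ⟶ Y)

/-- The direct image functor on presheaves. -/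
abbrev presheafPushforward : AbPresheaf X ⥤ AbPresheaf Y :=
  (Functor.whiskeringLeft _ _ _).obj (Opens.map f).op

/-- The adjunction between sheafification followed by inverse image, and direct image. -/
noncomputable abbrev inverseImageSheafificationAdj :
    sheafification Y ⋙ inverseImage f ⊣
      TopCat.Sheaf.pushforward AddCommGrpCat.{u} f ⋙ sheafToPresheaf _ _ :=
  (sheafificationAdjunction _ _).comp
    (TopCat.Sheaf.pullbackPushforwardAdjunction AddCommGrpCat.{u} f)

/-- The morphism `f⁻¹ G^♯ ⟶ H^♯` of sheaves on `X` induced by a morphism `G ⟶ f_* H` of presheaves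
on `Y`. -/
noncomputable def sheafTranspose {G : AbPresheaf Y} {H : AbPresheaf X}
    (θ : G ⟶ (presheafPushforward f).obj H) :
    (inverseImage f).obj ((sheafification Y).obj G) ⟶ (sheafification X).obj H :=
  ((inverseImageSheafificationAdj f).homEquiv G ((sheafification X).obj H)).symm
    (θ ≫ (presheafPushforward f).map (toSheafify _ H))

lemma sheafTranspose_naturality {G G' : AbPresheaf Y} {H H' : AbPresheaf X}
    (θ : G ⟶ (presheafPushforward f).obj H) (θ' : G' ⟶ (presheafPushforward f).obj H')
    (g : G ⟶ G') (h : H ⟶ H') (w : g ≫ θ' = θ ≫ (presheafPushforward f).map h) :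
    (inverseImage f).map ((sheafification Y).map g) ≫ sheafTranspose f θ' =
      sheafTranspose f θ ≫ (sheafification X).map h := by
  have h₁ : g ≫ θ' ≫ (presheafPushforward f).map (toSheafify (Opens.grothendieckTopology X) H') =
      (θ ≫ (presheafPushforward f).map (toSheafify (Opens.grothendieckTopology X) H)) ≫
        (presheafPushforward f).map (sheafifyMap (Opens.grothendieckTopology X) h) := by
    rw [reassoc_of% w, ← Functor.map_comp, toSheafify_naturality, Functor.map_comp, Category.assoc]
  exact ((inverseImageSheafificationAdj f).homEquiv_naturality_left_symm g _).symm.trans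
    ((congrArg _ h₁).trans ((inverseImageSheafificationAdj f).homEquiv_naturality_right_symm
      _ ((sheafification X).map h)))

/-- The canonical morphism from a constant presheaf to the direct image of the constant presheaf
with the same value. -/
def constPushforward (A : AddCommGrpCat.{u}) :
    (Functor.const (Opens Y)ᵒᵖ).obj A ⟶
      (presheafPushforward f).obj ((Functor.const (Opens X)ᵒᵖ).obj A) where
  app _ := 𝟙 A

/-- For constant presheaves, `sheafTranspose` recovers the canonical identification of the inverse
image of a constant sheaf with a constant sheaf. -/
lemma sheafTranspose_constPushforward (A : AddCommGrpCat.{u}) :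
    sheafTranspose f (constPushforward f A) = (inverseImageConstIso f).hom.app A := by
  refine ((Equiv.eq_symm_apply _).2 ?_).symm
  apply ((constantPresheafAdj AddCommGrpCat.{u}
    (isTerminalTop : IsTerminal (⊤ : Opens Y))).homEquiv _ _).injective
  have h := Adjunction.homEquiv_leftAdjointUniq_hom_app
    (((constantSheafAdj (Opens.grothendieckTopology Y) AddCommGrpCat.{u}
      (isTerminalTop : IsTerminal (⊤ : Opens Y))).comp
    (TopCat.Sheaf.pullbackPushforwardAdjunction AddCommGrpCat.{u} f)).ofNatIsoRight
      (Iso.refl _))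
    (constantSheafAdj (Opens.grothendieckTopology X) AddCommGrpCat.{u}
      (isTerminalTop : IsTerminal (⊤ : Opens X))) A
  refine Eq.trans ?_ (h.trans ?_)
  · rw [Adjunction.homEquiv_ofNatIsoRight_apply]
    exact Eq.trans rfl (Category.comp_id _).symm
  · refine (Adjunction.comp_unit_app _ (sheafificationAdjunction (Opens.grothendieckTopology X)
      AddCommGrpCat.{u}) A).trans ?_
    refine Eq.trans ?_ (Adjunction.homEquiv_unit (constantPresheafAdj AddCommGrpCat.{u}
      (isTerminalTop : IsTerminal (⊤ : Opens Y))) A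
      ((presheafPushforward f).obj (sheafify _ ((Functor.const (Opens X)ᵒᵖ).obj A)))
      (constPushforward f A ≫ (presheafPushforward f).map (toSheafify _ _))).symm
    rfl

/-- The restriction of a continuous map `f : X → Y` to the preimage of an open subset. -/
def restrictPreimage (U : Opens Y) : C((Opens.map f).obj U, U) :=
  ⟨fun x ↦ ⟨f x, x.2⟩, by fun_prop⟩

/-- The pullback of cochains, as a morphism of presheaves on `Y`. -/
def cochainPullback (A : AddCommGrpCat.{u}) (n : ℕ) :
    cochainPresheaf Y A n ⟶ (presheafPushforward f).obj (cochainPresheaf X A n) where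
  app U := AddCommGrpCat.ofHom (precompHom A (SingularChain.push n (restrictPreimage f U.unop)))
  naturality U _ i := AddCommGrpCat.hom_ext <| AddMonoidHom.ext fun a ↦ AddMonoidHom.ext fun c ↦
    congrArg (a : SingularChain n U.unop →+ A)
      ((SingularChain.push_push (openInclusion i.unop.le) (restrictPreimage f _) c).trans
        (SingularChain.push_push (restrictPreimage f U.unop) (openInclusion _) c).symm)

lemma cochainPullback_coboundary (A : AddCommGrpCat.{u}) (n : ℕ) :
    coboundary Y A n ≫ cochainPullback f A (n + 1) =
      cochainPullback f A n ≫ (presheafPushforward f).map (coboundary X A n) :=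
  NatTrans.ext <| funext fun U ↦ AddCommGrpCat.hom_ext <| AddMonoidHom.ext fun a ↦
    AddMonoidHom.ext fun c ↦ congrArg (a : SingularChain n U.unop →+ A)
      (SingularChain.push_boundary (restrictPreimage f U.unop) c).symm

/-- The pullback of cocycles, as a morphism of presheaves on `Y`. -/
noncomputable def cocyclePullback (A : AddCommGrpCat.{u}) (n : ℕ) :
    kernel ((cochainPresheafComplex Y A).d n (n + 1)) ⟶
      (presheafPushforward f).obj (kernel ((cochainPresheafComplex X A).d n (n + 1))) :=
  kernel.lift ((presheafPushforward f).map ((cochainPresheafComplex X A).d n (n + 1)))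
    (kernel.ι ((cochainPresheafComplex Y A).d n (n + 1)) ≫ cochainPullback f A n) (by
      have h := cochainPullback_coboundary f A n
      rw [← cochainPresheafComplex_d, ← cochainPresheafComplex_d] at h
      rw [Category.assoc]
      refine (congrArg (_ ≫ ·) h.symm).trans ?_
      rw [← Category.assoc, kernel.condition, zero_comp]) ≫
    inv (kernelComparison ((cochainPresheafComplex X A).d n (n + 1)) (presheafPushforward f))

lemma cocyclePullback_ι (A : AddCommGrpCat.{u}) (n : ℕ) :
    cocyclePullback f A n ≫ (presheafPushforward f).map (kernel.ι _) =
      kernel.ι _ ≫ cochainPullback f A n := by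
  rw [cocyclePullback, Category.assoc, ← kernelComparison_comp_ι, IsIso.inv_hom_id_assoc,
    kernel.lift_ι]

lemma toCocycles_cocyclePullback (A : AddCommGrpCat.{u}) (n : ℕ) :
    toCocycles (cochainPresheafComplex Y A) n ≫ cocyclePullback f A (n + 1) =
      cochainPullback f A n ≫ (presheafPushforward f).map
        (toCocycles (cochainPresheafComplex X A) n) := by
  rw [← cancel_mono ((presheafPushforward f).map (kernel.ι _)), Category.assoc, Category.assoc,
    ← Functor.map_comp]
  refine (congrArg (_ ≫ ·) (cocyclePullback_ι f A (n + 1))).trans ?_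
  rw [← Category.assoc]
  refine (congrArg (· ≫ _) ((toCocycles_ι _ n).trans (cochainPresheafComplex_d A n))).trans ?_
  refine (cochainPullback_coboundary f A n).trans ?_
  exact congrArg (fun k ↦ _ ≫ (presheafPushforward f).map k)
    ((toCocycles_ι _ n).trans (cochainPresheafComplex_d A n)).symm

lemma constToCocycles_cocyclePullback (A : AddCommGrpCat.{u}) :
    constToCocycles Y A ≫ cocyclePullback f A 0 =
      constPushforward f A ≫ (presheafPushforward f).map (constToCocycles X A) := by
  rw [← cancel_mono ((presheafPushforward f).map (kernel.ι _)), Category.assoc, Category.assoc,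
    ← Functor.map_comp]
  refine (congrArg (_ ≫ ·) (cocyclePullback_ι f A 0)).trans ?_
  rw [← Category.assoc]
  refine (congrArg (· ≫ _) constToCocycles_ι).trans
    (Eq.trans ?_ (congrArg (fun k ↦ _ ≫ (presheafPushforward f).map k) constToCocycles_ι).symm)
  refine NatTrans.ext <| funext fun U ↦ AddCommGrpCat.hom_ext <| AddMonoidHom.ext fun a ↦
    AddMonoidHom.ext fun c ↦ ?_
  exact congrArg (· • (a : A)) (SingularChain.augmentation_push (restrictPreimage f U.unop) c)

lemma globalToCocycles_cocyclePullback {A : AddCommGrpCat.{u}} {n : ℕ}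
    (a : SingularChain n Y →+ A) (ha : a.comp (SingularChain.boundary n) = 0)
    (hb : (a.comp (SingularChain.push n f.hom)).comp (SingularChain.boundary n) = 0) :
    globalToCocycles a ha ≫ cocyclePullback f A n =
      constPushforward f _ ≫ (presheafPushforward f).map (globalToCocycles _ hb) := by
  rw [← cancel_mono ((presheafPushforward f).map (kernel.ι _)), Category.assoc, Category.assoc,
    ← Functor.map_comp]
  refine (congrArg (_ ≫ ·) (cocyclePullback_ι f A n)).trans ?_
  rw [← Category.assoc]
  refine (congrArg (· ≫ _) (globalToCocycles_ι a ha)).trans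
    (Eq.trans ?_ (congrArg (fun k ↦ _ ≫ (presheafPushforward f).map k)
      (globalToCocycles_ι _ hb)).symm)
  refine NatTrans.ext <| funext fun U ↦ AddCommGrpCat.hom_ext <|
    AddMonoidHom.ext fun (m : ULift.{u} ℤ) ↦ AddMonoidHom.ext fun c ↦ ?_
  refine congrArg (fun c ↦ m.down • a c) ?_
  exact (SingularChain.push_push (openVal U.unop) (restrictPreimage f U.unop) c).trans
    (SingularChain.push_push f.hom (openVal _) c).symm

variable (hX : SemiLocallyContractible X) (hY : SemiLocallyContractible Y) {A : AddCommGrpCat.{u}}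

lemma cocyclesToConstSheaf_pullback (A : AddCommGrpCat.{u}) :
    sheafTranspose f (cocyclePullback f A 0) ≫ cocyclesToConstSheaf hX A =
      (inverseImage f).map (cocyclesToConstSheaf hY A) ≫ (inverseImageConstIso f).hom.app A := by
  have := isIso_sheafification_map_constToCocycles hY A
  rw [← cancel_epi ((inverseImage f).map ((sheafification Y).map (constToCocycles Y A)))]
  have h₁ := sheafTranspose_naturality f (constPushforward f A) (cocyclePullback f A 0)
    (constToCocycles Y A) (constToCocycles X A) (constToCocycles_cocyclePullback f A)
  have h₂ := congrArg (· ≫ cocyclesToConstSheaf hX A) h₁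
  rw [← Category.assoc]
  refine h₂.trans ?_
  rw [Category.assoc]
  refine (congrArg (_ ≫ ·) (map_constToCocycles_comp hX A)).trans ?_
  refine (Category.comp_id _).trans ((sheafTranspose_constPushforward f A).trans ?_)
  rw [← Category.assoc, ← Functor.map_comp]
  refine (Category.id_comp _).symm.trans (congrArg (· ≫ _) ?_)
  exact ((congrArg _ (map_constToCocycles_comp hY A)).trans ((inverseImage f).map_id _)).symm

/-- The class of a cocycle in sheaf cohomology is natural in the space. -/
lemma cocycleClass_pullback {n : ℕ} (a : SingularChain n Y →+ A)
    (ha : a.comp (SingularChain.boundary n) = 0)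
    (hb : (a.comp (SingularChain.push n f.hom)).comp (SingularChain.boundary n) = 0) :
    cocycleClass hX (a.comp (SingularChain.push n f.hom)) hb =
      constSheafCohomologyPullback f A n (cocycleClass hY a ha) := by
  have h := comp_cocycleToExt_eq_mapExactFunctor (isLocallyExact_cochainPresheafComplex hY A)
    (isLocallyExact_cochainPresheafComplex hX A) (inverseImage f)
    (fun n ↦ sheafTranspose f (cocyclePullback f A n))
    (fun n ↦ sheafTranspose f (cochainPullback f A n))
    (fun n ↦ sheafTranspose_naturality f _ _ _ _ (cocyclePullback_ι f A n).symm)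
    (fun n ↦ sheafTranspose_naturality f _ _ _ _ (toCocycles_cocyclePullback f A n))
    ((inverseImageConstIso f).hom.app A) (cocyclesToConstSheaf_pullback f hX hY A) n
    (sheafTranspose f (constPushforward f _)) (globalToCocycles a ha) (globalToCocycles _ hb)
    (sheafTranspose_naturality f _ _ _ _ (globalToCocycles_cocyclePullback f a ha hb))
  rw [sheafTranspose_constPushforward] at h
  exact ext_eq_of_mk₀_hom_comp ((inverseImageConstIso f).app (AddCommGrpCat.of (ULift.{u} ℤ)))
    _ _ _ h


lemma cyclesVal_cyclesMap (A : AddCommGrpCat.{u}) (n : ℕ) (c : (singularCochains Y A).cycles n) :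
    cyclesVal (X := X) (A := A) (HomologicalComplex.cyclesMap
      ((dualComplex A).map (singularChains.map f).op) n c) =
      (cyclesVal c).comp (SingularChain.push n f.hom) := by
  refine AddMonoidHom.ext fun s ↦ .trans ?_ (toConcrete_map f _ s)
  refine congrArg (fun y ↦ toConcrete y s) ?_
  exact ConcreteCategory.congr_hom (HomologicalComplex.cyclesMap_i
    ((dualComplex A).map (singularChains.map f).op) n) c

lemma cocycleClass_congr {n : ℕ} {a b : SingularChain n X →+ A} (h : a = b)
    (ha : a.comp (SingularChain.boundary n) = 0) (hb : b.comp (SingularChain.boundary n) = 0) :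
    cocycleClass hX a ha = cocycleClass hX b hb := by
  subst h
  rfl

/-- The comparison isomorphism is natural in the space. -/
theorem singularCohomologyPullback_comp_comparison (A : AddCommGrpCat.{u}) (n : ℕ) :
    singularCohomologyPullback f A n ≫ comparison hX A n =
      comparison hY A n ≫ constSheafCohomologyPullback f A n := by
  have h₁ : (singularCochains Y A).homologyπ n ≫ singularCohomologyPullback f A n ≫
      comparison hX A n = HomologicalComplex.cyclesMap
        ((dualComplex A).map (singularChains.map f).op) n ≫ cyclesToSheafCohomology hX A n := by
    rw [singularCohomologyPullback, HomologicalComplex.homologyπ_naturality_assoc]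
    exact congrArg (_ ≫ ·) (homologyπ_comparison hX A n)
  have h₂ : (singularCochains Y A).homologyπ n ≫ comparison hY A n ≫
      constSheafCohomologyPullback f A n =
      cyclesToSheafCohomology hY A n ≫ constSheafCohomologyPullback f A n := by
    rw [← Category.assoc, homologyπ_comparison]
  rw [← cancel_epi ((singularCochains Y A).homologyπ n), h₁, h₂]
  refine AddCommGrpCat.hom_ext <| AddMonoidHom.ext fun c ↦ ?_
  have hc := cyclesVal_cyclesMap f A n c
  have hb : ((cyclesVal c).comp (SingularChain.push n f.hom)).comp (SingularChain.boundary n) = 0 :=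
    hc ▸ cyclesVal_comp_boundary _
  have hX' : cyclesToSheafCohomology hX A n (HomologicalComplex.cyclesMap
      ((dualComplex A).map (singularChains.map f).op) n c) =
        constSheafCohomologyPullback f A n (cocycleClass hY (cyclesVal c) _) :=
    (cyclesToSheafCohomology_apply hX _).trans ((cocycleClass_congr hX hc _ hb).trans
      (cocycleClass_pullback f hX hY (cyclesVal c) (cyclesVal_comp_boundary c) hb))
  have hY' := congrArg (constSheafCohomologyPullback f A n) (cyclesToSheafCohomology_apply hY c)
  exact (ConcreteCategory.comp_apply _ (cyclesToSheafCohomology hX A n) c).trans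
    (hX'.trans (hY'.symm.trans (ConcreteCategory.comp_apply _ _ c).symm))

end SpaceNaturality

theorem mainTheorem1 (n : ℕ) :
    ∃ φ : ∀ X : TopCat.{u}, SemiLocallyContractible X → ∀ A : AddCommGrpCat.{u},
        singularCohomology X A n ≅ constSheafCohomology X A n,
      (∀ (X Y : TopCat.{u}) (hX : SemiLocallyContractible X) (hY : SemiLocallyContractible Y)
        (f : X ⟶ Y) (A : AddCommGrpCat.{u}),
        singularCohomologyPullback f A n ≫ (φ X hX A).hom =
          (φ Y hY A).hom ≫ constSheafCohomologyPullback f A n) ∧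
      (∀ (X : TopCat.{u}) (hX : SemiLocallyContractible X) (A B : AddCommGrpCat.{u}) (g : A ⟶ B),
        singularCohomologyCoeff X g n ≫ (φ X hX B).hom =
          (φ X hX A).hom ≫ constSheafCohomologyCoeff X g n) :=
  ⟨fun X hX A ↦ asIso (comparison hX A n),
    fun _ _ hX hY f A ↦ singularCohomologyPullback_comp_comparison f hX hY A n,
    fun _ hX _ _ g ↦ singularCohomologyCoeff_comp_comparison hX g n⟩
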